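/- Let $G$ be a locally compact Hausdorff group with a left Haar measure $m$ (a nonzero left invariant Borel measure, finite on compact sets and positive on non-empty open sets, such that each Borel set of finite measure is inner regular with respect to compact sets), and write $L^p(G)=L^p(G,m)$ (complex-valued functions) and $ds=dm(s)$. Let $\lambda$ be the left regular representation, $(\lambda(s)f)(t)=f(s^{-1}t)$, on $L^2(G)$, and let $\mathrm{VN}(G)=\lambda(G)''\subseteq B(L^2(G))$. Let $A(G)$ be the Fourier algebra, the predual of $\mathrm{VN}(G)$: it consists of the functions $u(s)=\sum_n\langle\lambda(s)f_n,g_n\rangle$ with $f_n,g_n\in L^2(G)$ and $\sum_n\|f_n\|_2\|g_n\|_2<\infty$, and $\|u\|_A$ is the infimum of $\sum_n\|f_n\|_2\|g_n\|_2$ over all such representations. The pairing of $T\in\mathrm{VN}(G)$ with $u\in A(G)$ is $\langle T,u\rangle=\sum_n\langle Tf_n,g_n\rangle$, which is independent of the representation of $u$. Let $S^1A(G)=A(G)\cap L^1(G)$ with the norm $\|u\|_{S^1A}=\|u\|_A+\|u\|_1$. Put $L^1(G)^\vee=\{f : \check f\in L^1(G)\}$, where $\check f(t)=f(t^{-1})$.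 For $\varphi\in L^\infty(G)$ and $f\in L^2(G)\cap L^1(G)^\vee$ let $\varphi*f(t)=\int_G\varphi(s)f(s^{-1}t)\,ds$. Let $\mathrm{Conv}^\infty(G)$ be the space of all $L^\infty$-convolvers, that is, of all $\varphi\in L^\infty(G)$ such that $$\sup\bigl\{\|\varphi*f\|_2 : f\in L^2(G)\cap L^1(G)^\vee,\ \|f\|_2\le1\bigr\}<\infty .$$ For $\varphi\in\mathrm{Conv}^\infty(G)$ the map $f\mapsto\varphi*f$, $L^2(G)\cap L^1(G)^\vee\to L^2(G)$, extends uniquely to a bounded operator $\Lambda(\varphi)$ on $L^2(G)$; this operator is in $\mathrm{VN}(G)$ and depends linearly on $\varphi$. **Theorem.** There is an isometric isomorphism $$S^1A(G)^*\cong\bigl(\mathrm{VN}(G)\oplus_\infty L^\infty(G)\bigr)\big/\{(\Lambda(\varphi),-\varphi):\varphi\in\mathrm{Conv}^\infty(G)\},$$ under which the class of $(T,\varphi)$ is the functional $u\mapsto\langle T,u\rangle+\int_G\varphi u\,dm$. In particular, $\{(\Lambda(\varphi),-\varphi):\varphi\in\mathrm{Conv}^\infty(G)\}$ is a norm-closed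 subspace of $\mathrm{VN}(G)\oplus_\infty L^\infty(G)$, and $\varphi\mapsto(\Lambda(\varphi),-\varphi)$ is a linear isomorphism of $\mathrm{Conv}^\infty(G)$ onto it. -/

import Mathlib

open MeasureTheory
open scoped ENNReal

noncomputable section

namespace SegalFourier

variable {G : Type*} [Group G] [TopologicalSpace G] [IsTopologicalGroup G]
  [MeasurableSpace G] [BorelSpace G]

/-! ### The left regular representation and `VN(G)` -/

/-- The left regular representation on `L²(G)`: `(λ(s) f)(t) = f (s⁻¹ t)` for almost every `t`. -/
def leftReg (m : Measure G) [m.IsMulLeftInvariant] (s : G) :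
    Lp ℂ 2 m →L[ℂ] Lp ℂ 2 m :=
  (Lp.compMeasurePreservingₗᵢ ℂ (fun t : G => s⁻¹ * t)
    (measurePreserving_mul_left m s⁻¹)).toContinuousLinearMap

/-- `VN(G)`: the von Neumann algebra generated by `λ(G)`, that is, the double commutant of
`λ(G)` together with its adjoints, in the bounded operators on `L²(G)`. -/
def groupVN (m : Measure G) [m.IsMulLeftInvariant] : VonNeumannAlgebra (Lp ℂ 2 m) where
  toStarSubalgebra := StarSubalgebra.centralizer ℂ
    (StarSubalgebra.centralizer ℂ (Set.range (leftReg m)) : Set (Lp ℂ 2 m →L[ℂ] Lp ℂ 2 m))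
  centralizer_centralizer' := by
    change Set.centralizer (Set.centralizer ((StarSubalgebra.centralizer ℂ
      (StarSubalgebra.centralizer ℂ (Set.range (leftReg m)) :
        Set (Lp ℂ 2 m →L[ℂ] Lp ℂ 2 m)) :
        StarSubalgebra ℂ (Lp ℂ 2 m →L[ℂ] Lp ℂ 2 m)) : Set (Lp ℂ 2 m →L[ℂ] Lp ℂ 2 m))) =
      ((StarSubalgebra.centralizer ℂ
      (StarSubalgebra.centralizer ℂ (Set.range (leftReg m)) :
        Set (Lp ℂ 2 m →L[ℂ] Lp ℂ 2 m)) :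
        StarSubalgebra ℂ (Lp ℂ 2 m →L[ℂ] Lp ℂ 2 m)) : Set (Lp ℂ 2 m →L[ℂ] Lp ℂ 2 m))
    rw [StarSubalgebra.coe_centralizer_centralizer, Set.centralizer_centralizer_centralizer]

/-- The elements of `VN(G)`, with the operator norm. -/
abbrev VN (m : Measure G) [m.IsMulLeftInvariant] : Type _ := ↥(groupVN m).toStarSubalgebra

/-! ### The Fourier algebra `A(G)` -/

/-- The coefficient function `s ↦ ⟨λ(s) f | g⟩` (the inner product of Mathlib is linear in its
second variable). -/
def coeffFun (m : Measure G) [m.IsMulLeftInvariant] (f g : Lp ℂ 2 m) (s : G) : ℂ :=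
  inner ℂ g (leftReg m s f)

/-- `u(s) = ∑ₙ ⟨λ(s) fₙ | gₙ⟩` for every `s`, where `∑ₙ ‖fₙ‖ ‖gₙ‖ < ∞`. -/
structure IsFourierRep (m : Measure G) [m.IsMulLeftInvariant]
    (f g : ℕ → Lp ℂ 2 m) (u : G → ℂ) : Prop where
  summable : Summable fun n => ‖f n‖ * ‖g n‖
  hasSum : ∀ s, HasSum (fun n => coeffFun m (f n) (g n) s) (u s)

/-- The Fourier norm: the infimum of `∑ₙ ‖fₙ‖ ‖gₙ‖` over all representations of `u`. -/
def fourierNorm (m : Measure G) [m.IsMulLeftInvariant] (u : G → ℂ) : ℝ :=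
  sInf {r : ℝ | ∃ f g : ℕ → Lp ℂ 2 m, IsFourierRep m f g u ∧ r = ∑' n, ‖f n‖ * ‖g n‖}

section Fourier

variable {m : Measure G} [m.IsMulLeftInvariant]

theorem norm_leftReg (s : G) (f : Lp ℂ 2 m) : ‖leftReg m s f‖ = ‖f‖ :=
  (Lp.compMeasurePreservingₗᵢ ℂ (fun t : G => s⁻¹ * t)
    (measurePreserving_mul_left m s⁻¹)).norm_map f

theorem norm_coeffFun_le (f g : Lp ℂ 2 m) (s : G) : ‖coeffFun m f g s‖ ≤ ‖f‖ * ‖g‖ := by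
  have h := norm_inner_le_norm (𝕜 := ℂ) g (leftReg m s f)
  rw [norm_leftReg, mul_comm] at h
  exact h

theorem IsFourierRep.zero : IsFourierRep m 0 0 0 where
  summable := by simp
  hasSum s := by simp [coeffFun]

theorem IsFourierRep.smul {f g : ℕ → Lp ℂ 2 m} {u : G → ℂ} (h : IsFourierRep m f g u) (c : ℂ) :
    IsFourierRep m (fun n => c • f n) g (c • u) where
  summable := by
    simpa [norm_smul, mul_assoc] using h.summable.mul_left ‖c‖
  hasSum s := by
    simpa [coeffFun, inner_smul_right] using (h.hasSum s).mul_left c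

theorem IsFourierRep.exists_add {f g f' g' : ℕ → Lp ℂ 2 m} {u v : G → ℂ}
    (h : IsFourierRep m f g u) (h' : IsFourierRep m f' g' v) :
    ∃ F K : ℕ → Lp ℂ 2 m, IsFourierRep m F K (u + v) ∧
      ∑' n, ‖F n‖ * ‖K n‖ = ∑' n, ‖f n‖ * ‖g n‖ + ∑' n, ‖f' n‖ * ‖g' n‖ := by
  let e := Equiv.natSumNatEquivNat.symm
  let F : ℕ ⊕ ℕ → Lp ℂ 2 m := Sum.elim f f'
  let K : ℕ ⊕ ℕ → Lp ℂ 2 m := Sum.elim g g'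
  have hn : HasSum (fun i => ‖F i‖ * ‖K i‖)
      (∑' n, ‖f n‖ * ‖g n‖ + ∑' n, ‖f' n‖ * ‖g' n‖) :=
    HasSum.sum h.summable.hasSum h'.summable.hasSum
  have hn' := (e.hasSum_iff (f := fun i => ‖F i‖ * ‖K i‖)).2 hn
  refine ⟨F ∘ e, K ∘ e, ⟨hn'.summable, fun s => ?_⟩, hn'.tsum_eq⟩
  have hs : HasSum (fun i => coeffFun m (F i) (K i) s) (u s + v s) :=
    HasSum.sum (h.hasSum s) (h'.hasSum s)
  exact (e.hasSum_iff (f := fun i => coeffFun m (F i) (K i) s)).2 hs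

theorem IsFourierRep.norm_le {f g : ℕ → Lp ℂ 2 m} {u : G → ℂ} (h : IsFourierRep m f g u)
    (s : G) : ‖u s‖ ≤ ∑' n, ‖f n‖ * ‖g n‖ := by
  rw [← (h.hasSum s).tsum_eq]
  exact tsum_of_norm_bounded h.summable.hasSum fun n => norm_coeffFun_le _ _ _

theorem IsFourierRep.fourierNorm_le {f g : ℕ → Lp ℂ 2 m} {u : G → ℂ}
    (h : IsFourierRep m f g u) : fourierNorm m u ≤ ∑' n, ‖f n‖ * ‖g n‖ := by
  refine csInf_le ⟨0, ?_⟩ ⟨f, g, h, rfl⟩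
  rintro r ⟨f, g, -, rfl⟩
  exact tsum_nonneg fun n => by positivity

theorem le_fourierNorm {u : G → ℂ} (hu : ∃ f g : ℕ → Lp ℂ 2 m, IsFourierRep m f g u) {a : ℝ}
    (ha : ∀ f g : ℕ → Lp ℂ 2 m, IsFourierRep m f g u → a ≤ ∑' n, ‖f n‖ * ‖g n‖) :
    a ≤ fourierNorm m u := by
  obtain ⟨f, g, h⟩ := hu
  refine le_csInf ⟨_, f, g, h, rfl⟩ ?_
  rintro r ⟨f, g, h, rfl⟩
  exact ha f g h

end Fourier

/-- The Fourier algebra `A(G)`, as a space of functions on `G`: the absolutely convergent sums of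
coefficient functions of the left regular representation. These are the functions
`s ↦ ω(λ(s))`, where `ω(T) = ∑ₙ ⟨T fₙ | gₙ⟩` runs through the normal functionals on `VN(G)`, so that
`A(G)` with `fourierNorm` is the predual of `VN(G)`; by a theorem of Eymard, a single coefficient
function is enough for every element. -/
def fourierAlgebra (m : Measure G) [m.IsMulLeftInvariant] : Submodule ℂ (G → ℂ) where
  carrier := {u | ∃ f g : ℕ → Lp ℂ 2 m, IsFourierRep m f g u}
  zero_mem' := ⟨0, 0, IsFourierRep.zero⟩
  add_mem' := by
    rintro u v ⟨f, g, h⟩ ⟨f', g', h'⟩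
    obtain ⟨F, K, H, -⟩ := h.exists_add h'
    exact ⟨F, K, H⟩
  smul_mem' := by
    rintro c u ⟨f, g, h⟩
    exact ⟨_, g, h.smul c⟩

section FourierNorm

variable {m : Measure G} [m.IsMulLeftInvariant]

theorem norm_apply_le_fourierNorm {u : G → ℂ} (hu : u ∈ fourierAlgebra m) (s : G) :
    ‖u s‖ ≤ fourierNorm m u :=
  le_fourierNorm hu fun _ _ h => h.norm_le s

theorem fourierNorm_nonneg (u : G → ℂ) : 0 ≤ fourierNorm m u := by
  refine Real.sInf_nonneg ?_
  rintro r ⟨f, g, -, rfl⟩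
  exact tsum_nonneg fun n => by positivity

theorem fourierNorm_zero : fourierNorm m (0 : G → ℂ) = 0 :=
  le_antisymm (by simpa using (IsFourierRep.zero (m := m)).fourierNorm_le) (fourierNorm_nonneg _)

theorem fourierNorm_add_le {u v : G → ℂ} (hu : u ∈ fourierAlgebra m) (hv : v ∈ fourierAlgebra m) :
    fourierNorm m (u + v) ≤ fourierNorm m u + fourierNorm m v := by
  rw [← sub_le_iff_le_add]
  refine le_fourierNorm hu fun f g h => ?_
  rw [sub_le_comm]
  refine le_fourierNorm hv fun f' g' h' => ?_
  rw [sub_le_iff_le_add']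
  obtain ⟨F, K, H, hFK⟩ := h.exists_add h'
  exact hFK ▸ H.fourierNorm_le

theorem fourierNorm_smul_le (c : ℂ) {u : G → ℂ} (hu : u ∈ fourierAlgebra m) :
    fourierNorm m (c • u) ≤ ‖c‖ * fourierNorm m u := by
  rcases eq_or_ne c 0 with rfl | hc
  · simp [fourierNorm_zero]
  have hc' : 0 < ‖c‖ := norm_pos_iff.2 hc
  rw [← div_le_iff₀' hc']
  refine le_fourierNorm hu fun f g h => ?_
  rw [div_le_iff₀' hc', ← tsum_mul_left]
  simpa [norm_smul, mul_assoc] using (h.smul c).fourierNorm_le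

theorem fourierNorm_neg {u : G → ℂ} (hu : u ∈ fourierAlgebra m) :
    fourierNorm m (-u) = fourierNorm m u := by
  have key : ∀ v : G → ℂ, v ∈ fourierAlgebra m → fourierNorm m (-v) ≤ fourierNorm m v := by
    intro v hv
    simpa using fourierNorm_smul_le (-1) hv
  exact le_antisymm (key u hu) (by simpa using key (-u) (neg_mem hu))

end FourierNorm

/-! ### The Segal algebra `S¹A(G)` -/

/-- `A(G) ∩ L¹(G)` as a space of functions. -/
def segalSubmodule (m : Measure G) [m.IsMulLeftInvariant] : Submodule ℂ (G → ℂ) where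
  carrier := {u | u ∈ fourierAlgebra m ∧ Integrable u m}
  zero_mem' := ⟨zero_mem _, integrable_zero _ _ _⟩
  add_mem' h h' := ⟨add_mem h.1 h'.1, h.2.add h'.2⟩
  smul_mem' c _ h := ⟨Submodule.smul_mem _ c h.1, h.2.smul c⟩

/-- The `1`-Segal Fourier algebra `S¹A(G) = A(G) ∩ L¹(G)`. It is a type of its own, so that it
carries only the norm given below. -/
def S1A (m : Measure G) [m.IsMulLeftInvariant] : Type _ := ↥(segalSubmodule m)

section S1A

variable (m : Measure G) [m.IsMulLeftInvariant]

instance : AddCommGroup (S1A m) := inferInstanceAs (AddCommGroup ↥(segalSubmodule m))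

instance : Module ℂ (S1A m) := inferInstanceAs (Module ℂ ↥(segalSubmodule m))

/-- An element of `S¹A(G)` is a function on `G`. -/
instance : CoeFun (S1A m) (fun _ => G → ℂ) := ⟨fun u => u.1⟩

/-- The norm `‖u‖_{S¹A} = ‖u‖_A + ‖u‖₁`. -/
instance : NormedAddCommGroup (S1A m) := AddGroupNorm.toNormedAddCommGroup
  { toFun := fun u => fourierNorm m u.1 + ∫ s, ‖u.1 s‖ ∂m
    map_zero' := by
      change fourierNorm m (0 : G → ℂ) + ∫ s, ‖(0 : G → ℂ) s‖ ∂m = 0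
      simp [fourierNorm_zero]
    add_le' := by
      intro u v
      change fourierNorm m (u.1 + v.1) + ∫ s, ‖(u.1 + v.1) s‖ ∂m ≤ _
      have h1 := fourierNorm_add_le u.2.1 v.2.1
      have h2 : ∫ s, ‖(u.1 + v.1) s‖ ∂m ≤ ∫ s, ‖u.1 s‖ ∂m + ∫ s, ‖v.1 s‖ ∂m := by
        rw [← integral_add u.2.2.norm v.2.2.norm]
        exact integral_mono (u.2.2.add v.2.2).norm (u.2.2.norm.add v.2.2.norm)
          fun s => norm_add_le _ _
      linarith
    neg' := by
      intro u
      change fourierNorm m (-u.1) + ∫ s, ‖(-u.1) s‖ ∂m = _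
      simp [fourierNorm_neg u.2.1]
    eq_zero_of_map_eq_zero' := by
      intro u hu
      have h1 : 0 ≤ fourierNorm m u.1 := fourierNorm_nonneg _
      have h2 : 0 ≤ ∫ s, ‖u.1 s‖ ∂m := integral_nonneg fun s => norm_nonneg _
      have h3 : fourierNorm m u.1 = 0 := by linarith
      refine Subtype.ext (funext fun s => ?_)
      have h4 := norm_apply_le_fourierNorm u.2.1 s
      rw [h3] at h4
      exact norm_le_zero_iff.1 h4 }

theorem S1A.norm_def (u : S1A m) : ‖u‖ = fourierNorm m u + ∫ s, ‖u s‖ ∂m := rfl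

instance : NormedSpace ℂ (S1A m) where
  norm_smul_le := by
    intro c u
    change fourierNorm m (c • u.1) + ∫ s, ‖(c • u.1) s‖ ∂m ≤
      ‖c‖ * (fourierNorm m u.1 + ∫ s, ‖u.1 s‖ ∂m)
    have h := fourierNorm_smul_le c u.2.1
    simp only [Pi.smul_apply, norm_smul, integral_const_mul, mul_add]
    linarith

end S1A

/-! ### `L^∞`-convolvers -/

/-- The convolution `(φ ∗ f)(t) = ∫ φ(s) f(s⁻¹ t) ds`. -/
def conv (m : Measure G) (φ f : G → ℂ) (t : G) : ℂ := ∫ s, φ s * f (s⁻¹ * t) ∂m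

/-- `f ∈ L²(G) ∩ L¹(G)^∨`: `f` is square integrable and `t ↦ f (t⁻¹)` is integrable. -/
structure IsTestFun (m : Measure G) (f : G → ℂ) : Prop where
  memLp : MemLp f 2 m
  integrable_inv : Integrable (fun t => f t⁻¹) m

/-- `φ` is an `L^∞`-convolver: the supremum of `‖φ ∗ f‖₂` over all `f ∈ L²(G) ∩ L¹(G)^∨` with
`‖f‖₂ ≤ 1` is finite (so that, in particular, each such `φ ∗ f` is in `L²(G)`). -/
def IsConvolver (m : Measure G) (φ : Lp ℂ ∞ m) : Prop :=
  (∀ f, IsTestFun m f → MemLp (conv m φ f) 2 m) ∧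
    ⨆ (f : G → ℂ) (_ : IsTestFun m f) (_ : eLpNorm f 2 m ≤ 1), eLpNorm (conv m φ f) 2 m < ∞

section Conv

variable {m : Measure G} [m.IsMulLeftInvariant]

/-- The integral defining `φ ∗ f` converges absolutely at every point. -/
theorem IsTestFun.integrable_conv {f : G → ℂ} (hf : IsTestFun m f) (φ : Lp ℂ ∞ m) (t : G) :
    Integrable (fun s => φ s * f (s⁻¹ * t)) m := by
  have h : Integrable (fun s => f (s⁻¹ * t)) m := by
    have := hf.integrable_inv.comp_mul_left t⁻¹
    simpa [mul_inv_rev] using this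
  exact memLp_one_iff_integrable.1 ((memLp_one_iff_integrable.2 h).mul' (r := 1) (Lp.memLp φ))

theorem conv_add {f : G → ℂ} (hf : IsTestFun m f) (φ ψ : Lp ℂ ∞ m) :
    conv m (φ + ψ : Lp ℂ ∞ m) f = conv m φ f + conv m ψ f := by
  funext t
  simp only [conv, Pi.add_apply]
  rw [← integral_add (hf.integrable_conv φ t) (hf.integrable_conv ψ t)]
  refine integral_congr_ae ?_
  filter_upwards [Lp.coeFn_add φ ψ] with s hs
  rw [hs, Pi.add_apply, add_mul]

set_option linter.unusedSectionVars false in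
theorem conv_smul (c : ℂ) (φ : Lp ℂ ∞ m) (f : G → ℂ) :
    conv m (c • φ : Lp ℂ ∞ m) f = c • conv m φ f := by
  funext t
  simp only [conv, Pi.smul_apply, smul_eq_mul, ← integral_const_mul]
  refine integral_congr_ae ?_
  filter_upwards [Lp.coeFn_smul c φ] with s hs
  rw [hs, Pi.smul_apply, smul_eq_mul, mul_assoc]

end Conv

/-- `Conv^∞(G)`, the space of all `L^∞`-convolvers. -/
def convInfty (m : Measure G) [m.IsMulLeftInvariant] : Submodule ℂ (Lp ℂ ∞ m) where
  carrier := {φ | IsConvolver m φ}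
  zero_mem' := by
    have h0 : ∀ f, conv m (0 : Lp ℂ ∞ m) f = 0 := fun f => by
      simpa using conv_smul (m := m) 0 0 f
    exact ⟨fun f _ => by rw [h0]; exact MemLp.zero, by simp only [h0]; simp⟩
  add_mem' := by
    rintro φ ψ ⟨h1, h2⟩ ⟨h1', h2'⟩
    refine ⟨fun f hf => ?_, lt_of_le_of_lt ?_ (ENNReal.add_lt_top.2 ⟨h2, h2'⟩)⟩
    · rw [conv_add hf]
      exact (h1 f hf).add (h1' f hf)
    · refine iSup_le fun f => iSup_le fun hf => iSup_le fun hn => ?_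
      rw [conv_add hf]
      refine (eLpNorm_add_le (h1 f hf).1 (h1' f hf).1 one_le_two).trans (add_le_add ?_ ?_)
      · exact le_iSup_of_le f (le_iSup_of_le hf (le_iSup_of_le hn le_rfl))
      · exact le_iSup_of_le f (le_iSup_of_le hf (le_iSup_of_le hn le_rfl))
  smul_mem' := by
    rintro c φ ⟨h1, h2⟩
    refine ⟨fun f hf => ?_, lt_of_le_of_lt ?_ (ENNReal.mul_lt_top (enorm_lt_top (x := c)) h2)⟩
    · rw [conv_smul]
      exact (h1 f hf).const_smul c
    · refine iSup_le fun f => iSup_le fun hf => iSup_le fun hn => ?_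
      rw [conv_smul, eLpNorm_const_smul]
      refine mul_le_mul_right ?_ _
      exact le_iSup_of_le f (le_iSup_of_le hf (le_iSup_of_le hn le_rfl))

/-- The bounded operator `T` on `L²(G)` extends `f ↦ φ ∗ f : L²(G) ∩ L¹(G)^∨ → L²(G)`. -/
def IsConvolutionOperator (m : Measure G) (φ : Lp ℂ ∞ m) (T : Lp ℂ 2 m →L[ℂ] Lp ℂ 2 m) : Prop :=
  ∀ (f : G → ℂ) (hf : IsTestFun m f), ⇑(T (hf.memLp.toLp f)) =ᵐ[m] conv m φ f

/-- The subspace `{(Λ(φ), -φ) : φ ∈ Conv^∞(G)}` of `VN(G) ⊕_∞ L^∞(G)` (the norm of a product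
type is the maximum of the two norms). -/
def convolverGraph (m : Measure G) [m.IsMulLeftInvariant] (Λ : convInfty m →ₗ[ℂ] VN m) :
    Submodule ℂ (VN m × Lp ℂ ∞ m) :=
  LinearMap.range (Λ.prod (-(convInfty m).subtype))

end SegalFourier

end

noncomputable section

set_option linter.unusedSectionVars false

namespace SegalFourier

open Filter Set
open scoped Topology CompactlySupported ComplexConjugate NNReal

section

/-! ### Approximation by continuous functions of compact support in two norms at once -/

section Density

variable {X : Type*} [TopologicalSpace X] [R1Space X] [MeasurableSpace X] [BorelSpace X]

/-! The map sending `(T, φ)` to the functional `u ↦ ⟨T, u⟩ + ∫ φ u` is a contraction. Since `S¹A(G)`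
sits isometrically in the `ℓ¹`-sum of `A(G)` and `L¹(G)`, Hahn–Banach splits a functional into
functionals on `A(G)` and on `L¹(G)` of no larger norm (`exists_dual_decomposition`), and these come
from `VN(G)` (`exists_VN_of_dual`) and from `L^∞(G)` (`exists_Linfty_representation`). So every
functional has a preimage of no larger norm, and the quotient by the kernel is isometric to the
dual. What remains is to identify the kernel with the graph of the convolvers (`ker_segalPairing`);
closedness follows, because the kernel of a bounded map is closed.

If `(T, φ)` is in the kernel, testing on coefficient functions of elements of `C_c(G)` shows that
`T` is convolution by `-φ`. Conversely, one needs `⟨Λ(φ), u⟩ = ∫ φ u` for all `u ∈ A(G) ∩ L¹(G)`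
(`IsConvolutionOperator.tsum_inner_eq`). Such a `u` is bounded, hence in `L²`, so for `k ∈ C_c(G)`
the average `s ↦ ∫ k(x) u(sx) dx` is the single coefficient of `k` and the conjugate of `u`. It is
also represented by the series of `u` with each `fₙ` replaced by `λ(k) fₙ`. As the pairing does not
depend on the representation, `∑ ⟨T λ(k) fₙ, gₙ⟩ = ∫ u (φ ∗ k)`, and `k` then runs through an
approximate identity.

Independence of the representation is a bicommutant argument on an amplification
(`tsum_inner_eq_of_isFourierRep`), and it requires `Λ(φ) ∈ VN(G)`
(`IsConvolutionOperator.mem_groupVN`). To see this, smooth to `λ(h) Λ(φ) λ(k)`, which is convolution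
by the continuous function `c = h ∗ φ ∗ k`. Both `c` and `c*` are square integrable, in the form of
a uniform `L²` bound on the cutoffs of `c`. The cutoffs act by operators `λ(c_K)` commuting with the
commutant of `λ(G)`; the bounds allow passing to the limit, and afterwards `h` and `k` tend to the
identity.

The measure need not be `σ`-finite. Fubini is used only with compact supports, and global statements
are reduced to an open `σ`-compact subgroup and its cosets. -/

theorem innerRegularCompactLTTop_add (μ ν : Measure X) [μ.InnerRegularCompactLTTop]
    [ν.InnerRegularCompactLTTop] : (μ + ν).InnerRegularCompactLTTop := by
  refine ⟨fun U ⟨hU, hfin⟩ r hr => ?_⟩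
  set a := (μ + ν) U with ha
  have hμ : μ U ≠ ∞ := ne_top_of_le_ne_top hfin (by simp [ha])
  have hν : ν U ≠ ∞ := ne_top_of_le_ne_top hfin (by simp [ha])
  have hε : (a - r) / 2 ≠ 0 := (ENNReal.half_pos (tsub_pos_of_lt hr).ne').ne'
  -- Each measure loses at most half of the allowed defect `a - r`, so the union of the two compact
  -- sets loses less than `a - r` for the sum.
  obtain ⟨K, hKU, hK, -, hKμ⟩ := hU.exists_isCompact_isClosed_lt_add hμ hε
  obtain ⟨L, hLU, hL, -, hLν⟩ := hU.exists_isCompact_isClosed_lt_add hν hε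
  refine ⟨K ∪ L, union_subset hKU hLU, hK.union hL, ?_⟩
  by_contra! hle
  have h1 : a < μ K + (a - r) / 2 + (ν L + (a - r) / 2) := by
    rw [ha, Measure.add_apply]
    exact ENNReal.add_lt_add hKμ hLν
  have h2 : μ K + ν L ≤ r := by
    refine le_trans ?_ hle
    rw [Measure.add_apply]
    exact add_le_add (measure_mono subset_union_left) (measure_mono subset_union_right)
  have h3 : μ K + (a - r) / 2 + (ν L + (a - r) / 2) = μ K + ν L + (a - r) := by
    rw [add_add_add_comm, ENNReal.add_halves]
  rw [h3] at h1
  have h4 : μ K + ν L + (a - r) ≤ a := by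
    refine (add_le_add_left h2 _).trans ?_
    rw [add_tsub_cancel_of_le hr.le]
  exact absurd (h1.trans_le h4) (lt_irrefl _)

/-- The tail of an `L^p` function outside of large compact sets is small. -/
theorem exists_isCompact_eLpNorm_indicator_compl_le {μ : Measure X} [μ.InnerRegularCompactLTTop]
    {p : ℝ≥0∞} (hp1 : 1 ≤ p) (hp : p ≠ ∞) {f : X → ℂ} (hf : MemLp f p μ) {ε : ℝ} (hε : 0 < ε) :
    ∃ K, IsCompact K ∧ ∀ K', K ⊆ K' → eLpNorm (K'ᶜ.indicator f) p μ ≤ ENNReal.ofReal ε := by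
  have hε2 : 0 < ε / 2 := by positivity
  obtain ⟨s, hs, hsμ, hsε⟩ := hf.exists_eLpNorm_indicator_compl_lt hp
    (ENNReal.ofReal_pos.2 hε2).ne'
  obtain ⟨δ, hδ, hδε⟩ := hf.eLpNorm_indicator_le hp1 hp hε2
  obtain ⟨K, hKs, hK, hKc, hKδ⟩ := hs.exists_isCompact_isClosed_sdiff_lt hsμ.ne
    (ENNReal.ofReal_pos.2 hδ).ne'
  refine ⟨K, hK, fun K' hK' => ?_⟩
  have h1 : eLpNorm (K'ᶜ.indicator f) p μ ≤ eLpNorm (Kᶜ.indicator f) p μ :=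
    eLpNorm_mono fun x => by
      simp only [indicator, mem_compl_iff]
      split_ifs with h h' h'
      · exact le_rfl
      · exact absurd (hK' (not_not.1 h')) h
      · simp
      · simp
  have h2 : Kᶜ.indicator f = sᶜ.indicator f + (s \ K).indicator f := by
    ext x
    have := @hKs x
    by_cases h : x ∈ s <;> by_cases h' : x ∈ K <;> simp_all
  refine h1.trans ?_
  rw [h2]
  refine (eLpNorm_add_le (hf.1.indicator hs.compl) (hf.1.indicator (hs.diff hKc.measurableSet))
    hp1).trans ?_
  refine (add_le_add hsε.le (hδε _ (hs.diff hKc.measurableSet) hKδ.le)).trans ?_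
  rw [← ENNReal.ofReal_add hε2.le hε2.le, add_halves]

/-- By density of simple functions only indicators matter. A measurable set lies between a compact
set inside it and an open set around that compact set up to small measure, and a Urysohn function
for this pair differs from the indicator only on the small remainder. -/
theorem exists_hasCompactSupport_eLpNorm_two_sub_le [LocallyCompactSpace X] {κ : Measure X}
    [IsFiniteMeasure κ] [κ.InnerRegularCompactLTTop] {f : X → ℂ} (hf : MemLp f 2 κ) {ε : ℝ≥0∞}
    (hε : ε ≠ 0) :
    ∃ g : X → ℂ, eLpNorm (f - g) 2 κ ≤ ε ∧ Continuous g ∧ HasCompactSupport g := by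
  refine hf.induction_dense (by simp) (fun g => Continuous g ∧ HasCompactSupport g) ?_ ?_ ?_ hε
  rotate_left
  · rintro f g ⟨hf, hf'⟩ ⟨hg, hg'⟩
    exact ⟨hf.add hg, hf'.add hg'⟩
  · rintro f ⟨hf, -⟩
    exact hf.aestronglyMeasurable
  intro c s hs hsκ ε hε
  obtain ⟨η, hη0, hη⟩ := exists_eLpNorm_indicator_le (μ := κ) (p := 2) (by simp) c hε
  have hη2 : (η : ℝ≥0∞) / 2 ≠ 0 := (ENNReal.half_pos (by exact_mod_cast hη0.ne')).ne'
  obtain ⟨K, hKs, hK, hKc, hKη⟩ := hs.exists_isCompact_isClosed_sdiff_lt hsκ.ne hη2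
  obtain ⟨U, hKU, hU, hUη⟩ := hK.exists_isOpen_lt_add (μ := κ) hη2
  obtain ⟨χ, hχ1, hχ0, hχc, hχb⟩ := exists_continuous_one_zero_of_isCompact hK
    hU.isClosed_compl (disjoint_compl_right_iff_subset.2 hKU)
  refine ⟨fun x => (χ x : ℂ) * c, ?_, by fun_prop, ?_⟩
  · have h1 : κ ((U \ K) ∪ (s \ K)) ≤ η := by
      refine (measure_union_le _ _).trans ?_
      rw [measure_sdiff hKU hKc.measurableSet.nullMeasurableSet (measure_ne_top _ _)]
      refine (add_le_add (tsub_le_iff_left.2 hUη.le) hKη.le).trans ?_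
      rw [ENNReal.add_halves]
    refine (eLpNorm_mono fun x => ?_).trans (hη _ h1)
    simp only [Pi.sub_apply, indicator]
    by_cases hxK : x ∈ K
    · have : χ x = 1 := hχ1 hxK
      simp [hKs hxK, this]
    · by_cases hxU : x ∈ U
      · have h2 := hχb x
        have h3 : ‖(χ x : ℂ)‖ ≤ 1 := by
          rw [Complex.norm_real, Real.norm_of_nonneg h2.1]; exact h2.2
        have h4 : ‖(χ x : ℂ) - 1‖ ≤ 1 := by
          rw [← Complex.ofReal_one, ← Complex.ofReal_sub, Complex.norm_real, Real.norm_eq_abs,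
            abs_le]
          constructor <;> linarith [h2.1, h2.2]
        have : ‖(χ x : ℂ) * c - c‖ ≤ ‖c‖ := by
          rw [← sub_one_mul, norm_mul]
          exact mul_le_of_le_one_left (norm_nonneg _) h4
        split_ifs with h5 h6 h7
        · exact this
        · exact absurd (Or.inl ⟨hxU, hxK⟩) h6
        · simpa using mul_le_of_le_one_left (norm_nonneg c) h3
        · exact absurd (Or.inl ⟨hxU, hxK⟩) h7
      · have : χ x = 0 := hχ0 hxU
        by_cases hxs : x ∈ s <;> simp [this, hxs, hxK]
  · exact (hχc.comp_left (g := fun r : ℝ => (r : ℂ)) Complex.ofReal_zero).mul_right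

/-- Truncating the values and then the support leaves a bounded function living on a compact set, up
to small errors in both norms. There one finite measure dominates both measures, and since `p, q ≤
2` a single `L²` approximation controls both norms by Hölder. -/
theorem exists_compactlySupported_eLpNorm_sub_le_of_stronglyMeasurable [LocallyCompactSpace X]
    {μ ν : Measure X}
    [μ.InnerRegularCompactLTTop] [ν.InnerRegularCompactLTTop] [IsFiniteMeasureOnCompacts μ]
    [IsFiniteMeasureOnCompacts ν] {p q : ℝ≥0∞} (hp1 : 1 ≤ p) (hp2 : p ≤ 2) (hq1 : 1 ≤ q)
    (hq2 : q ≤ 2) {f : X → ℂ} (hfm : StronglyMeasurable f) (hf : MemLp f p μ) (hf' : MemLp f q ν)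
    {ε : ℝ} (hε : 0 < ε) :
    ∃ g : C_c(X, ℂ), eLpNorm (f - ⇑g) p μ ≤ ENNReal.ofReal ε ∧
      eLpNorm (f - ⇑g) q ν ≤ ENNReal.ofReal ε := by
  have hp : p ≠ ∞ := ne_top_of_le_ne_top (by simp) hp2
  have hq : q ≠ ∞ := ne_top_of_le_ne_top (by simp) hq2
  have hε3 : 0 < ε / 3 := by positivity
  obtain ⟨M₁, hM₁⟩ := hf.eLpNorm_indicator_norm_ge_le hfm hε3
  obtain ⟨M₂, hM₂⟩ := hf'.eLpNorm_indicator_norm_ge_le hfm hε3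
  set M := max M₁ M₂
  set A := {x | ‖f x‖ < M} with hA
  have hAm : MeasurableSet A := measurableSet_lt hfm.norm.measurable measurable_const
  have hA1 : eLpNorm (Aᶜ.indicator f) p μ ≤ ENNReal.ofReal (ε / 3) := by
    refine (eLpNorm_mono fun x => ?_).trans hM₁
    rw [norm_indicator_eq_indicator_norm, norm_indicator_eq_indicator_norm]
    refine indicator_le_indicator_of_subset (fun x hx => ?_) (fun _ => norm_nonneg _) x
    exact (le_max_left _ _).trans (not_lt.1 (show ¬ ‖f x‖ < M from hx))
  have hA2 : eLpNorm (Aᶜ.indicator f) q ν ≤ ENNReal.ofReal (ε / 3) := by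
    refine (eLpNorm_mono fun x => ?_).trans hM₂
    rw [norm_indicator_eq_indicator_norm, norm_indicator_eq_indicator_norm]
    refine indicator_le_indicator_of_subset (fun x hx => ?_) (fun _ => norm_nonneg _) x
    exact (le_max_right _ _).trans (not_lt.1 (show ¬ ‖f x‖ < M from hx))
  set f₁ := A.indicator f
  obtain ⟨K₁, hK₁, hK₁'⟩ := exists_isCompact_eLpNorm_indicator_compl_le hp1 hp
    (hf.indicator hAm) hε3
  obtain ⟨K₂, hK₂, hK₂'⟩ := exists_isCompact_eLpNorm_indicator_compl_le hq1 hq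
    (hf'.indicator hAm) hε3
  -- The closure makes the compact set closed, hence measurable, without a Hausdorff assumption.
  set K := closure (K₁ ∪ K₂)
  have hK : IsCompact K := (hK₁.union hK₂).closure
  have hKm : MeasurableSet K := isClosed_closure.measurableSet
  have hK1 := hK₁' K (subset_union_left.trans subset_closure)
  have hK2 := hK₂' K (subset_union_right.trans subset_closure)
  set f₂ := K.indicator f₁
  have hf₂m : StronglyMeasurable f₂ := (hfm.indicator hAm).indicator hKm
  have hf₂b : ∀ x, ‖f₂ x‖ ≤ max M 0 := by
    intro x
    simp only [f₂, f₁, indicator]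
    split_ifs with h h'
    · exact h'.le.trans (le_max_left _ _)
    all_goals simp
  obtain ⟨L, hL, hKL⟩ := exists_compact_superset hK
  have hLi : MeasurableSet (interior L) := isOpen_interior.measurableSet
  set κ := (μ + ν).restrict (interior L) with hκ
  have hκ1 : μ.restrict (interior L) ≤ κ :=
    Measure.restrict_mono_measure (Measure.le_add_right le_rfl) _
  have hκ2 : ν.restrict (interior L) ≤ κ :=
    Measure.restrict_mono_measure (Measure.le_add_left le_rfl) _
  have hκf : κ univ < ∞ := by
    rw [hκ, Measure.restrict_apply_univ, Measure.add_apply]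
    exact ENNReal.add_lt_top.2 ⟨(measure_mono interior_subset).trans_lt hL.measure_lt_top,
      (measure_mono interior_subset).trans_lt hL.measure_lt_top⟩
  have : IsFiniteMeasure κ := ⟨hκf⟩
  have := innerRegularCompactLTTop_add μ ν
  have : κ.InnerRegularCompactLTTop := Measure.InnerRegularCompactLTTop.restrict _
  have hf₂κ : MemLp f₂ 2 κ := MemLp.of_bound hf₂m.aestronglyMeasurable _ (.of_forall hf₂b)
  -- Hölder constants of the inclusions of `L²(κ)` in `L^p(κ)` and `L^q(κ)`; `δ` is chosen so that
  -- `δ * C` is below `ε / 3`.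
  set C := κ univ ^ (1 / p.toReal - 1 / (2 : ℝ≥0∞).toReal) +
    κ univ ^ (1 / q.toReal - 1 / (2 : ℝ≥0∞).toReal) with hC
  have hexp : ∀ r : ℝ≥0∞, 1 ≤ r → r ≤ 2 → 0 ≤ 1 / r.toReal - 1 / (2 : ℝ≥0∞).toReal := by
    intro r h1 h2
    have h3 : r.toReal ≤ (2 : ℝ≥0∞).toReal := ENNReal.toReal_mono (by simp) h2
    have h4 : 0 < r.toReal := ENNReal.toReal_pos (by positivity) (ne_top_of_le_ne_top (by simp) h2)
    exact sub_nonneg.2 (one_div_le_one_div_of_le h4 h3)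
  have hCt : C ≠ ∞ := ENNReal.add_ne_top.2 ⟨ENNReal.rpow_ne_top_of_nonneg (hexp p hp1 hp2) hκf.ne,
    ENNReal.rpow_ne_top_of_nonneg (hexp q hq1 hq2) hκf.ne⟩
  obtain ⟨δ, hδ, hδC⟩ := ENNReal.exists_nnreal_pos_mul_lt hCt (ENNReal.ofReal_pos.2 hε3).ne'
  obtain ⟨g₀, hg₀, hg₀', hg₀c⟩ := exists_hasCompactSupport_eLpNorm_two_sub_le hf₂κ (ε := δ) (by exact_mod_cast hδ.ne')
  have hg₀m : MemLp g₀ 2 κ := hg₀'.memLp_of_hasCompactSupport hg₀c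
  obtain ⟨χ, hχ1, hχ0, -, hχb⟩ := exists_continuous_one_zero_of_isCompact hK
    isOpen_interior.isClosed_compl (disjoint_compl_right_iff_subset.2 hKL)
  -- `g₀` approximates only inside `interior L`; multiplying by `χ` removes the uncontrolled part
  -- outside and does not increase the error inside.
  let g : C_c(X, ℂ) := ⟨⟨fun x => (χ x : ℂ) * g₀ x, by fun_prop⟩, hg₀c.mul_left⟩
  have hg : ∀ x, ‖(f₂ - ⇑g) x‖ ≤ ‖(interior L).indicator (f₂ - g₀) x‖ := by
    intro x
    by_cases hx : x ∈ interior L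
    · rw [indicator_of_mem hx]
      by_cases hxK : x ∈ K
      · have : χ x = 1 := hχ1 hxK
        simp [g, this]
      · have : f₂ x = 0 := indicator_of_notMem hxK _
        simp only [Pi.sub_apply, this, g, CompactlySupportedContinuousMap.coe_mk,
          ContinuousMap.coe_mk, zero_sub, norm_neg, norm_mul, Complex.norm_real]
        refine mul_le_of_le_one_left (norm_nonneg _) ?_
        rw [Real.norm_of_nonneg (hχb x).1]
        exact (hχb x).2
    · have h1 : f₂ x = 0 := indicator_of_notMem (fun h => hx (hKL h)) _
      have h2 : χ x = 0 := hχ0 hx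
      simp [g, h1, h2]
  have key : ∀ (τ : Measure X) (r : ℝ≥0∞), 1 ≤ r → r ≤ 2 → τ.restrict (interior L) ≤ κ →
      κ univ ^ (1 / r.toReal - 1 / (2 : ℝ≥0∞).toReal) ≤ C →
      eLpNorm (f₂ - ⇑g) r τ ≤ ENNReal.ofReal (ε / 3) := by
    intro τ r h1 h2 h3 h4
    refine (eLpNorm_mono hg).trans ?_
    rw [eLpNorm_indicator_eq_eLpNorm_restrict hLi]
    refine (eLpNorm_mono_measure _ h3).trans ?_
    refine (eLpNorm_le_eLpNorm_mul_rpow_measure_univ h2 (hf₂κ.sub hg₀m).1).trans ?_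
    exact (mul_le_mul' hg₀ h4).trans hδC.le
  have fin : ∀ (τ : Measure X) (r : ℝ≥0∞), 1 ≤ r → 
      eLpNorm (Aᶜ.indicator f) r τ ≤ ENNReal.ofReal (ε / 3) →
      eLpNorm (Kᶜ.indicator f₁) r τ ≤ ENNReal.ofReal (ε / 3) →
      eLpNorm (f₂ - ⇑g) r τ ≤ ENNReal.ofReal (ε / 3) → eLpNorm (f - ⇑g) r τ ≤ ENNReal.ofReal ε := by
    intro τ r hr h1 h2 h3
    have : f - ⇑g = Aᶜ.indicator f + Kᶜ.indicator f₁ + (f₂ - ⇑g) := by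
      have e1 : Aᶜ.indicator f + A.indicator f = f := indicator_compl_add_self _ _
      have e2 : Kᶜ.indicator f₁ + K.indicator f₁ = f₁ := indicator_compl_add_self _ _
      calc f - ⇑g = Aᶜ.indicator f + f₁ - ⇑g := by rw [e1]
        _ = Aᶜ.indicator f + (Kᶜ.indicator f₁ + f₂) - ⇑g := by rw [e2]
        _ = _ := by abel
    rw [this]
    have m1 := (hfm.indicator hAm.compl).aestronglyMeasurable (μ := τ)
    have m2 := ((hfm.indicator hAm).indicator hKm.compl).aestronglyMeasurable (μ := τ)
    have m3 : AEStronglyMeasurable (f₂ - ⇑g) τ :=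
      hf₂m.aestronglyMeasurable.sub g.continuous.aestronglyMeasurable
    refine (eLpNorm_add_le (m1.add m2) m3 hr).trans ?_
    refine (add_le_add ((eLpNorm_add_le m1 m2 hr).trans (add_le_add h1 h2)) h3).trans ?_
    rw [← ENNReal.ofReal_add hε3.le hε3.le, ← ENNReal.ofReal_add (by positivity) hε3.le]
    refine ENNReal.ofReal_le_ofReal (by linarith)
  exact ⟨g, fin μ p hp1 hA1 hK1 (key μ p hp1 hp2 hκ1 le_self_add),
    fin ν q hq1 hA2 hK2 (key ν q hq1 hq2 hκ2 le_add_self)⟩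

/-- Continuous functions of compact support approximate a function simultaneously in
`L^p(μ)` and in `L^q(ν)`. -/
theorem exists_compactlySupported_eLpNorm_sub_le [LocallyCompactSpace X] {μ ν : Measure X}
    [μ.InnerRegularCompactLTTop] [ν.InnerRegularCompactLTTop] [IsFiniteMeasureOnCompacts μ]
    [IsFiniteMeasureOnCompacts ν] {p q : ℝ≥0∞} (hp1 : 1 ≤ p) (hp2 : p ≤ 2) (hq1 : 1 ≤ q)
    (hq2 : q ≤ 2) {f : X → ℂ} (hf : MemLp f p μ) (hf' : MemLp f q ν) {ε : ℝ} (hε : 0 < ε) :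
    ∃ g : C_c(X, ℂ), eLpNorm (f - ⇑g) p μ ≤ ENNReal.ofReal ε ∧
      eLpNorm (f - ⇑g) q ν ≤ ENNReal.ofReal ε := by
  have hm : AEStronglyMeasurable f (μ + ν) := hf.1.add_measure hf'.1
  have h := hm.ae_eq_mk
  have hμ : f =ᵐ[μ] hm.mk f := h.filter_mono (ae_mono (Measure.le_add_right le_rfl))
  have hν : f =ᵐ[ν] hm.mk f := h.filter_mono (ae_mono (Measure.le_add_left le_rfl))
  obtain ⟨g, hg, hg'⟩ := exists_compactlySupported_eLpNorm_sub_le_of_stronglyMeasurable hp1 hp2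
    hq1 hq2 hm.stronglyMeasurable_mk ((memLp_congr_ae hμ).1 hf) ((memLp_congr_ae hν).1 hf') hε
  exact ⟨g, (eLpNorm_congr_ae (hμ.sub .rfl)).trans_le hg,
    (eLpNorm_congr_ae (hν.sub .rfl)).trans_le hg'⟩

end Density

end

section

variable {G : Type*} [Group G] [TopologicalSpace G] [IsTopologicalGroup G]
  [MeasurableSpace G] [BorelSpace G]

/-! ### Continuous functions of compact support -/

theorem hasCompactSupport_of_forall_mem {F : G × G → ℂ} {K L : Set G} (hK : IsCompact K)
    (hL : IsCompact L) (h : ∀ x y, F (x, y) ≠ 0 → x ∈ K ∧ y ∈ L) : HasCompactSupport F :=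
  HasCompactSupport.intro (hK.prod hL) fun p hp => by
    by_contra hne
    exact hp (h p.1 p.2 hne)

theorem mem_tsupport_of_ne_zero {X : Type*} [TopologicalSpace X] {f : X → ℂ} {x : X}
    (h : f x ≠ 0) : x ∈ tsupport f :=
  subset_tsupport _ h

theorem memLp_compactlySupported {X : Type*} [TopologicalSpace X] [R1Space X] [MeasurableSpace X]
    [BorelSpace X] (μ : Measure X)
    [IsFiniteMeasureOnCompacts μ] (f : C_c(X, ℂ)) (p : ℝ≥0∞) : MemLp f p μ :=
  f.continuous.memLp_of_hasCompactSupport f.hasCompactSupport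

theorem integrable_compactlySupported {X : Type*} [TopologicalSpace X] [R1Space X]
    [MeasurableSpace X] [BorelSpace X] (μ : Measure X)
    [IsFiniteMeasureOnCompacts μ] (f : C_c(X, ℂ)) : Integrable f μ :=
  f.continuous.integrable_of_hasCompactSupport f.hasCompactSupport

theorem Linfty.ae_norm_le {X : Type*} [MeasurableSpace X] {μ : Measure X} (φ : Lp ℂ ∞ μ) :
    ∀ᵐ x ∂μ, ‖φ x‖ ≤ ‖φ‖ := by
  have h := enorm_ae_le_eLpNormEssSup φ μ
  filter_upwards [h] with x hx
  rw [Lp.norm_def, eLpNorm_exponent_top]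
  have h2 : eLpNormEssSup φ μ ≠ ∞ := by
    simpa [eLpNorm_exponent_top] using (Lp.memLp φ).2.ne
  simpa using ENNReal.toReal_mono h2 hx

theorem integrable_Linfty_mul {X : Type*} [MeasurableSpace X] {μ : Measure X} (φ : Lp ℂ ∞ μ)
    {f : X → ℂ} (hf : Integrable f μ) : Integrable (fun x => φ x * f x) μ :=
  hf.bdd_mul (Lp.aestronglyMeasurable φ) (Linfty.ae_norm_le φ)

theorem norm_integral_Linfty_mul_le {X : Type*} [MeasurableSpace X] {μ : Measure X}
    (φ : Lp ℂ ∞ μ) {f : X → ℂ} (hf : Integrable f μ) :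
    ‖∫ x, φ x * f x ∂μ‖ ≤ ‖φ‖ * ∫ x, ‖f x‖ ∂μ := by
  rw [← integral_const_mul]
  refine norm_integral_le_of_norm_le (hf.norm.const_mul _) ?_
  filter_upwards [Linfty.ae_norm_le φ] with x hx
  rw [norm_mul]
  exact mul_le_mul_of_nonneg_right hx (norm_nonneg _)

/-- Fubini's theorem for the product of a function of `L^∞` and a continuous function of compact
support; no `σ`-finiteness is needed. -/
theorem integral_Linfty_mul_swap {μ ν : Measure G} [IsFiniteMeasureOnCompacts μ]
    [IsFiniteMeasureOnCompacts ν] (φ : Lp ℂ ∞ μ) {F : G → G → ℂ} (hF : Continuous F.uncurry)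
    (hF' : HasCompactSupport F.uncurry) :
    ∫ s, φ s * ∫ t, F s t ∂ν ∂μ = ∫ t, ∫ s, φ s * F s t ∂μ ∂ν := by
  -- The projections of the support are compact, hence of finite measure, so the usual Fubini
  -- theorem applies to the restricted measures.
  let U := Prod.fst '' (tsupport F.uncurry)
  have : Fact (μ U < ∞) := ⟨(IsCompact.image hF' continuous_fst).measure_lt_top⟩
  let V := Prod.snd '' (tsupport F.uncurry)
  have : Fact (ν V < ∞) := ⟨(IsCompact.image hF' continuous_snd).measure_lt_top⟩
  have hU : ∀ x y, F x y ≠ 0 → x ∈ U := fun x y h =>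
    mem_image_of_mem Prod.fst (subset_tsupport F.uncurry (show F.uncurry (x, y) ≠ 0 from h))
  have hV : ∀ x y, F x y ≠ 0 → y ∈ V := fun x y h =>
    mem_image_of_mem Prod.snd (subset_tsupport F.uncurry (show F.uncurry (x, y) ≠ 0 from h))
  calc
  ∫ s, φ s * ∫ t, F s t ∂ν ∂μ = ∫ s, ∫ t, φ s * F s t ∂ν ∂μ := by simp_rw [integral_const_mul]
  _ = ∫ s, ∫ t in V, φ s * F s t ∂ν ∂μ := by
    congr 1 with x
    refine (setIntegral_eq_integral_of_forall_compl_eq_zero fun y hy => ?_).symm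
    rw [not_imp_comm.1 (hV x y) hy, mul_zero]
  _ = ∫ s in U, ∫ t in V, φ s * F s t ∂ν ∂μ := by
    refine (setIntegral_eq_integral_of_forall_compl_eq_zero fun x hx => ?_).symm
    have : ∀ y, F x y = 0 := fun y => not_imp_comm.1 (hU x y) hx
    simp [this]
  _ = ∫ t in V, ∫ s in U, φ s * F s t ∂μ ∂ν := by
    refine integral_integral_swap ?_
    have h1 : Integrable F.uncurry ((μ.restrict U).prod (ν.restrict V)) := by
      -- Without second countability the Borel sets of the product may exceed the product
      -- `σ`-algebra; compact support is what gives measurability for the latter.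
      refine ⟨(hF'.stronglyMeasurable_of_prod hF).aestronglyMeasurable, ?_⟩
      obtain ⟨C, hC⟩ : ∃ C, ∀ p, ‖F.uncurry p‖ ≤ C := hF.bounded_above_of_compact_support hF'
      exact .of_bounded (C := C) (.of_forall hC)
    refine h1.bdd_mul (c := ‖φ‖) (f := fun p => φ p.1) ?_ ?_
    · exact ((Lp.stronglyMeasurable φ).comp_measurable measurable_fst).aestronglyMeasurable
    · exact Measure.quasiMeasurePreserving_fst.ae (ae_restrict_of_ae (Linfty.ae_norm_le φ))
  _ = ∫ t, ∫ s in U, φ s * F s t ∂μ ∂ν := by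
    refine setIntegral_eq_integral_of_forall_compl_eq_zero fun y hy => ?_
    have : ∀ x, F x y = 0 := fun x => not_imp_comm.1 (hV x y) hy
    simp [this]
  _ = ∫ t, ∫ s, φ s * F s t ∂μ ∂ν := by
    congr 1 with y
    refine setIntegral_eq_integral_of_forall_compl_eq_zero fun x hx => ?_
    rw [not_imp_comm.1 (hU x y) hx, mul_zero]

/-! ### The dense image of `C_c(G)` in `L²(G)` -/

section L2

variable (m : Measure G) [IsFiniteMeasureOnCompacts m]

/-- The inclusion of the continuous functions of compact support in `L²`. -/
def toL2 : C_c(G, ℂ) →ₗ[ℂ] Lp ℂ 2 m where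
  toFun f := (memLp_compactlySupported m f 2).toLp f
  map_add' _ _ := rfl
  map_smul' _ _ := rfl

theorem coeFn_toL2 (f : C_c(G, ℂ)) : ⇑(toL2 m f) =ᵐ[m] f :=
  (memLp_compactlySupported m f 2).coeFn_toLp

theorem norm_toL2_sub_toLp_le {f : G → ℂ} (hf : MemLp f 2 m) (g : C_c(G, ℂ)) {ε : ℝ} (hε : 0 ≤ ε)
    (h : eLpNorm (f - ⇑g) 2 m ≤ ENNReal.ofReal ε) : ‖hf.toLp f - toL2 m g‖ ≤ ε := by
  have : hf.toLp f - toL2 m g = (hf.sub (memLp_compactlySupported m g 2)).toLp _ := rfl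
  rw [this, Lp.norm_toLp]
  exact ENNReal.toReal_le_of_le_ofReal hε h

theorem denseRange_toL2 [LocallyCompactSpace G] [m.InnerRegularCompactLTTop] :
    DenseRange (toL2 m) := by
  intro x
  rw [Metric.mem_closure_range_iff]
  intro ε hε
  obtain ⟨g, hg, -⟩ := exists_compactlySupported_eLpNorm_sub_le (μ := m) (ν := m) (p := 2) (q := 2)
    one_le_two le_rfl one_le_two le_rfl (Lp.memLp x) (Lp.memLp x) (half_pos hε)
  refine ⟨g, ?_⟩
  have := norm_toL2_sub_toLp_le m (Lp.memLp x) g (half_pos hε).le hg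
  rw [Lp.toLp_coeFn] at this
  rw [dist_eq_norm]
  linarith

variable {m}

theorem inner_toL2_left (f : C_c(G, ℂ)) (x : Lp ℂ 2 m) :
    inner ℂ (toL2 m f) x = ∫ t, conj (f t) * x t ∂m := by
  rw [L2.inner_def]
  refine integral_congr_ae ?_
  filter_upwards [coeFn_toL2 m f] with t ht
  rw [ht, RCLike.inner_apply, mul_comm]

theorem inner_toL2 (f g : C_c(G, ℂ)) :
    inner ℂ (toL2 m f) (toL2 m g) = ∫ t, conj (f t) * g t ∂m := by
  rw [inner_toL2_left]
  refine integral_congr_ae ?_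
  filter_upwards [coeFn_toL2 m g] with t ht
  rw [ht]

theorem inner_toL2_toLp (f : C_c(G, ℂ)) {g : G → ℂ} (hg : MemLp g 2 m) :
    inner ℂ (toL2 m f) (hg.toLp g) = ∫ t, conj (f t) * g t ∂m := by
  rw [inner_toL2_left]
  refine integral_congr_ae ?_
  filter_upwards [hg.coeFn_toLp] with t ht
  rw [ht]

theorem ext_inner_toL2 [LocallyCompactSpace G] [m.InnerRegularCompactLTTop] {x y : Lp ℂ 2 m}
    (h : ∀ f : C_c(G, ℂ), inner ℂ (toL2 m f) x = inner ℂ (toL2 m f) y) : x = y :=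
  ext_inner_left ℂ fun z => (denseRange_toL2 m).induction_on z
    (isClosed_eq (by fun_prop) (by fun_prop)) h

theorem norm_le_of_forall_inner_toL2 [LocallyCompactSpace G] [m.InnerRegularCompactLTTop]
    {x : Lp ℂ 2 m} {C : ℝ} (hC : 0 ≤ C)
    (h : ∀ f : C_c(G, ℂ), ‖inner ℂ (toL2 m f) x‖ ≤ C * ‖toL2 m f‖) : ‖x‖ ≤ C := by
  have h1 : ∀ z : Lp ℂ 2 m, ‖inner ℂ z x‖ ≤ C * ‖z‖ := fun z =>
    (denseRange_toL2 m).induction_on z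
      (isClosed_le (by fun_prop) (by fun_prop)) h
  have h2 := h1 x
  rw [inner_self_eq_norm_sq_to_K, norm_pow] at h2
  simp only [Complex.coe_algebraMap, Complex.norm_real, norm_norm] at h2
  rcases (norm_nonneg x).eq_or_lt' with h3 | h3
  · rwa [h3]
  · nlinarith

variable [m.IsMulLeftInvariant]

/-! ### Translations and coefficient functions -/

/-- Left translation of a continuous function of compact support. -/
def ltrans (s : G) (f : C_c(G, ℂ)) : C_c(G, ℂ) :=
  ⟨⟨fun t => f (s⁻¹ * t), by fun_prop⟩,
    f.hasCompactSupport.comp_homeomorph (Homeomorph.mulLeft s⁻¹)⟩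

@[simp]
theorem ltrans_apply (s : G) (f : C_c(G, ℂ)) (t : G) : ltrans s f t = f (s⁻¹ * t) := rfl

theorem leftReg_toL2 (s : G) (f : C_c(G, ℂ)) : leftReg m s (toL2 m f) = toL2 m (ltrans s f) := rfl

theorem leftReg_mul_apply (s t : G) (x : Lp ℂ 2 m) :
    leftReg m (s * t) x = leftReg m s (leftReg m t x) := by
  have h := Lp.compMeasurePreserving_comp_apply x (measurePreserving_mul_left m t⁻¹)
    (measurePreserving_mul_left m s⁻¹)
  refine Eq.trans ?_ h
  change Lp.compMeasurePreserving _ _ _ = _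
  congr 2
  funext y
  simp [mul_assoc]

theorem leftReg_one_apply (x : Lp ℂ 2 m) : leftReg m 1 x = x := by
  refine Eq.trans ?_ (Lp.compMeasurePreserving_id_apply x)
  change Lp.compMeasurePreserving _ _ _ = _
  congr 2
  funext y
  simp

theorem inner_leftReg_leftReg (s : G) (x y : Lp ℂ 2 m) :
    inner ℂ (leftReg m s x) (leftReg m s y) = inner ℂ x y :=
  (Lp.compMeasurePreservingₗᵢ ℂ (fun t : G => s⁻¹ * t)
    (measurePreserving_mul_left m s⁻¹)).inner_map_map x y

theorem inner_leftReg_right (s : G) (x y : Lp ℂ 2 m) :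
    inner ℂ x (leftReg m s y) = inner ℂ (leftReg m s⁻¹ x) y := by
  rw [← inner_leftReg_leftReg s⁻¹ x, ← leftReg_mul_apply, inv_mul_cancel, leftReg_one_apply]

theorem adjoint_leftReg (s : G) :
    ContinuousLinearMap.adjoint (leftReg m s) = leftReg m s⁻¹ := by
  refine ((ContinuousLinearMap.eq_adjoint_iff _ _).2 fun x y => ?_).symm
  rw [inner_leftReg_right]

theorem continuous_leftReg [LocallyCompactSpace G] [m.InnerRegularCompactLTTop] (x : Lp ℂ 2 m) :
    Continuous fun s => leftReg m s x := by
  let g : C(G, C(G, G)) := (ContinuousMap.mk (fun a : G × G => a.1⁻¹ * a.2) (by fun_prop)).curry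
  exact continuous_const.compMeasurePreservingLp g.continuous
    (fun s => measurePreserving_mul_left m s⁻¹) (by simp)

theorem inner_toL2_leftReg_toL2 (g f : C_c(G, ℂ)) (s : G) :
    inner ℂ (toL2 m g) (leftReg m s (toL2 m f)) = ∫ t, conj (g t) * f (s⁻¹ * t) ∂m := by
  rw [leftReg_toL2, inner_toL2]
  rfl

theorem continuous_coeffFun [LocallyCompactSpace G] [m.InnerRegularCompactLTTop]
    (x y : Lp ℂ 2 m) : Continuous (coeffFun m x y) :=
  continuous_const.inner (continuous_leftReg x)

theorem hasCompactSupport_mul_ltrans (g f : C_c(G, ℂ)) :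
    HasCompactSupport fun p : G × G => g p.2 * f (p.1⁻¹ * p.2) := by
  refine hasCompactSupport_of_forall_mem
    (K := (fun p : G × G => p.1 * p.2⁻¹) '' (tsupport g ×ˢ tsupport f))
    ((g.hasCompactSupport.prod f.hasCompactSupport).image (by fun_prop)) g.hasCompactSupport
    fun x y h => ?_
  have h1 := mem_tsupport_of_ne_zero (left_ne_zero_of_mul h)
  have h2 := mem_tsupport_of_ne_zero (right_ne_zero_of_mul h)
  exact ⟨⟨(y, x⁻¹ * y), ⟨h1, h2⟩, by simp⟩, h1⟩

/-- The coefficient function of two continuous functions of compact support. -/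
def coeffCc (m : Measure G) [IsFiniteMeasureOnCompacts m] [m.IsMulLeftInvariant]
    [LocallyCompactSpace G] [m.InnerRegularCompactLTTop] (f g : C_c(G, ℂ)) : C_c(G, ℂ) :=
  ⟨⟨coeffFun m (toL2 m f) (toL2 m g), continuous_coeffFun _ _⟩, by
    refine HasCompactSupport.intro
      -- A nonzero integrand at `s` has `t` in the support of `g` and `s⁻¹ * t` in that of `f`, so
      -- `s` is a quotient of such points.
      (K := (fun p : G × G => p.1 * p.2⁻¹) '' (tsupport g ×ˢ tsupport f))
      ((g.hasCompactSupport.prod f.hasCompactSupport).image (by fun_prop)) fun s hs => ?_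
    rw [ContinuousMap.toFun_eq_coe, ContinuousMap.coe_mk, coeffFun, inner_toL2_leftReg_toL2]
    refine integral_eq_zero_of_ae (.of_forall fun t => ?_)
    by_contra h
    have h1 := mem_tsupport_of_ne_zero
      ((map_ne_zero (starRingEnd ℂ)).1 (left_ne_zero_of_mul h))
    have h2 := mem_tsupport_of_ne_zero (right_ne_zero_of_mul h)
    exact hs ⟨(t, s⁻¹ * t), ⟨h1, h2⟩, by simp⟩⟩

end L2

end

section

variable {G : Type*} [Group G] [TopologicalSpace G] [IsTopologicalGroup G]
  [MeasurableSpace G] [BorelSpace G] {m : Measure G} [IsFiniteMeasureOnCompacts m]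

/-! ### Approximate identities -/

theorem integrable_smul_of_continuous {E : Type*} [NormedAddCommGroup E] [NormedSpace ℂ E]
    (k : C_c(G, ℂ)) {F : G → E} (hF : Continuous F) : Integrable (fun x => k x • F x) m :=
  (k.continuous.smul hF).integrable_of_hasCompactSupport k.hasCompactSupport.smul_right

/-- `k ≥ 0` is supported in `V` and `∫ k = 1`. -/
structure IsBump (m : Measure G) (V : Set G) (k : C_c(G, ℂ)) : Prop where
  nonneg : ∀ x, k x = ‖k x‖
  eq_zero : ∀ x ∉ V, k x = 0
  integral_norm : ∫ x, ‖k x‖ ∂m = 1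

/-- The filter of all approximate identities at `1`. -/
def bumpFilter (m : Measure G) : Filter C_c(G, ℂ) :=
  (𝓝 (1 : G)).lift' fun V => {k | IsBump m V k}

theorem monotone_isBump : Monotone fun V : Set G => {k | IsBump m V k} := fun _ _ h _ hk =>
  ⟨hk.nonneg, fun x hx => hk.eq_zero x fun hx' => hx (h hx'), hk.integral_norm⟩

theorem eventually_isBump {V : Set G} (hV : V ∈ 𝓝 (1 : G)) :
    ∀ᶠ k in bumpFilter m, IsBump m V k :=
  mem_lift' hV

theorem IsBump.integral {V : Set G} {k : C_c(G, ℂ)} (hk : IsBump m V k) : ∫ x, k x ∂m = 1 := by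
  have : ∀ x, k x = ((‖k x‖ : ℝ) : ℂ) := hk.nonneg
  rw [integral_congr_ae (.of_forall this), integral_complex_ofReal, hk.integral_norm, Complex.ofReal_one]

theorem exists_isBump [LocallyCompactSpace G] [m.IsOpenPosMeasure] {V : Set G}
    (hV : V ∈ 𝓝 (1 : G)) : ∃ k, IsBump m V k := by
  obtain ⟨χ, hχ1, hχ0, hχc, hχb⟩ := exists_continuous_one_zero_of_isCompact
    (isCompact_singleton (x := (1 : G))) (isOpen_interior (s := V)).isClosed_compl
    (disjoint_compl_right_iff_subset.2 (singleton_subset_iff.2 (mem_interior_iff_mem_nhds.2 hV)))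
  have hpos : 0 < ∫ x, χ x ∂m :=
    χ.continuous.integral_pos_of_hasCompactSupport_nonneg_nonzero hχc (fun x => (hχb x).1)
      (x := 1) (by rw [hχ1 rfl]; simp)
  set c := ∫ x, χ x ∂m
  have hn : ∀ x, ‖((c⁻¹ * χ x : ℝ) : ℂ)‖ = c⁻¹ * χ x := fun x => by
    rw [Complex.norm_real, Real.norm_of_nonneg]
    have := (hχb x).1
    positivity
  refine ⟨⟨⟨fun x => ((c⁻¹ * χ x : ℝ) : ℂ), by fun_prop⟩, ?_⟩, ?_, ?_, ?_⟩
  · exact (hχc.mul_left (f := fun _ => c⁻¹)).comp_left (g := fun r : ℝ => (r : ℂ))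
      Complex.ofReal_zero
  · intro x
    simp only [CompactlySupportedContinuousMap.coe_mk, ContinuousMap.coe_mk, hn]
  · intro x hx
    have : χ x = 0 := hχ0 fun h => hx (interior_subset h)
    simp [this]
  · simp only [CompactlySupportedContinuousMap.coe_mk, ContinuousMap.coe_mk, hn]
    rw [integral_const_mul, inv_mul_cancel₀ hpos.ne']

instance bumpFilter_neBot [LocallyCompactSpace G] [m.IsOpenPosMeasure] : (bumpFilter m).NeBot :=
  (lift'_neBot_iff monotone_isBump).2 fun _ hV => exists_isBump hV

/-- Stated for vector-valued `F` so that it covers both the strong convergence `λ(k) → 1`, with `F`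
an orbit of the representation, and scalar limits. -/
theorem tendsto_integral_bump {E : Type*} [NormedAddCommGroup E] [NormedSpace ℂ E]
    [CompleteSpace E] {F : G → E} (hF : Continuous F) :
    Tendsto (fun k : C_c(G, ℂ) => ∫ x, k x • F x ∂m) (bumpFilter m) (𝓝 (F 1)) := by
  rw [Metric.tendsto_nhds]
  intro ε hε
  have hV : {x | dist (F x) (F 1) < ε / 2} ∈ 𝓝 (1 : G) :=
    hF.continuousAt.eventually (Metric.ball_mem_nhds (F 1) (half_pos hε))
  filter_upwards [eventually_isBump (m := m) hV] with k hk
  have h1 : F 1 = ∫ x, k x • F 1 ∂m := by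
    rw [integral_smul_const, hk.integral, one_smul]
  rw [dist_eq_norm, h1, ← integral_sub (integrable_smul_of_continuous k hF)
    (integrable_smul_of_continuous k continuous_const)]
  have h2 : ∀ x, ‖k x • F x - k x • F 1‖ ≤ ‖k x‖ * (ε / 2) := fun x => by
    rw [← smul_sub, norm_smul]
    by_cases hx : x ∈ {x | dist (F x) (F 1) < ε / 2}
    · rw [← dist_eq_norm]
      exact mul_le_mul_of_nonneg_left (le_of_lt hx) (norm_nonneg _)
    · simp [hk.eq_zero x hx]
  refine (norm_integral_le_of_norm_le
    ((integrable_compactlySupported m k).norm.mul_const _) (.of_forall h2)).trans_lt ?_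
  rw [integral_mul_const, hk.integral_norm]
  linarith

/-! ### Convolution of continuous functions -/

/-- Convolution of a continuous function of compact support with a continuous function. -/
def cconv (m : Measure G) (k a : G → ℂ) (t : G) : ℂ := ∫ x, k x * a (x⁻¹ * t) ∂m

theorem continuous_cconv (k : C_c(G, ℂ)) {a : G → ℂ} (ha : Continuous a) :
    Continuous (cconv m k a) := by
  rw [← continuousOn_univ]
  refine continuousOn_integral_of_compact_support (k := tsupport k) k.hasCompactSupport
    (f := fun t x => k x * a (x⁻¹ * t)) (Continuous.continuousOn (by fun_prop)) fun t x _ hx => ?_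
  rw [image_eq_zero_of_notMem_tsupport hx, zero_mul]

/-- `∫ (k ∗ a) d = ∫ k(x) ∫ a(x⁻¹t) d(t)`. -/
theorem integral_cconv_mul (k : C_c(G, ℂ)) {a : G → ℂ} (ha : Continuous a) (d : C_c(G, ℂ)) :
    ∫ t, cconv m k a t * d t ∂m = ∫ x, k x * ∫ t, a (x⁻¹ * t) * d t ∂m ∂m := by
  have h : ∀ t, cconv m k a t * d t = ∫ x, k x * (a (x⁻¹ * t) * d t) ∂m := fun t => by
    rw [cconv, ← integral_mul_const]
    simp only [mul_assoc]
  simp only [h, ← integral_const_mul]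
  refine (integral_integral_swap_of_hasCompactSupport (by fun_prop)
    (hasCompactSupport_of_forall_mem d.hasCompactSupport k.hasCompactSupport fun t x hne => ?_))
  exact ⟨mem_tsupport_of_ne_zero (right_ne_zero_of_mul (right_ne_zero_of_mul hne)),
    mem_tsupport_of_ne_zero (left_ne_zero_of_mul hne)⟩

theorem hasCompactSupport_cconv (k f : C_c(G, ℂ)) : HasCompactSupport (cconv m k f) := by
  refine HasCompactSupport.intro (K := (fun p : G × G => p.1 * p.2) '' (tsupport k ×ˢ tsupport f))
    ((k.hasCompactSupport.prod f.hasCompactSupport).image (by fun_prop)) fun t ht => ?_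
  refine integral_eq_zero_of_ae (.of_forall fun x => ?_)
  by_contra h
  exact ht ⟨(x, x⁻¹ * t), ⟨mem_tsupport_of_ne_zero (left_ne_zero_of_mul h),
    mem_tsupport_of_ne_zero (right_ne_zero_of_mul h)⟩, by simp⟩

/-- The convolution of two continuous functions of compact support. -/
def ccConv (m : Measure G) [IsFiniteMeasureOnCompacts m] (k f : C_c(G, ℂ)) : C_c(G, ℂ) :=
  ⟨⟨cconv m k f, continuous_cconv k f.continuous⟩, hasCompactSupport_cconv k f⟩

@[simp]
theorem coe_ccConv (k f : C_c(G, ℂ)) : ⇑(ccConv m k f) = cconv m k f := rfl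

/-! ### The operators `λ(k) = ∫ k(x) λ(x) dx` -/

variable [m.IsMulLeftInvariant] [LocallyCompactSpace G] [m.InnerRegularCompactLTTop]

theorem integrable_smul_leftReg (k : C_c(G, ℂ)) (f : Lp ℂ 2 m) :
    Integrable (fun x => k x • leftReg m x f) m :=
  integrable_smul_of_continuous k (continuous_leftReg f)

/-- The operator `λ(k) = ∫ k(x) λ(x) dx` of left convolution by `k`. -/
def leftConv (m : Measure G) [IsFiniteMeasureOnCompacts m] [m.IsMulLeftInvariant]
    [m.InnerRegularCompactLTTop] (k : C_c(G, ℂ)) : Lp ℂ 2 m →L[ℂ] Lp ℂ 2 m :=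
  LinearMap.mkContinuous
    { toFun := fun f => ∫ x, k x • leftReg m x f ∂m
      map_add' := fun f g => by
        rw [← integral_add (integrable_smul_leftReg k f) (integrable_smul_leftReg k g)]
        simp only [map_add, smul_add]
      map_smul' := fun c f => by
        rw [RingHom.id_apply, ← integral_smul]
        simp only [map_smul, smul_comm c] }
    (∫ x, ‖k x‖ ∂m) fun f => by
      rw [← integral_mul_const]
      refine norm_integral_le_of_norm_le
        ((integrable_compactlySupported m k).norm.mul_const _) (.of_forall fun x => ?_)
      rw [norm_smul, norm_leftReg]

theorem leftConv_apply (k : C_c(G, ℂ)) (f : Lp ℂ 2 m) :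
    leftConv m k f = ∫ x, k x • leftReg m x f ∂m := rfl

theorem norm_leftConv_le (k : C_c(G, ℂ)) : ‖leftConv m k‖ ≤ ∫ x, ‖k x‖ ∂m :=
  LinearMap.mkContinuous_norm_le _ (integral_nonneg fun _ => norm_nonneg _) _

theorem IsBump.norm_leftConv_apply_le {V : Set G} {k : C_c(G, ℂ)} (hk : IsBump m V k)
    (f : Lp ℂ 2 m) : ‖leftConv m k f‖ ≤ ‖f‖ := by
  have := (leftConv m k).le_of_opNorm_le ((norm_leftConv_le k).trans_eq hk.integral_norm) f
  rwa [one_mul] at this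

theorem inner_leftConv (k : C_c(G, ℂ)) (g f : Lp ℂ 2 m) :
    inner ℂ g (leftConv m k f) = ∫ x, k x * inner ℂ g (leftReg m x f) ∂m := by
  rw [leftConv_apply, ← innerSL_apply_apply ℂ g,
    ← (innerSL ℂ g).integral_comp_comm (integrable_smul_leftReg k f)]
  simp

/-- A bounded operator passes through the Bochner integral, so the commutant of `λ(G)` commutes with
all `λ(k)`. -/
theorem map_leftConv {S : Lp ℂ 2 m →L[ℂ] Lp ℂ 2 m}
    (hS : ∀ s f, S (leftReg m s f) = leftReg m s (S f)) (k : C_c(G, ℂ)) (f : Lp ℂ 2 m) :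
    S (leftConv m k f) = leftConv m k (S f) := by
  rw [leftConv_apply, ← S.integral_comp_comm (integrable_smul_leftReg k f), leftConv_apply]
  simp [hS]

theorem tendsto_leftConv [m.IsOpenPosMeasure] (f : Lp ℂ 2 m) :
    Tendsto (fun k => leftConv m k f) (bumpFilter m) (𝓝 f) := by
  have := tendsto_integral_bump (m := m) (continuous_leftReg f)
  rwa [leftReg_one_apply] at this

theorem memLp_leftConv_aux {a : G → ℂ} (ha : MemLp a 2 m) (x : G) :
    MemLp (fun t => a (x⁻¹ * t)) 2 m := ha.comp_measurePreserving (measurePreserving_mul_left m x⁻¹)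

/-- `λ(k)` acts on continuous square integrable functions as convolution, weakly. -/
theorem inner_toL2_leftConv_toLp (k d : C_c(G, ℂ)) {a : G → ℂ} (ha : Continuous a)
    (ha' : MemLp a 2 m) :
    inner ℂ (toL2 m d) (leftConv m k (ha'.toLp a)) = ∫ t, conj (d t) * cconv m k a t ∂m := by
  have h := integral_cconv_mul (m := m) k ha (star d)
  simp only [CompactlySupportedContinuousMap.star_apply, RCLike.star_def] at h
  rw [inner_leftConv]
  simp only [mul_comm (conj _)]
  rw [h]
  congr 1 with x
  congr 1
  have : leftReg m x (ha'.toLp a) = (memLp_leftConv_aux ha' x).toLp _ := rfl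
  rw [this, inner_toL2_toLp]
  simp only [mul_comm (conj _)]

theorem leftConv_toL2 (k f : C_c(G, ℂ)) : leftConv m k (toL2 m f) = toL2 m (ccConv m k f) :=
  ext_inner_toL2 fun d => by
    rw [inner_toL2]
    exact inner_toL2_leftConv_toLp k d f.continuous (memLp_compactlySupported m f 2)

end

section

/-! ### Amplifications and the double commutant -/

section Amplification

variable {ι E : Type*} [NormedAddCommGroup E] [InnerProductSpace ℂ E]

/-- The amplification of an operator `S` on `E` to `ℓ²(ι, E)`. -/
def amplify (ι : Type*) (S : E →L[ℂ] E) : lp (fun _ : ι => E) 2 →L[ℂ] lp (fun _ : ι => E) 2 :=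
  LinearMap.mkContinuous
    { toFun := fun x => ⟨fun i => S (x i), by
        refine memℓp_gen (.of_nonneg_of_le (fun i => by positivity) (fun i => ?_)
          (((lp.memℓp x).summable (by simp)).mul_left (‖S‖ ^ (2 : ℝ≥0∞).toReal)))
        rw [← Real.mul_rpow (norm_nonneg _) (norm_nonneg _)]
        exact Real.rpow_le_rpow (norm_nonneg _) (S.le_opNorm _) (by simp)⟩
      map_add' := fun x y => by ext i; simp; rfl
      map_smul' := fun c x => by ext i; simp }
    ‖S‖ fun x => by
      have h : ‖((‖S‖ : ℝ) : ℂ) • x‖ = ‖S‖ * ‖x‖ := by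
        rw [norm_smul, Complex.norm_real, norm_norm]
      rw [← h]
      refine lp.norm_mono (by simp) fun i => ?_
      change ‖S (x i)‖ ≤ ‖((‖S‖ : ℝ) : ℂ) • x i‖
      rw [norm_smul, Complex.norm_real, norm_norm]
      exact S.le_opNorm _

@[simp]
theorem amplify_apply (S : E →L[ℂ] E) (x : lp (fun _ : ι => E) 2) (i : ι) :
    amplify ι S x i = S (x i) := rfl

theorem amplify_single [DecidableEq ι] (S : E →L[ℂ] E) (j : ι) (v : E) :
    amplify ι S (lp.single 2 j v) = lp.single 2 j (S v) := by
  ext i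
  rw [amplify_apply]
  by_cases h : i = j
  · subst h
    simp
  · rw [lp.single_apply_ne _ _ _ h, lp.single_apply_ne _ _ _ h, map_zero]

variable [CompleteSpace E] {G : Type*} [Group G]

/-- An operator in the double commutant of a unitary group annihilates, in the sense of normal
functionals on countable (or arbitrary) direct sums, all what the group annihilates; version with
square summable families. -/
theorem inner_amplify_eq_zero {U : G → E →L[ℂ] E} (hmul : ∀ s t x, U (s * t) x = U s (U t x))
    (hone : ∀ x, U 1 x = x) (hinner : ∀ s x y, inner ℂ x (U s y) = inner ℂ (U s⁻¹ x) y)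
    {T : E →L[ℂ] E}
    (hT : ∀ S : E →L[ℂ] E, (∀ s x, S (U s x) = U s (S x)) → ∀ x, T (S x) = S (T x))
    (F K : lp (fun _ : ι => E) 2) (h : ∀ s, inner ℂ K (amplify ι (U s) F) = 0) :
    inner ℂ K (amplify ι T F) = 0 := by
  classical
  -- `M` is the closed cyclic subspace generated by `F`, and `K` is orthogonal to it. The aim is
  -- that the amplification of `T` preserves `M`.
  let M : Submodule ℂ (lp (fun _ : ι => E) 2) :=
    (Submodule.span ℂ (range fun s => amplify ι (U s) F)).topologicalClosure
  have hMc : IsClosed (M : Set (lp (fun _ : ι => E) 2)) := Submodule.isClosed_topologicalClosure _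
  have : CompleteSpace M := hMc.completeSpace_coe
  have hUM : ∀ s, ∀ x ∈ M, amplify ι (U s) x ∈ M := by
    intro s
    have : M ≤ M.comap (amplify ι (U s)).toLinearMap := by
      refine Submodule.topologicalClosure_minimal _ (Submodule.span_le.2 ?_)
        (hMc.preimage (amplify ι (U s)).continuous)
      rintro _ ⟨t, rfl⟩
      have : amplify ι (U s) (amplify ι (U t) F) = amplify ι (U (s * t)) F := by
        ext i
        simp [hmul]
      change amplify ι (U s) (amplify ι (U t) F) ∈ M
      rw [this]
      exact Submodule.le_topologicalClosure _ (Submodule.subset_span ⟨_, rfl⟩)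
    exact this
  have hFM : F ∈ M := by
    have : amplify ι (U 1) F = F := by
      ext i
      simp [hone]
    rw [← this]
    exact Submodule.le_topologicalClosure _ (Submodule.subset_span ⟨_, rfl⟩)
  have hKM : ∀ x ∈ M, inner ℂ K x = 0 := by
    have : M ≤ LinearMap.ker (innerSL ℂ K).toLinearMap := by
      refine Submodule.topologicalClosure_minimal _ (Submodule.span_le.2 ?_)
        (innerSL ℂ K).isClosed_ker
      rintro _ ⟨t, rfl⟩
      exact h t
    exact fun x hx => by simpa using this hx
  have hinner' : ∀ s (x y : lp (fun _ : ι => E) 2),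
      inner ℂ x (amplify ι (U s) y) = inner ℂ (amplify ι (U s⁻¹) x) y := by
    intro s x y
    simp only [lp.inner_eq_tsum, amplify_apply, hinner s]
  set P := M.starProjection with hP
  -- The adjoint of `U s` is `U s⁻¹`, which preserves `M` as well; hence the orthogonal complement
  -- is invariant and the projection commutes with the group.
  have hPU : ∀ s x, P (amplify ι (U s) x) = amplify ι (U s) (P x) := by
    intro s x
    refine Submodule.eq_starProjection_of_mem_of_inner_eq_zero
      (hUM s _ (M.starProjection_apply_mem x)) fun w hw => ?_
    rw [← map_sub, ← inner_conj_symm, hinner', ← inner_conj_symm (amplify ι (U s⁻¹) w)]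
    have h1 := M.sub_starProjection_mem_orthogonal x
    rw [Submodule.mem_orthogonal'] at h1
    rw [h1 _ (hUM s⁻¹ w hw)]
    simp
  -- Every matrix entry of `P` lies in the commutant of the group, so `T` commutes with it; vectors
  -- supported at one index span a dense subspace.
  have hPT : P ∘L amplify ι T = amplify ι T ∘L P := by
    have key : ∀ j (v : E), P (amplify ι T (lp.single 2 j v)) = amplify ι T (P (lp.single 2 j v)) := by
      intro j v
      ext i
      let S : E →L[ℂ] E := lp.evalCLM ℂ (fun _ : ι => E) 2 i ∘L P ∘L
        lp.singleContinuousLinearMap ℂ (fun _ : ι => E) 2 j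
      have hS : ∀ v, S v = P (lp.single 2 j v) i := fun _ => rfl
      rw [amplify_single, amplify_apply, ← hS, ← hS]
      refine (hT S (fun s x => ?_) v).symm
      rw [hS, hS, ← amplify_single, hPU, amplify_apply]
    ext1 x
    have hx := lp.hasSum_single (p := 2) (by simp) x
    have h1 := (P ∘L amplify ι T).hasSum hx
    have h2 := (amplify ι T ∘L P).hasSum hx
    refine h1.unique ?_
    convert! h2 using 2 with j
    exact key j _
  refine hKM _ ?_
  have h1 : P F = F := Submodule.starProjection_eq_self_iff.2 hFM
  have h2 : P (amplify ι T F) = amplify ι T F := by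
    have := DFunLike.congr_fun hPT F
    simpa [h1] using this
  rw [← h2]
  exact M.starProjection_apply_mem _

/-- Rescaling `x` and `y` by inverse positive factors equalizes their norms without changing the
coefficient. Summability of `‖f i‖ * ‖g i‖` then becomes square summability of both families. -/
theorem exists_balanced (x y : E) : ∃ x' y' : E, ‖x'‖ ^ 2 = ‖x‖ * ‖y‖ ∧ ‖y'‖ ^ 2 = ‖x‖ * ‖y‖ ∧
    ∀ S : E →L[ℂ] E, inner ℂ y' (S x') = inner ℂ y (S x) := by
  rcases eq_or_ne x 0 with rfl | hx
  · exact ⟨0, 0, by simp, by simp, by simp⟩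
  rcases eq_or_ne y 0 with rfl | hy
  · exact ⟨0, 0, by simp, by simp, by simp⟩
  have hx' : 0 < ‖x‖ := norm_pos_iff.2 hx
  have hy' : 0 < ‖y‖ := norm_pos_iff.2 hy
  set c := √(‖y‖ / ‖x‖)
  have hc : 0 < c := Real.sqrt_pos.2 (by positivity)
  have hc2 : c ^ 2 = ‖y‖ / ‖x‖ := Real.sq_sqrt (by positivity)
  refine ⟨(c : ℂ) • x, ((c⁻¹ : ℝ) : ℂ) • y, ?_, ?_, fun S => ?_⟩
  · rw [norm_smul, Complex.norm_real, Real.norm_of_nonneg hc.le, mul_pow, hc2]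
    field_simp
  · rw [norm_smul, Complex.norm_real, Real.norm_of_nonneg (by positivity), mul_pow, inv_pow, hc2]
    field_simp
  · rw [map_smul, inner_smul_left, inner_smul_right, Complex.conj_ofReal, ← mul_assoc,
      ← Complex.ofReal_mul, inv_mul_cancel₀ hc.ne', Complex.ofReal_one, one_mul]

/-- An operator in the double commutant of a unitary group annihilates the normal functionals
that annihilate the group. -/
theorem tsum_inner_eq_zero_of_double_commutant {U : G → E →L[ℂ] E}
    (hmul : ∀ s t x, U (s * t) x = U s (U t x))
    (hone : ∀ x, U 1 x = x) (hinner : ∀ s x y, inner ℂ x (U s y) = inner ℂ (U s⁻¹ x) y)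
    {T : E →L[ℂ] E}
    (hT : ∀ S : E →L[ℂ] E, (∀ s x, S (U s x) = U s (S x)) → ∀ x, T (S x) = S (T x))
    {f g : ι → E} (hfg : Summable fun i => ‖f i‖ * ‖g i‖)
    (h : ∀ s, ∑' i, inner ℂ (g i) (U s (f i)) = 0) : ∑' i, inner ℂ (g i) (T (f i)) = 0 := by
  choose f' g' hf' hg' hfg' using fun i => exists_balanced (f i) (g i)
  have h1 : Memℓp f' 2 := memℓp_gen (by simpa [hf'] using hfg)
  have h2 : Memℓp g' 2 := memℓp_gen (by simpa [hg'] using hfg)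
  have key : ∀ S : E →L[ℂ] E, inner ℂ (⟨g', h2⟩ : lp (fun _ : ι => E) 2)
      (amplify ι S ⟨f', h1⟩) = ∑' i, inner ℂ (g i) (S (f i)) := by
    intro S
    rw [lp.inner_eq_tsum]
    exact tsum_congr fun i => hfg' i S
  rw [← key]
  exact inner_amplify_eq_zero hmul hone hinner hT _ _ fun s => by rw [key, h]

end Amplification

/-! ### The pairing of `VN(G)` and `A(G)` -/

variable {G : Type*} [Group G] [TopologicalSpace G] [IsTopologicalGroup G]
  [MeasurableSpace G] [BorelSpace G] {m : Measure G} [m.IsMulLeftInvariant]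

/-- Because the adjoint of `λ(s)` is `λ(s⁻¹)`, the set `λ(G)` is self-adjoint, and the conditions on
adjoints in the star centralizers are automatic. -/
theorem mem_groupVN_iff [IsFiniteMeasureOnCompacts m] {T : Lp ℂ 2 m →L[ℂ] Lp ℂ 2 m} :
    T ∈ (groupVN m).toStarSubalgebra ↔ ∀ S : Lp ℂ 2 m →L[ℂ] Lp ℂ 2 m,
      (∀ s x, S (leftReg m s x) = leftReg m s (S x)) → ∀ x, T (S x) = S (T x) := by
  change T ∈ StarSubalgebra.centralizer ℂ
    (StarSubalgebra.centralizer ℂ (Set.range (leftReg m)) : Set (Lp ℂ 2 m →L[ℂ] Lp ℂ 2 m)) ↔ _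
  rw [StarSubalgebra.mem_centralizer_iff]
  have h1 : ∀ S : Lp ℂ 2 m →L[ℂ] Lp ℂ 2 m,
      S ∈ StarSubalgebra.centralizer ℂ (Set.range (leftReg m)) ↔
      ∀ s x, S (leftReg m s x) = leftReg m s (S x) := by
    intro S
    rw [StarSubalgebra.mem_centralizer_iff]
    constructor
    · intro h s x
      exact (DFunLike.congr_fun (h _ ⟨s, rfl⟩).1 x).symm
    · rintro h _ ⟨s, rfl⟩
      rw [ContinuousLinearMap.star_eq_adjoint, adjoint_leftReg]
      exact ⟨ContinuousLinearMap.ext fun x => (h s x).symm,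
        ContinuousLinearMap.ext fun x => (h s⁻¹ x).symm⟩
  constructor
  · intro h S hS x
    exact (DFunLike.congr_fun (h S ((h1 S).2 hS)).1 x).symm
  · intro h S hS
    have hS' := star_mem hS
    exact ⟨ContinuousLinearMap.ext fun x => (h S ((h1 S).1 hS) x).symm,
      ContinuousLinearMap.ext fun x => (h _ ((h1 _).1 hS') x).symm⟩

theorem summable_inner_apply {f g : ℕ → Lp ℂ 2 m} (h : Summable fun n => ‖f n‖ * ‖g n‖)
    (T : Lp ℂ 2 m →L[ℂ] Lp ℂ 2 m) : Summable fun n => inner ℂ (g n) (T (f n)) := by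
  refine .of_norm_bounded (h.mul_left ‖T‖) fun n => ?_
  refine (norm_inner_le_norm _ _).trans ?_
  calc ‖g n‖ * ‖T (f n)‖ ≤ ‖g n‖ * (‖T‖ * ‖f n‖) := by gcongr; exact T.le_opNorm _
    _ = _ := by ring

theorem norm_tsum_inner_apply_le {f g : ℕ → Lp ℂ 2 m} (h : Summable fun n => ‖f n‖ * ‖g n‖)
    (T : Lp ℂ 2 m →L[ℂ] Lp ℂ 2 m) :
    ‖∑' n, inner ℂ (g n) (T (f n))‖ ≤ ‖T‖ * ∑' n, ‖f n‖ * ‖g n‖ := by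
  rw [← tsum_mul_left]
  refine tsum_of_norm_bounded (h.mul_left ‖T‖).hasSum fun n => ?_
  refine (norm_inner_le_norm _ _).trans ?_
  calc ‖g n‖ * ‖T (f n)‖ ≤ ‖g n‖ * (‖T‖ * ‖f n‖) := by gcongr; exact T.le_opNorm _
    _ = _ := by ring

/-- The pairing `⟨T, u⟩ = ∑ₙ ⟨T fₙ | gₙ⟩` does not depend on the representation of `u`. -/
theorem tsum_inner_eq_of_isFourierRep [IsFiniteMeasureOnCompacts m]
    {T : Lp ℂ 2 m →L[ℂ] Lp ℂ 2 m}
    (hT : T ∈ (groupVN m).toStarSubalgebra) {f g f' g' : ℕ → Lp ℂ 2 m} {u : G → ℂ}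
    (h : IsFourierRep m f g u) (h' : IsFourierRep m f' g' u) :
    ∑' n, inner ℂ (g n) (T (f n)) = ∑' n, inner ℂ (g' n) (T (f' n)) := by
  -- Concatenating the first representation with the negative of the second gives a normal
  -- functional that vanishes on `λ(G)`, hence on the double commutant.
  have key : ∀ S : Lp ℂ 2 m →L[ℂ] Lp ℂ 2 m,
      HasSum (fun i : ℕ ⊕ ℕ => inner ℂ (Sum.elim g g' i) (S (Sum.elim f (-f') i)))
        (∑' n, inner ℂ (g n) (S (f n)) - ∑' n, inner ℂ (g' n) (S (f' n))) := by
    intro S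
    rw [sub_eq_add_neg, ← tsum_neg]
    refine HasSum.sum (summable_inner_apply h.summable S).hasSum ?_
    have := (summable_inner_apply h'.summable S).neg.hasSum
    simpa [Function.comp_def] using this
  have h0 := tsum_inner_eq_zero_of_double_commutant (U := leftReg m) leftReg_mul_apply
    leftReg_one_apply inner_leftReg_right (mem_groupVN_iff.1 hT)
    (f := Sum.elim f (-f')) (g := Sum.elim g g') ?_ fun s => ?_
  · rw [(key T).tsum_eq] at h0
    exact sub_eq_zero.1 h0
  · let N : ℕ ⊕ ℕ → ℝ := fun i => ‖Sum.elim f (-f') i‖ * ‖Sum.elim g g' i‖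
    have h1 : HasSum (N ∘ Sum.inl) (∑' n, ‖f n‖ * ‖g n‖) := h.summable.hasSum
    have h2 : HasSum (N ∘ Sum.inr) (∑' n, ‖f' n‖ * ‖g' n‖) := by
      simpa [Function.comp_def, N] using h'.summable.hasSum
    exact (HasSum.sum (f := N) h1 h2).summable
  · rw [(key _).tsum_eq]
    exact sub_eq_zero.2 ((h.hasSum s).tsum_eq.trans (h'.hasSum s).tsum_eq.symm)

end

section

/-! ### Open `σ`-compact subgroups -/

section Subgroup

open scoped Pointwise

variable {G : Type*} [Group G] [TopologicalSpace G] [IsTopologicalGroup G]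

theorem isCompact_pow {S : Set G} (hS : IsCompact S) (n : ℕ) : IsCompact (S ^ n) := by
  induction n with
  | zero => simp
  | succ n ih => rw [pow_succ]; exact ih.mul hS

/-- Every `σ`-compact set is contained in an open `σ`-compact subgroup. -/
theorem exists_open_sigmaCompact_subgroup [LocallyCompactSpace G] (K : ℕ → Set G)
    (hK : ∀ n, IsCompact (K n)) :
    ∃ (H : Subgroup G) (L : ℕ → Set G), IsOpen (H : Set G) ∧ (∀ n, K n ⊆ H) ∧
      (∀ n, IsCompact (L n)) ∧ (H : Set G) = ⋃ n, L n := by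
  obtain ⟨V, hV, hV1⟩ := exists_compact_mem_nhds (1 : G)
  -- The compact neighbourhood `V` of `1` makes the subgroup open. Letting the symmetric sets grow
  -- together with the exponent in `S n ^ n` makes the union closed under products.
  let B : ℕ → Set G := fun n => V ∪ ⋃ i ∈ Finset.range (n + 1), K i
  have hB : ∀ n, IsCompact (B n) := fun n =>
    hV.union ((Finset.range (n + 1)).isCompact_biUnion fun i _ => hK i)
  have hBm : Monotone B := fun i j hij => union_subset_union_right _
    (biUnion_subset_biUnion_left fun x hx => by
      have : x ∈ Finset.range (i + 1) := hx
      have h2 := Finset.mem_range.1 this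
      exact Finset.mem_range.2 (by omega))
  let S : ℕ → Set G := fun n => B n ∪ (B n)⁻¹
  have hS1 : ∀ n, (1 : G) ∈ S n := fun n => Or.inl (Or.inl (mem_of_mem_nhds hV1))
  have hSm : Monotone S := fun i j hij =>
    union_subset_union (hBm hij) (inv_subset_inv.2 (hBm hij))
  have hSc : ∀ n, IsCompact (S n) := fun n => (hB n).union (hB n).inv
  have hSi : ∀ n, (S n)⁻¹ = S n := fun n => by simp only [S, union_inv, inv_inv, union_comm]
  let L : ℕ → Set G := fun n => S n ^ n
  have hLS : ∀ n, B n ⊆ ⋃ n, L n := fun n x hx => by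
    refine mem_iUnion.2 ⟨n + 1, ?_⟩
    have h1 : x ∈ S (n + 1) := Or.inl (hBm n.le_succ hx)
    have h2 : S (n + 1) ^ 1 ⊆ S (n + 1) ^ (n + 1) := pow_subset_pow_right (hS1 _) (by omega)
    exact h2 (by simpa using h1)
  let H : Subgroup G :=
    { carrier := ⋃ n, L n
      one_mem' := mem_iUnion.2 ⟨0, by simp [L]⟩
      mul_mem' := by
        intro x y hx hy
        obtain ⟨i, hi⟩ := mem_iUnion.1 hx
        obtain ⟨j, hj⟩ := mem_iUnion.1 hy
        refine mem_iUnion.2 ⟨i + j, ?_⟩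
        change x * y ∈ S (i + j) ^ (i + j)
        rw [pow_add]
        exact mul_mem_mul (pow_subset_pow_left (hSm (by omega)) hi)
          (pow_subset_pow_left (hSm (by omega)) hj)
      inv_mem' := by
        intro x hx
        obtain ⟨i, hi⟩ := mem_iUnion.1 hx
        refine mem_iUnion.2 ⟨i, ?_⟩
        change x⁻¹ ∈ S i ^ i
        rw [← hSi i, inv_pow]
        exact inv_mem_inv.2 hi }
  refine ⟨H, L, ?_, fun n x hx => hLS n (Or.inr ?_), fun n => isCompact_pow (hSc n) n, rfl⟩
  · refine Subgroup.isOpen_of_mem_nhds H (g := 1) (mem_of_superset hV1 fun x hx => ?_)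
    exact hLS 0 (Or.inl hx)
  · exact mem_biUnion (x := n) (by simp) hx

end Subgroup

/-! ### Almost everywhere equality without `σ`-finiteness -/

variable {G : Type*} [Group G] [TopologicalSpace G] [IsTopologicalGroup G]
  [LocallyCompactSpace G] [MeasurableSpace G] [BorelSpace G] {m : Measure G} [m.IsHaarMeasure]
  [m.InnerRegularCompactLTTop]

/-- A square integrable function vanishes almost everywhere outside of a `σ`-compact set. -/
theorem exists_sigmaCompact_ae_eq_zero (h : Lp ℂ 2 m) :
    ∃ K : ℕ → Set G, (∀ n, IsCompact (K n)) ∧ ∀ᵐ t ∂m, t ∉ ⋃ n, K n → h t = 0 := by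
  have := fun n : ℕ => exists_compactlySupported_eLpNorm_sub_le (μ := m) (ν := m) (p := 2)
    (q := 2) one_le_two le_rfl one_le_two le_rfl (Lp.memLp h) (Lp.memLp h)
    (ε := 1 / ((n : ℝ) + 1)) (by positivity)
  choose g hg _ using this
  refine ⟨fun n => tsupport (g n), fun n => (g n).hasCompactSupport, ?_⟩
  set Z := ⋃ n, tsupport (g n)
  have hZ : MeasurableSet Z := .iUnion fun n => (isClosed_tsupport _).measurableSet
  -- All approximants vanish off `Z`, so the part of `h` there is bounded by every approximation
  -- error.
  have h1 : ∀ n : ℕ, eLpNorm (Zᶜ.indicator h) 2 m ≤ ENNReal.ofReal (1 / ((n : ℝ) + 1)) := by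
    intro n
    refine (eLpNorm_mono fun t => ?_).trans (hg n)
    by_cases ht : t ∈ Z
    · rw [indicator_of_notMem (by simpa using ht)]
      simp
    · rw [indicator_of_mem (by simpa using ht), Pi.sub_apply, image_eq_zero_of_notMem_tsupport
        (fun h => ht (mem_iUnion.2 ⟨n, h⟩)), sub_zero]
  have h2 : eLpNorm (Zᶜ.indicator h) 2 m ≤ 0 := by
    have h0 := ENNReal.tendsto_ofReal (tendsto_one_div_add_atTop_nhds_zero_nat (𝕜 := ℝ))
    rw [ENNReal.ofReal_zero] at h0
    exact ge_of_tendsto' h0 h1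
  have h3 := (eLpNorm_eq_zero_iff ((Lp.memLp h).1.indicator hZ.compl) (by simp)).1
    (le_antisymm h2 (by simp))
  filter_upwards [h3] with t ht htZ
  rwa [indicator_of_mem (by simpa using htZ)] at ht

/-- A continuous function and a function of `L²` that agree as functionals on the continuous
functions of compact support are equal almost everywhere, even if `m` is not `σ`-finite. -/
theorem ae_eq_of_forall_integral_eq {F : G → ℂ} (hF : Continuous F) (h : Lp ℂ 2 m)
    (hFh : ∀ d : C_c(G, ℂ), ∫ t, conj (d t) * F t ∂m = inner ℂ (toL2 m d) h) :
    ⇑h =ᵐ[m] F := by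
  -- After multiplication by a cutoff equal to `1` on `K`, both functions are in `L²` and have the
  -- same inner products with `C_c(G)`.
  have hloc : ∀ K : Set G, IsCompact K → ∀ᵐ t ∂m, t ∈ K → h t = F t := by
    intro K hK
    obtain ⟨χ, hχ1, -, hχc, -⟩ := exists_continuous_one_zero_of_isCompact hK
      isClosed_empty (disjoint_empty K)
    have hχb : ∃ C, ∀ t, ‖χ t‖ ≤ C := χ.continuous.bounded_above_of_compact_support hχc
    obtain ⟨C, hC⟩ := hχb
    have hχc' : HasCompactSupport fun t => (χ t : ℂ) :=
      hχc.comp_left (g := fun r : ℝ => (r : ℂ)) Complex.ofReal_zero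
    have hχh : MemLp (fun t => (χ t : ℂ) * h t) 2 m := by
      refine MemLp.of_le_mul (c := C) (Lp.memLp h) ?_ (.of_forall fun t => ?_)
      · exact (Continuous.aestronglyMeasurable (by fun_prop)).mul (Lp.aestronglyMeasurable h)
      · rw [norm_mul, Complex.norm_real]
        exact mul_le_mul_of_nonneg_right (hC t) (norm_nonneg _)
    let χF : C_c(G, ℂ) := ⟨⟨fun t => (χ t : ℂ) * F t, by fun_prop⟩, hχc'.mul_right⟩
    have heq : toL2 m χF = hχh.toLp _ := by
      refine ext_inner_toL2 fun d => ?_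
      let χd : C_c(G, ℂ) := ⟨⟨fun t => (χ t : ℂ) * d t, by fun_prop⟩, hχc'.mul_right⟩
      rw [inner_toL2, inner_toL2_toLp]
      have h1 := hFh χd
      rw [inner_toL2_left] at h1
      simp only [χd, χF, CompactlySupportedContinuousMap.coe_mk, ContinuousMap.coe_mk, map_mul,
        Complex.conj_ofReal] at h1 ⊢
      convert! h1 using 3 <;> ring
    have h2 := coeFn_toL2 m χF
    rw [heq] at h2
    filter_upwards [h2, hχh.coeFn_toLp] with t ht1 ht2 htK
    rw [ht2] at ht1
    have : χ t = 1 := hχ1 htK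
    simpa [χF, this] using ht1
  obtain ⟨K, hK, hKh⟩ := exists_sigmaCompact_ae_eq_zero h
  obtain ⟨H, L, hHo, hKH, hL, hHL⟩ := exists_open_sigmaCompact_subgroup K hK
  have hHc : IsClosed (H : Set G) := H.isClosed_of_isOpen hHo
  -- Off `H` the function `h` vanishes almost everywhere. If the continuous `F` were nonzero there,
  -- it would be so on a nonempty open set inside a compact set, where `F = h = 0` almost
  -- everywhere; this contradicts positivity of the measure on open sets.
  have hF0 : ∀ t, t ∉ H → F t = 0 := by
    intro t ht
    by_contra hne
    obtain ⟨W, hW, htW⟩ := exists_compact_mem_nhds t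
    let O : Set G := interior W ∩ (H : Set G)ᶜ ∩ {s | F s ≠ 0}
    have hO : IsOpen O := (isOpen_interior.inter hHc.isOpen_compl).inter
      (isOpen_ne_fun hF continuous_const)
    have hOm : m O = 0 := by
      have : ∀ᵐ s ∂m, s ∉ O := by
        filter_upwards [hloc W hW, hKh] with s hs1 hs2 hsO
        refine hsO.2 ?_
        rw [← hs1 (interior_subset hsO.1.1)]
        refine hs2 fun hsK => hsO.1.2 ?_
        obtain ⟨n, hn⟩ := mem_iUnion.1 hsK
        exact hKH n hn
      have h := mem_ae_iff.1 this
      rwa [show {s | s ∉ O}ᶜ = O by ext; simp] at h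
    have := (hO.measure_eq_zero_iff m).1 hOm
    exact (this ▸ (⟨⟨mem_interior_iff_mem_nhds.2 htW, ht⟩, hne⟩ : t ∈ O) : t ∈ (∅ : Set G))
  have hLae : ∀ᵐ t ∂m, ∀ n, t ∈ L n → h t = F t := ae_all_iff.2 fun n => hloc _ (hL n)
  filter_upwards [hLae, hKh] with t ht1 ht2
  by_cases ht : t ∈ (H : Set G)
  · rw [hHL] at ht
    obtain ⟨n, hn⟩ := mem_iUnion.1 ht
    exact ht1 n hn
  · rw [hF0 t ht]
    refine ht2 fun h => ht ?_
    obtain ⟨n, hn⟩ := mem_iUnion.1 h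
    exact hKH n hn

/-! ### Convolution of a bounded function and a continuous function of compact support -/

theorem isTestFun_compactlySupported (f : C_c(G, ℂ)) : IsTestFun m f where
  memLp := memLp_compactlySupported m f 2
  integrable_inv := (f.continuous.comp continuous_inv).integrable_of_hasCompactSupport
    (f.hasCompactSupport.comp_homeomorph (Homeomorph.inv G))

theorem continuous_conv (φ : Lp ℂ ∞ m) (f : C_c(G, ℂ)) : Continuous (conv m φ f) := by
  refine continuous_iff_continuousAt.2 fun t₀ => ?_
  obtain ⟨W, hW, ht₀⟩ := exists_compact_mem_nhds t₀
  -- For all `t` in `W` the integrands vanish off this one compact set, on which `φ` is integrable.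
  have hk : IsCompact ((fun p : G × G => p.1 * p.2⁻¹) '' (W ×ˢ tsupport f)) :=
    (hW.prod f.hasCompactSupport).image (by fun_prop)
  have hc := continuousOn_integral_bilinear_of_locally_integrable_of_compact_support
    (ContinuousLinearMap.mul ℂ ℂ) (f := fun t s => f (s⁻¹ * t)) (s := W) (g := φ) (μ := m) hk
    (Continuous.continuousOn (by fun_prop)) (fun t s ht hs => ?_) ?_
  · exact hc.continuousAt ht₀
  · by_contra hne
    exact hs ⟨(t, s⁻¹ * t), ⟨ht, mem_tsupport_of_ne_zero hne⟩, by simp⟩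
  · exact Measure.integrableOn_of_bounded hk.measure_lt_top.ne (Lp.aestronglyMeasurable φ)
      (M := ‖φ‖) (ae_restrict_of_ae (Linfty.ae_norm_le φ))

/-- `∫ (φ ∗ f) d = ∫ φ(s) ∫ f(s⁻¹t) d(t)`. -/
theorem integral_conv_mul (φ : Lp ℂ ∞ m) (f d : C_c(G, ℂ)) :
    ∫ t, d t * conv m φ f t ∂m = ∫ s, φ s * ∫ t, d t * f (s⁻¹ * t) ∂m ∂m := by
  rw [integral_Linfty_mul_swap φ (F := fun s t => d t * f (s⁻¹ * t)) (by fun_prop)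
    (hasCompactSupport_mul_ltrans d f)]
  congr 1 with t
  rw [conv, ← integral_const_mul]
  congr 1 with s
  ring

theorem integral_conj_mul_conv (φ : Lp ℂ ∞ m) (f d : C_c(G, ℂ)) :
    ∫ t, conj (d t) * conv m φ f t ∂m = ∫ s, φ s * coeffFun m (toL2 m f) (toL2 m d) s ∂m := by
  have := integral_conv_mul φ f (star d)
  simp only [CompactlySupportedContinuousMap.star_apply, RCLike.star_def] at this
  rw [this]
  simp only [coeffFun, inner_toL2_leftReg_toL2]

theorem conv_add_right {f g : G → ℂ} (φ : Lp ℂ ∞ m) (hf : IsTestFun m f) (hg : IsTestFun m g) :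
    conv m φ (f + g) = conv m φ f + conv m φ g := by
  funext t
  simp only [conv, Pi.add_apply, mul_add]
  exact integral_add (hf.integrable_conv φ t) (hg.integrable_conv φ t)

theorem conv_smul_right (c : ℂ) (φ : Lp ℂ ∞ m) (f : G → ℂ) :
    conv m φ (c • f) = c • conv m φ f := by
  funext t
  simp only [conv, Pi.smul_apply, smul_eq_mul, ← integral_const_mul]
  congr 1 with s
  ring

/-- A bounded operator that is convolution by `φ` weakly on continuous functions of compact
support is so on all continuous functions of compact support. -/
theorem apply_toL2_ae_eq_conv {φ : Lp ℂ ∞ m} {T : Lp ℂ 2 m →L[ℂ] Lp ℂ 2 m} (f : C_c(G, ℂ))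
    (hT : ∀ d : C_c(G, ℂ), inner ℂ (toL2 m d) (T (toL2 m f)) =
      ∫ s, φ s * coeffFun m (toL2 m f) (toL2 m d) s ∂m) :
    ⇑(T (toL2 m f)) =ᵐ[m] conv m φ f :=
  ae_eq_of_forall_integral_eq (continuous_conv φ f) _ fun d => by
    rw [hT, integral_conj_mul_conv]

theorem lintegral_inv_measure (f : G → ℝ≥0∞) : ∫⁻ s, f s ∂m.inv = ∫⁻ s, f s⁻¹ ∂m :=
  (Homeomorph.inv G).measurableEmbedding.lintegral_map f

/-- A bounded operator that is convolution by `φ` on continuous functions of compact support is so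
on all of `L² ∩ (L¹)^∨`. -/
theorem isConvolutionOperator_of_compactlySupported {φ : Lp ℂ ∞ m} {T : Lp ℂ 2 m →L[ℂ] Lp ℂ 2 m}
    (hT : ∀ f : C_c(G, ℂ), ⇑(T (toL2 m f)) =ᵐ[m] conv m φ f) : IsConvolutionOperator m φ T := by
  intro f hf
  have hreg : m.inv.InnerRegularCompactLTTop :=
    Measure.InnerRegularCompactLTTop.map_of_continuous continuous_inv
  have hfin : IsFiniteMeasureOnCompacts m.inv :=
    MeasureTheory.Measure.IsFiniteMeasureOnCompacts.map m (Homeomorph.inv G)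
  -- The condition `f ∈ L¹(G)^∨` is integrability for the inverted measure; this is why
  -- approximation in two different norms is needed.
  have hfi : MemLp f 1 m.inv := by
    rw [memLp_one_iff_integrable]
    exact ((Homeomorph.inv G).measurableEmbedding.integrable_map_iff).2 hf.integrable_inv
  have := fun n : ℕ => exists_compactlySupported_eLpNorm_sub_le (μ := m) (ν := m.inv) (p := 2)
    (q := 1) one_le_two le_rfl le_rfl one_le_two hf.memLp hfi
    (ε := 1 / ((n : ℝ) + 1)) (by positivity)
  choose g hg hg' using this
  have h0 := tendsto_one_div_add_atTop_nhds_zero_nat (𝕜 := ℝ)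
  have h1 : Tendsto (fun n => toL2 m (g n)) atTop (𝓝 (hf.memLp.toLp f)) := by
    rw [tendsto_iff_norm_sub_tendsto_zero]
    refine squeeze_zero (fun _ => norm_nonneg _) (fun n => ?_) h0
    rw [norm_sub_rev]
    exact norm_toL2_sub_toLp_le m hf.memLp (g n) (by positivity) (hg n)
  have h2 : Tendsto (fun n => T (toL2 m (g n))) atTop (𝓝 (T (hf.memLp.toLp f))) :=
    (T.continuous.tendsto _).comp h1
  obtain ⟨ns, hns, hae⟩ := (tendstoInMeasure_of_tendsto_Lp h2).exists_seq_tendsto_ae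
  -- Convergence in `L¹(G)^∨` gives convergence of the convolutions at every point, while the `L²`
  -- convergence gives it almost everywhere along a subsequence; the limits must agree.
  have h3 : ∀ t, Tendsto (fun n => conv m φ (g n) t) atTop (𝓝 (conv m φ f t)) := by
    intro t
    rw [tendsto_iff_norm_sub_tendsto_zero]
    refine squeeze_zero (fun _ => norm_nonneg _) (fun n => ?_)
      (by simpa only [mul_zero] using h0.const_mul ‖φ‖)
    have e1 : conv m φ (g n) t - conv m φ f t =
        ∫ s, φ s * (g n (s⁻¹ * t) - f (s⁻¹ * t)) ∂m := by
      simp only [mul_sub]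
      exact (integral_sub ((isTestFun_compactlySupported (g n)).integrable_conv φ t)
        (hf.integrable_conv φ t)).symm
    have e2 : Integrable (fun s => g n s⁻¹ - f s⁻¹) m :=
      (isTestFun_compactlySupported (g n)).integrable_inv.sub hf.integrable_inv
    have e3 : Integrable (fun s => g n (s⁻¹ * t) - f (s⁻¹ * t)) m := by
      simpa [mul_inv_rev] using e2.comp_mul_left t⁻¹
    rw [e1]
    refine (norm_integral_Linfty_mul_le φ e3).trans (mul_le_mul_of_nonneg_left ?_ (norm_nonneg _))
    have e4 : ∫ s, ‖g n (s⁻¹ * t) - f (s⁻¹ * t)‖ ∂m = ∫ s, ‖g n s⁻¹ - f s⁻¹‖ ∂m := by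
      have := integral_mul_left_eq_self (μ := m) (fun s => ‖g n s⁻¹ - f s⁻¹‖) t⁻¹
      simpa [mul_inv_rev] using this
    rw [e4, integral_norm_eq_lintegral_enorm e2.1]
    refine ENNReal.toReal_le_of_le_ofReal (b := 1 / ((n : ℝ) + 1)) (by positivity) ?_
    refine le_trans (le_of_eq ?_) (hg' n)
    rw [eLpNorm_one_eq_lintegral_enorm, lintegral_inv_measure]
    refine lintegral_congr fun s => ?_
    rw [Pi.sub_apply, ← enorm_neg, neg_sub]
  have h4 : ∀ᵐ t ∂m, ∀ n, T (toL2 m (g n)) t = conv m φ (g n) t := ae_all_iff.2 fun n => hT (g n)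
  filter_upwards [hae, h4] with t ht1 ht2
  refine tendsto_nhds_unique ht1 ?_
  simp only [ht2]
  exact (h3 t).comp hns.tendsto_atTop

theorem IsConvolutionOperator.apply_toL2 {φ : Lp ℂ ∞ m} {T : Lp ℂ 2 m →L[ℂ] Lp ℂ 2 m}
    (hT : IsConvolutionOperator m φ T) (f : C_c(G, ℂ)) :
    ⇑(T (toL2 m f)) =ᵐ[m] conv m φ f := hT f (isTestFun_compactlySupported f)

theorem IsConvolutionOperator.unique {φ : Lp ℂ ∞ m} {T T' : Lp ℂ 2 m →L[ℂ] Lp ℂ 2 m}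
    (hT : IsConvolutionOperator m φ T) (hT' : IsConvolutionOperator m φ T') : T = T' :=
  ContinuousLinearMap.ext fun x => (denseRange_toL2 m).induction_on x
    (isClosed_eq T.continuous T'.continuous) fun f =>
      Lp.ext ((hT.apply_toL2 f).trans (hT'.apply_toL2 f).symm)

theorem IsConvolutionOperator.isConvolver {φ : Lp ℂ ∞ m} {T : Lp ℂ 2 m →L[ℂ] Lp ℂ 2 m}
    (hT : IsConvolutionOperator m φ T) : IsConvolver m φ := by
  refine ⟨fun f hf => (memLp_congr_ae (hT f hf)).1 (Lp.memLp _),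
    lt_of_le_of_lt ?_ (ENNReal.ofReal_lt_top (r := ‖T‖))⟩
  refine iSup_le fun f => iSup_le fun hf => iSup_le fun hn => ?_
  rw [← eLpNorm_congr_ae (hT f hf), ← Lp.enorm_def, ← ofReal_norm]
  refine ENNReal.ofReal_le_ofReal ((T.le_opNorm _).trans (mul_le_of_le_one_right (norm_nonneg _) ?_))
  rw [Lp.norm_toLp]
  exact ENNReal.toReal_le_of_le_ofReal zero_le_one (by simpa using hn)

theorem IsConvolver.exists_bound {φ : Lp ℂ ∞ m} (hφ : IsConvolver m φ) :
    ∃ C : ℝ, ∀ f : C_c(G, ℂ), ∀ h : MemLp (conv m φ f) 2 m,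
      ‖h.toLp _‖ ≤ C * ‖toL2 m f‖ := by
  obtain ⟨h1, h2⟩ := hφ
  set S := ⨆ (f : G → ℂ) (_ : IsTestFun m f) (_ : eLpNorm f 2 m ≤ 1), eLpNorm (conv m φ f) 2 m
  refine ⟨S.toReal, fun f h => ?_⟩
  -- Normalizing by `‖f‖ + ε` instead of `‖f‖` covers the case of zero norm.
  have key : ∀ ε > 0, ‖h.toLp _‖ ≤ S.toReal * (‖toL2 m f‖ + ε) := by
    intro ε hε
    set r := ‖toL2 m f‖ + ε
    have hr : 0 < r := by positivity
    set c : ℂ := ((r⁻¹ : ℝ) : ℂ)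
    have hc : ‖c‖ = r⁻¹ := by
      rw [Complex.norm_real, Real.norm_of_nonneg (by positivity)]
    have e1 : eLpNorm (c • f : C_c(G, ℂ)) 2 m ≤ 1 := by
      have : ‖toL2 m (c • f)‖ ≤ 1 := by
        rw [map_smul, norm_smul, hc, inv_mul_le_iff₀ hr, mul_one]
        linarith
      rw [← eLpNorm_congr_ae (coeFn_toL2 m (c • f)), ← Lp.enorm_def, ← ofReal_norm]
      simpa using ENNReal.ofReal_le_ofReal this
    have e2 : eLpNorm (conv m φ (c • f : C_c(G, ℂ))) 2 m ≤ S :=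
      le_iSup_of_le _ (le_iSup_of_le (isTestFun_compactlySupported _) (le_iSup_of_le e1 le_rfl))
    have e3 : conv m φ (c • f : C_c(G, ℂ)) = c • conv m φ f := by
      rw [CompactlySupportedContinuousMap.coe_smul, conv_smul_right]
    rw [e3] at e2
    have e4 : ‖c • h.toLp _‖ ≤ S.toReal := by
      rw [← MemLp.toLp_const_smul, Lp.norm_toLp]
      exact ENNReal.toReal_mono h2.ne e2
    rw [norm_smul, hc, inv_mul_le_iff₀ hr] at e4
    linarith
  have hlim : Tendsto (fun ε : ℝ => S.toReal * (‖toL2 m f‖ + ε)) (𝓝[>] 0)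
      (𝓝 (S.toReal * (‖toL2 m f‖ + 0))) :=
    (Continuous.tendsto (by fun_prop) 0).mono_left nhdsWithin_le_nhds
  rw [add_zero] at hlim
  exact ge_of_tendsto hlim (eventually_nhdsWithin_of_forall key)

theorem IsConvolver.exists_operator {φ : Lp ℂ ∞ m} (hφ : IsConvolver m φ) :
    ∃ T : Lp ℂ 2 m →L[ℂ] Lp ℂ 2 m, IsConvolutionOperator m φ T := by
  have hmem : ∀ f : C_c(G, ℂ), MemLp (conv m φ f) 2 m := fun f =>
    hφ.1 f (isTestFun_compactlySupported f)
  obtain ⟨C, hC⟩ := hφ.exists_bound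
  let A : C_c(G, ℂ) →ₗ[ℂ] Lp ℂ 2 m :=
    { toFun := fun f => (hmem f).toLp _
      map_add' := fun f g => by
        rw [← MemLp.toLp_add]
        congr 1
        rw [CompactlySupportedContinuousMap.coe_add, conv_add_right φ
          (isTestFun_compactlySupported f) (isTestFun_compactlySupported g)]
      map_smul' := fun c f => by
        rw [RingHom.id_apply, ← MemLp.toLp_const_smul]
        congr 1
        rw [CompactlySupportedContinuousMap.coe_smul, conv_smul_right] }
  refine ⟨A.extendOfNorm (toL2 m), isConvolutionOperator_of_compactlySupported fun f => ?_⟩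
  rw [LinearMap.extendOfNorm_eq (denseRange_toL2 m) ⟨C, fun f => hC f (hmem f)⟩]
  exact (hmem f).coeFn_toLp

end

section

variable {G : Type*} [Group G] [TopologicalSpace G] [IsTopologicalGroup G]
  [LocallyCompactSpace G] [MeasurableSpace G] [BorelSpace G]

/-! ### The modular function -/

/-- Right translation of a continuous function of compact support. -/
def rtrans (x : G) (f : C_c(G, ℂ)) : C_c(G, ℂ) :=
  ⟨⟨fun t => f (t * x), by fun_prop⟩, f.hasCompactSupport.comp_homeomorph (Homeomorph.mulRight x)⟩

@[simp]
theorem rtrans_apply (x : G) (f : C_c(G, ℂ)) (t : G) : rtrans x f t = f (t * x) := rfl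

/-- Right translation of a Haar measure is again left invariant, so by uniqueness the two integrals
on `C_c(G)` are proportional. Evaluating on one fixed nonnegative `g` writes the factor as a
quotient of integrals, which shows that it is continuous and positive. -/
theorem exists_modular (m : Measure G) [m.IsHaarMeasure] :
    ∃ D : G → ℝ, Continuous D ∧ (∀ x, 0 < D x) ∧
      ∀ (f : C_c(G, ℂ)) (x : G), ∫ t, f (t * x) ∂m = D x * ∫ t, f t ∂m := by
  obtain ⟨⟨g, g_cont⟩, g_comp, g_nonneg, g_one⟩ :
    ∃ (g : C(G, ℝ)), HasCompactSupport g ∧ 0 ≤ g ∧ g 1 ≠ 0 := exists_continuous_nonneg_pos 1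
  have hg : 0 < ∫ x, g x ∂m :=
    g_cont.integral_pos_of_hasCompactSupport_nonneg_nonzero g_comp g_nonneg g_one
  have key : ∀ x, ∃ c : ℝ, ∀ f : G → ℝ, Continuous f → HasCompactSupport f →
      ∫ t, f (t * x) ∂m = c * ∫ t, f t ∂m := by
    intro x
    refine ⟨(Measure.map (· * x) m).haarScalarFactor m, fun f hf hf' => ?_⟩
    have h1 := Measure.integral_isMulLeftInvariant_eq_smul_of_hasCompactSupport
      (Measure.map (· * x) m) m hf hf'
    rw [integral_smul_nnreal_measure] at h1
    have h2 : ∫ t, f t ∂(Measure.map (· * x) m) = ∫ t, f (t * x) ∂m :=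
      (Homeomorph.mulRight x).measurableEmbedding.integral_map f
    rw [← h2, h1]
    rfl
  choose D hD using key
  have hDg : ∀ x, D x = (∫ t, g (t * x) ∂m) / ∫ t, g t ∂m := fun x => by
    rw [hD x g g_cont g_comp, mul_div_cancel_right₀ _ hg.ne']
  refine ⟨D, ?_, fun x => ?_, fun f x => ?_⟩
  · simp only [funext hDg]
    refine Continuous.div_const ?_ _
    refine continuous_iff_continuousAt.2 fun x₀ => ?_
    obtain ⟨W, hW, hx₀⟩ := exists_compact_mem_nhds x₀
    have hk : IsCompact ((fun p : G × G => p.1 * p.2⁻¹) '' (tsupport g ×ˢ W)) :=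
      (IsCompact.prod g_comp hW).image (by fun_prop)
    have hc := continuousOn_integral_of_compact_support (f := fun x t => g (t * x)) (s := W)
      (μ := m) hk (Continuous.continuousOn (by fun_prop)) (fun x t hx ht => ?_)
    · exact hc.continuousAt hx₀
    · by_contra hne
      exact ht ⟨(t * x, x), ⟨subset_tsupport _ hne, hx⟩, by simp⟩
  · rw [hDg]
    refine div_pos ?_ hg
    refine Continuous.integral_pos_of_hasCompactSupport_nonneg_nonzero (x := x⁻¹) (by fun_prop)
      (g_comp.comp_homeomorph (Homeomorph.mulRight x)) (fun t => g_nonneg _) ?_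
    simpa using g_one
  · have hre : HasCompactSupport fun t => (f t).re :=
      f.hasCompactSupport.comp_left (g := Complex.re) rfl
    have him : HasCompactSupport fun t => (f t).im :=
      f.hasCompactSupport.comp_left (g := Complex.im) rfl
    have h1 := hD x _ (by fun_prop) hre
    have h2 := hD x _ (by fun_prop) him
    have e1 := integral_re_add_im (𝕜 := ℂ) (integrable_compactlySupported m (rtrans x f))
    have e2 := integral_re_add_im (𝕜 := ℂ) (integrable_compactlySupported m f)
    simp only [rtrans_apply, RCLike.re_eq_complex_re, RCLike.im_eq_complex_im] at e1 e2
    rw [← e1, ← e2, h1, h2]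
    simp only [Complex.coe_algebraMap, Complex.ofReal_mul]
    ring

/-- The function `D` with `∫ f(tx) dt = D(x) ∫ f(t) dt`. -/
def modD (m : Measure G) [m.IsHaarMeasure] : G → ℝ := (exists_modular m).choose

variable {m : Measure G} [m.IsHaarMeasure]

theorem continuous_modD : Continuous (modD m) := (exists_modular m).choose_spec.1

theorem modD_pos (x : G) : 0 < modD m x := (exists_modular m).choose_spec.2.1 x

theorem integral_mul_right (f : C_c(G, ℂ)) (x : G) :
    ∫ t, f (t * x) ∂m = modD m x * ∫ t, f t ∂m := (exists_modular m).choose_spec.2.2 f x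

theorem exists_compactlySupported_integral_ne_zero (m : Measure G) [m.IsHaarMeasure] :
    ∃ g : C_c(G, ℂ), ∫ t, g t ∂m ≠ 0 := by
  obtain ⟨g, hg⟩ := exists_isBump (m := m) (univ_mem : (univ : Set G) ∈ 𝓝 1)
  exact ⟨g, by rw [hg.integral]; exact one_ne_zero⟩

/-- Multiply by a nonzero `∫ g` and compute the double integral of `g(t) f(s⁻¹t)` in both orders;
the substitution `t ↦ st` followed by right translation of `g` produces the modular factor. -/
theorem integral_inv (f : C_c(G, ℂ)) : ∫ s, f s⁻¹ ∂m = ∫ t, modD m t * f t ∂m := by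
  obtain ⟨g, hg⟩ := exists_compactlySupported_integral_ne_zero m
  refine mul_right_cancel₀ hg ?_
  calc (∫ s, f s⁻¹ ∂m) * ∫ t, g t ∂m = ∫ t, ∫ s, g t * f (s⁻¹ * t) ∂m ∂m := by
        rw [← integral_const_mul]
        congr 1 with t
        rw [integral_const_mul, mul_comm]
        congr 1
        have := integral_mul_left_eq_self (μ := m) (fun s => f (s⁻¹ * t)) t
        simpa [mul_inv_rev] using this
    _ = ∫ s, ∫ t, g t * f (s⁻¹ * t) ∂m ∂m :=
        (integral_integral_swap_of_hasCompactSupport (f := fun s t => g t * f (s⁻¹ * t))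
          (by fun_prop) (hasCompactSupport_mul_ltrans g f)).symm
    _ = ∫ s, ∫ t, g (s * t) * f t ∂m ∂m := by
        congr 1 with s
        have := integral_mul_left_eq_self (μ := m) (fun t => g t * f (s⁻¹ * t)) s
        simpa using this.symm
    _ = ∫ t, ∫ s, g (s * t) * f t ∂m ∂m := by
        refine integral_integral_swap_of_hasCompactSupport (by fun_prop)
          (hasCompactSupport_of_forall_mem
            (K := (fun p : G × G => p.1 * p.2⁻¹) '' (tsupport g ×ˢ tsupport f))
            ((g.hasCompactSupport.prod f.hasCompactSupport).image (by fun_prop))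
            f.hasCompactSupport fun s t hne => ?_)
        have h1 := mem_tsupport_of_ne_zero (left_ne_zero_of_mul hne)
        have h2 := mem_tsupport_of_ne_zero (right_ne_zero_of_mul hne)
        exact ⟨⟨(s * t, t), ⟨h1, h2⟩, by simp⟩, h2⟩
    _ = _ := by
        rw [← integral_mul_const]
        congr 1 with t
        rw [_root_.MeasureTheory.integral_mul_const, integral_mul_right]
        ring

/-- The involution `c ↦ c*` with `λ(c)* = λ(c*)`. -/
def ccStar (m : Measure G) [m.IsHaarMeasure] (c : C_c(G, ℂ)) : C_c(G, ℂ) :=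
  ⟨⟨fun t => modD m t * conj (c t⁻¹), by
    have := continuous_modD (m := m)
    fun_prop⟩, by
    refine HasCompactSupport.mul_left ?_
    exact (c.hasCompactSupport.comp_homeomorph (Homeomorph.inv G)).comp_left
      (g := fun z : ℂ => conj z) (map_zero _)⟩

@[simp]
theorem ccStar_apply (c : C_c(G, ℂ)) (t : G) : ccStar m c t = modD m t * conj (c t⁻¹) := rfl

variable [m.InnerRegularCompactLTTop]

/-- The adjoint of `∫ c(x) λ(x) dx` is the integral of `conj c(x) λ(x⁻¹)`; inverting the variable
through `integral_inv` produces the factor `modD`. -/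
theorem inner_leftConv_left (c : C_c(G, ℂ)) (x y : Lp ℂ 2 m) :
    inner ℂ (leftConv m c x) y = inner ℂ x (leftConv m (ccStar m c) y) := by
  rw [← inner_conj_symm, inner_leftConv, inner_leftConv, ← integral_conj]
  let f : C_c(G, ℂ) := ⟨⟨fun t => conj (c t⁻¹) * inner ℂ x (leftReg m t y), by
    have := continuous_leftReg y
    fun_prop⟩, by
    refine HasCompactSupport.mul_right ?_
    exact (c.hasCompactSupport.comp_homeomorph (Homeomorph.inv G)).comp_left
      (g := fun z : ℂ => conj z) (map_zero _)⟩
  have h := integral_inv (m := m) f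
  simp only [f, CompactlySupportedContinuousMap.coe_mk, ContinuousMap.coe_mk, inv_inv] at h
  simp only [ccStar_apply, mul_assoc]
  rw [← h]
  congr 1 with s
  rw [map_mul, inner_conj_symm, inner_leftReg_right, inv_inv]

theorem norm_toL2_sq (f : C_c(G, ℂ)) : ((‖toL2 m f‖ : ℝ) : ℂ) ^ 2 = ∫ t, conj (f t) * f t ∂m := by
  rw [← inner_toL2, inner_self_eq_norm_sq_to_K]
  rfl

theorem norm_toL2_rtrans (s : G) (c : C_c(G, ℂ)) :
    ‖toL2 m (rtrans s c)‖ = √(modD m s) * ‖toL2 m c‖ := by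
  have h1 := norm_toL2_sq (m := m) (rtrans s c)
  have h2 := integral_mul_right (m := m) (star c * c) s
  simp only [CompactlySupportedContinuousMap.mul_apply,
    CompactlySupportedContinuousMap.star_apply, RCLike.star_def] at h2
  simp only [rtrans_apply] at h1
  rw [h2, ← norm_toL2_sq] at h1
  have h3 : ‖toL2 m (rtrans s c)‖ ^ 2 = modD m s * ‖toL2 m c‖ ^ 2 := by exact_mod_cast h1
  rw [← Real.sqrt_sq (norm_nonneg (toL2 m (rtrans s c))), h3, Real.sqrt_mul (modD_pos s).le,
    Real.sqrt_sq (norm_nonneg _)]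

/-- Right convolution by a continuous function of compact support is bounded on `L²`. -/
theorem exists_norm_leftConv_toL2_le (b : C_c(G, ℂ)) :
    ∃ M : ℝ, 0 ≤ M ∧ ∀ c : C_c(G, ℂ), ‖leftConv m c (toL2 m b)‖ ≤ M * ‖toL2 m c‖ := by
  -- Writing `(c ∗ b)(t) = ∫ b(s⁻¹) c(ts) ds` as a superposition of right translates, each of norm
  -- `√(modD m s) * ‖c‖`, bounds right convolution by the `L¹` norm of `w`.
  let w : C_c(G, ℂ) := ⟨⟨fun s => b s⁻¹ * √(modD m s), by
    have := continuous_modD (m := m)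
    fun_prop⟩, (b.hasCompactSupport.comp_homeomorph (Homeomorph.inv G)).mul_right⟩
  have hw : ∀ s, ‖w s‖ = ‖b s⁻¹‖ * √(modD m s) := fun s => by
    change ‖b s⁻¹ * ((√(modD m s) : ℝ) : ℂ)‖ = _
    rw [norm_mul, Complex.norm_real, Real.norm_of_nonneg (Real.sqrt_nonneg _)]
  have hM : 0 ≤ ∫ s, ‖w s‖ ∂m := integral_nonneg fun s => norm_nonneg _
  refine ⟨∫ s, ‖w s‖ ∂m, hM, fun c => norm_le_of_forall_inner_toL2 (by positivity) fun d => ?_⟩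
  have h1 : inner ℂ (toL2 m d) (leftConv m c (toL2 m b)) =
      ∫ s, b s⁻¹ * inner ℂ (toL2 m d) (toL2 m (rtrans s c)) ∂m := by
    rw [leftConv_toL2, inner_toL2]
    simp only [inner_toL2, coe_ccConv, cconv, rtrans_apply, ← integral_const_mul]
    have h2 : ∀ t, ∫ x, conj (d t) * (c x * b (x⁻¹ * t)) ∂m =
        ∫ s, b s⁻¹ * (conj (d t) * c (t * s)) ∂m := by
      intro t
      rw [← integral_mul_left_eq_self (μ := m) _ t]
      congr 1 with s
      simp only [mul_inv_rev, inv_mul_cancel_right]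
      ring
    simp only [h2]
    refine integral_integral_swap_of_hasCompactSupport (by fun_prop)
      (hasCompactSupport_of_forall_mem d.hasCompactSupport
        (L := (tsupport b)⁻¹) (IsCompact.inv b.hasCompactSupport) fun t s hne => ?_)
    refine ⟨mem_tsupport_of_ne_zero (f := d) fun h => ?_,
      mem_tsupport_of_ne_zero (left_ne_zero_of_mul hne)⟩
    simp [h] at hne
  rw [h1, mul_assoc, ← _root_.MeasureTheory.integral_mul_const]
  refine norm_integral_le_of_norm_le ((integrable_compactlySupported m w).norm.mul_const _)
    (.of_forall fun s => ?_)
  rw [norm_mul, hw]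
  calc ‖b s⁻¹‖ * ‖inner ℂ (toL2 m d) (toL2 m (rtrans s c))‖
      ≤ ‖b s⁻¹‖ * (‖toL2 m d‖ * (√(modD m s) * ‖toL2 m c‖)) := by
        gcongr
        rw [← norm_toL2_rtrans]
        exact norm_inner_le_norm _ _
    _ = _ := by ring

/-! ### Associativity -/

theorem cconv_assoc (h b : C_c(G, ℂ)) {a : G → ℂ} (ha : Continuous a) :
    cconv m h (cconv m a b) = cconv m (cconv m h a) b := by
  funext t
  have h1 : ∀ x, cconv m a b (x⁻¹ * t) = ∫ y, a (x⁻¹ * y) * b (y⁻¹ * t) ∂m := by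
    intro x
    rw [cconv, ← integral_mul_left_eq_self (μ := m) _ x⁻¹]
    congr 1 with y
    congr 2
    group
  change ∫ x, h x * cconv m a b (x⁻¹ * t) ∂m = ∫ y, cconv m h a y * b (y⁻¹ * t) ∂m
  simp only [h1]
  simp only [cconv, ← integral_const_mul, ← _root_.MeasureTheory.integral_mul_const,
    ← mul_assoc]
  refine integral_integral_swap_of_hasCompactSupport
    (f := fun x y => h x * a (x⁻¹ * y) * b (y⁻¹ * t)) (by fun_prop)
    (hasCompactSupport_of_forall_mem h.hasCompactSupport
      (L := (fun p : G => t * p⁻¹) '' tsupport b)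
      (IsCompact.image b.hasCompactSupport (by fun_prop)) fun x y hne => ?_)
  exact ⟨mem_tsupport_of_ne_zero (left_ne_zero_of_mul (left_ne_zero_of_mul hne)),
    ⟨y⁻¹ * t, mem_tsupport_of_ne_zero (right_ne_zero_of_mul hne), by simp⟩⟩

/-- Associativity with a merely bounded left factor. It exhibits `φ ∗ (k ∗ b)` as convolution of the
continuous function `φ ∗ k` with `b`. -/
theorem conv_cconv (φ : Lp ℂ ∞ m) (k b : C_c(G, ℂ)) :
    conv m φ (cconv m k b) = cconv m (conv m φ k) b := by
  funext t
  have h1 : ∀ x, ∫ y, k y * b (y⁻¹ * (x⁻¹ * t)) ∂m = ∫ y, k (x⁻¹ * y) * b (y⁻¹ * t) ∂m := by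
    intro x
    rw [← integral_mul_left_eq_self (μ := m) _ x⁻¹]
    congr 1 with y
    congr 2
    group
  simp only [cconv, conv, h1]
  rw [integral_Linfty_mul_swap φ (F := fun x y => k (x⁻¹ * y) * b (y⁻¹ * t)) (by fun_prop)]
  · simp only [← integral_mul_const, mul_assoc]
  · refine hasCompactSupport_of_forall_mem
      (K := (fun p : G × G => t * p.1⁻¹ * p.2⁻¹) '' (tsupport b ×ˢ tsupport k))
      (L := (fun p : G => t * p⁻¹) '' tsupport b)
      ((b.hasCompactSupport.prod k.hasCompactSupport).image (by fun_prop))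
      (IsCompact.image b.hasCompactSupport (by fun_prop)) fun x y hne => ?_
    have hk := mem_tsupport_of_ne_zero (left_ne_zero_of_mul hne)
    have hb := mem_tsupport_of_ne_zero (right_ne_zero_of_mul hne)
    exact ⟨⟨(y⁻¹ * t, x⁻¹ * y), ⟨hb, hk⟩, by simp⟩, ⟨y⁻¹ * t, hb, by simp⟩⟩

/-- With `d = θ w` and `0 ≤ θ ≤ 1` one has `|d|² ≤ θ |w|²` pointwise. So a cutoff of `w` is bounded
in `L²` by testing `w` against that cutoff, before `w` is known to be square integrable. -/
theorem norm_toL2_sq_le {d : C_c(G, ℂ)} {θ : G → ℝ} {w : G → ℂ} (hw : Continuous w)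
    (hd : ∀ t, d t = θ t * w t) (hθ0 : ∀ t, 0 ≤ θ t) (hθ1 : ∀ t, θ t ≤ 1) :
    ‖toL2 m d‖ ^ 2 ≤ ‖∫ t, conj (d t) * w t ∂m‖ := by
  have h1 : ∀ t, conj (d t) * w t = ((‖conj (d t) * w t‖ : ℝ) : ℂ) := fun t => by
    have : conj (d t) * w t = ((θ t * ‖w t‖ ^ 2 : ℝ) : ℂ) := by
      rw [hd, map_mul, Complex.conj_ofReal, mul_assoc, ← Complex.normSq_eq_conj_mul_self,
        Complex.normSq_eq_norm_sq]
      push_cast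
      rfl
    rw [this, Complex.norm_real, Real.norm_of_nonneg]
    have := hθ0 t
    positivity
  have h2 : ‖toL2 m d‖ ^ 2 = ∫ t, ‖conj (d t) * d t‖ ∂m := by
    have h3 := norm_toL2_sq (m := m) d
    have h4 : ∀ t, conj (d t) * d t = ((‖conj (d t) * d t‖ : ℝ) : ℂ) := fun t => by
      rw [← Complex.normSq_eq_conj_mul_self, Complex.norm_real,
        Real.norm_of_nonneg (Complex.normSq_nonneg _)]
    rw [integral_congr_ae (.of_forall h4), integral_complex_ofReal] at h3
    exact_mod_cast h3
  rw [h2, integral_congr_ae (.of_forall h1), integral_complex_ofReal, Complex.norm_real]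
  refine le_trans ?_ (le_abs_self _)
  have hc : HasCompactSupport fun t => conj (d t) :=
    d.hasCompactSupport.comp_left (g := fun z : ℂ => conj z) (map_zero _)
  refine integral_mono ?_ ?_ fun t => ?_
  · exact (Continuous.integrable_of_hasCompactSupport (by fun_prop) hc.mul_right).norm
  · exact (Continuous.integrable_of_hasCompactSupport (by fun_prop) hc.mul_right).norm
  · simp only [norm_mul]
    refine mul_le_mul_of_nonneg_left ?_ (norm_nonneg _)
    rw [hd, norm_mul, Complex.norm_real, Real.norm_of_nonneg (hθ0 t)]
    exact mul_le_of_le_one_left (norm_nonneg _) (hθ1 t)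

end

section

variable {G : Type*} [Group G] [TopologicalSpace G] [IsTopologicalGroup G]
  [LocallyCompactSpace G] [MeasurableSpace G] [BorelSpace G] {m : Measure G} [m.IsHaarMeasure]

theorem modD_inv_mul (x : G) : modD m x⁻¹ * modD m x = 1 := by
  obtain ⟨g, hg⟩ := exists_compactlySupported_integral_ne_zero m
  have h1 := integral_mul_right (m := m) (rtrans x g) x⁻¹
  simp only [rtrans_apply, inv_mul_cancel_right] at h1
  rw [integral_mul_right, ← mul_assoc] at h1
  have h2 := mul_right_cancel₀ hg (h1.symm.trans (one_mul _).symm)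
  exact_mod_cast h2

theorem ccStar_ccStar (c : C_c(G, ℂ)) : ccStar m (ccStar m c) = c := by
  ext t
  have h : (modD m t⁻¹ : ℂ) * modD m t = 1 := by exact_mod_cast modD_inv_mul (m := m) t
  simp only [ccStar_apply, map_mul, Complex.conj_ofReal, Complex.conj_conj, inv_inv]
  linear_combination c t * h

/-! ### Convolution operators belong to `VN(G)` -/

/-- The product of a function of compact support with a continuous function. -/
def cutoff (θ : C(G, ℝ)) (hθ : HasCompactSupport θ) (c : C(G, ℂ)) : C_c(G, ℂ) :=
  ⟨⟨fun t => θ t * c t, by fun_prop⟩,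
    (hθ.comp_left (g := fun r : ℝ => (r : ℂ)) Complex.ofReal_zero).mul_right⟩

@[simp]
theorem cutoff_apply (θ : C(G, ℝ)) (hθ : HasCompactSupport θ) (c : C(G, ℂ)) (t : G) :
    cutoff θ hθ c t = θ t * c t := rfl

variable [m.InnerRegularCompactLTTop]

theorem integral_conj_mul_cconv {c : G → ℂ} (hc : Continuous c) (b q : C_c(G, ℂ)) :
    ∫ t, conj (q t) * cconv m c b t ∂m = ∫ s, c s * coeffFun m (toL2 m b) (toL2 m q) s ∂m := by
  simp only [coeffFun, inner_toL2_leftReg_toL2, cconv, ← integral_const_mul]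
  have hs := hasCompactSupport_mul_ltrans (star q) b
  have h1 := integral_integral_swap_of_hasCompactSupport (μ := m) (ν := m)
    (f := fun s t => c s * (conj (q t) * b (s⁻¹ * t))) (by fun_prop) hs.mul_left
  rw [h1]
  congr 1 with t
  congr 1 with s
  ring

namespace IsConvolutionOperator

variable {φ : Lp ℂ ∞ m} {T : Lp ℂ 2 m →L[ℂ] Lp ℂ 2 m}

theorem inner_leftConv_apply (hT : IsConvolutionOperator m φ T) (h k d : C_c(G, ℂ)) :
    inner ℂ (toL2 m d) (leftConv m h (T (toL2 m k))) =
      ∫ t, conj (d t) * cconv m h (conv m φ k) t ∂m := by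
  have ha : MemLp (conv m φ k) 2 m := (memLp_congr_ae (hT.apply_toL2 k)).1 (Lp.memLp _)
  have : T (toL2 m k) = ha.toLp _ := Lp.ext ((hT.apply_toL2 k).trans ha.coeFn_toLp.symm)
  rw [this, inner_toL2_leftConv_toLp h d (continuous_conv φ k) ha]

theorem inner_apply_toL2 (hT : IsConvolutionOperator m φ T) (k d : C_c(G, ℂ)) :
    inner ℂ (toL2 m d) (T (toL2 m k)) = ∫ t, conj (d t) * conv m φ k t ∂m := by
  rw [inner_toL2_left]
  refine integral_congr_ae ?_
  filter_upwards [hT.apply_toL2 k] with t ht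
  rw [ht]

/-- The left side is the value at `1` of `h ∗ φ ∗ k ∗ d`. Reassociating and inverting the variable
turns it into an inner product, which bounds pairings with the involute of `h ∗ φ ∗ k`. -/
theorem integral_cconv_mul_inv (hT : IsConvolutionOperator m φ T) (h k d : C_c(G, ℂ)) :
    ∫ t, cconv m h (conv m φ k) t * d t⁻¹ ∂m =
      inner ℂ (toL2 m (ccStar m h)) (T (leftConv m k (toL2 m d))) := by
  have h1 : ∫ t, cconv m h (conv m φ k) t * d t⁻¹ ∂m =
      cconv m h (conv m φ (ccConv m k d)) 1 := by
    rw [coe_ccConv, conv_cconv, cconv_assoc h d (continuous_conv φ k), cconv]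
    simp only [mul_one]
  rw [h1, leftConv_toL2, hT.inner_apply_toL2]
  let f : C_c(G, ℂ) := ⟨⟨fun t => h t⁻¹ * conv m φ (ccConv m k d) t, by
    have := continuous_conv (m := m) φ (ccConv m k d)
    fun_prop⟩, (h.hasCompactSupport.comp_homeomorph (Homeomorph.inv G)).mul_right⟩
  have hf : ∀ t, f t = h t⁻¹ * conv m φ (ccConv m k d) t := fun _ => rfl
  have h2 := integral_inv (m := m) f
  simp only [hf, inv_inv] at h2
  simp only [cconv, mul_one]
  rw [h2]
  congr 1 with t
  simp only [ccStar_apply, map_mul, Complex.conj_ofReal, Complex.conj_conj, mul_assoc]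

theorem inner_leftConv_apply_leftConv (hT : IsConvolutionOperator m φ T) (h k b q : C_c(G, ℂ)) :
    inner ℂ (toL2 m q) (leftConv m h (T (leftConv m k (toL2 m b)))) =
      ∫ s, cconv m h (conv m φ k) s * coeffFun m (toL2 m b) (toL2 m q) s ∂m := by
  rw [leftConv_toL2, hT.inner_leftConv_apply, coe_ccConv, conv_cconv,
    cconv_assoc h b (continuous_conv φ k),
    integral_conj_mul_cconv (continuous_cconv h (continuous_conv φ k))]

/-- This expresses that `c = h ∗ φ ∗ k` and `c*` are both in `L²`. Testing a cutoff against `c`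
gives an inner product with `λ(h) T k`. Testing a cutoff of `c*` gives one with `h*` and `T λ(k)`,
by `integral_cconv_mul_inv`. Both bounds are independent of `K`. -/
theorem exists_cutoff (hT : IsConvolutionOperator m φ T) (h k : C_c(G, ℂ)) :
    ∃ M : ℝ, 0 ≤ M ∧ ∀ K : Set G, IsCompact K → ∃ c : C_c(G, ℂ), ‖toL2 m c‖ ≤ M ∧
      ‖toL2 m (ccStar m c)‖ ≤ M ∧ ∀ t ∈ K, c t = cconv m h (conv m φ k) t := by
  have hc := continuous_cconv (m := m) h (continuous_conv φ k)
  set c := cconv m h (conv m φ k)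
  set M₁ := ‖leftConv m h (T (toL2 m k))‖
  set M₂ := ‖toL2 m (ccStar m h)‖ * (‖T‖ * ‖leftConv m k‖)
  have hM₂ : 0 ≤ M₂ := by positivity
  refine ⟨max M₁ M₂, (norm_nonneg _).trans (le_max_left _ _), fun K hK => ?_⟩
  obtain ⟨θ, hθ1, -, hθc, hθb⟩ := exists_continuous_one_zero_of_isCompact hK
    isClosed_empty (disjoint_empty K)
  have hsq : ∀ {x y : ℝ}, 0 ≤ x → 0 ≤ y → x ^ 2 ≤ y * x → x ≤ y := by
    intro x y hx hy hxy
    rcases hx.eq_or_lt with rfl | hx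
    · exact hy
    · nlinarith
  refine ⟨cutoff θ hθc ⟨c, hc⟩, le_max_of_le_left ?_, le_max_of_le_right ?_, fun t ht => ?_⟩
  · refine hsq (norm_nonneg _) (norm_nonneg _)
      ((norm_toL2_sq_le hc (fun t => cutoff_apply θ hθc ⟨c, hc⟩ t) (fun t => (hθb t).1)
        fun t => (hθb t).2).trans ?_)
    rw [← hT.inner_leftConv_apply, mul_comm]
    exact norm_inner_le_norm _ _
  · set d := ccStar m (cutoff θ hθc ⟨c, hc⟩)
    have hw : Continuous fun t => modD m t * conj (c t⁻¹) := by
      have := continuous_modD (m := m)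
      fun_prop
    refine hsq (norm_nonneg _) hM₂ ((norm_toL2_sq_le (θ := fun t => θ t⁻¹) hw (fun t => ?_)
      (fun t => (hθb _).1) fun t => (hθb _).2).trans ?_)
    · simp only [d, ccStar_apply, cutoff_apply, map_mul, Complex.conj_ofReal,
        ContinuousMap.coe_mk]
      ring
    · let f : C_c(G, ℂ) := ⟨⟨fun t => conj (d t) * conj (c t⁻¹), by fun_prop⟩, by
        refine HasCompactSupport.mul_right ?_
        exact d.hasCompactSupport.comp_left (g := fun z : ℂ => conj z) (map_zero _)⟩
      have h2 := integral_inv (m := m) f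
      simp only [f, CompactlySupportedContinuousMap.coe_mk, ContinuousMap.coe_mk, inv_inv] at h2
      simp only [mul_left_comm (conj (d _))]
      rw [← h2]
      simp only [← map_mul, mul_comm (d _)]
      rw [integral_conj, RCLike.norm_conj, hT.integral_cconv_mul_inv, mul_assoc]
      refine (norm_inner_le_norm _ _).trans ?_
      gcongr
      rw [mul_assoc]
      exact (T.le_opNorm _).trans (by gcongr; exact (leftConv m k).le_opNorm _)
  · simp [hθ1 ht]

/-- For a cutoff `c` of `h ∗ φ ∗ k` the operator `λ(c)` commutes with `S` and agrees with `T' = λ(h)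
T λ(k)` on matrix coefficients of `C_c` functions, once the cutoff is exact on their supports. The
operator norms of the `λ(c)` need not be bounded, but `λ(c) b` and `λ(c*) q` are, because right
convolution by `b` and `q` is bounded on `L²`. -/
theorem leftConv_comm_of_toL2 (hT : IsConvolutionOperator m φ T) (h k b q : C_c(G, ℂ))
    {S : Lp ℂ 2 m →L[ℂ] Lp ℂ 2 m} (hS : ∀ s x, S (leftReg m s x) = leftReg m s (S x)) :
    inner ℂ (toL2 m q) (leftConv m h (T (leftConv m k (S (toL2 m b))))) =
      inner ℂ (toL2 m q) (S (leftConv m h (T (leftConv m k (toL2 m b))))) := by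
  obtain ⟨M, hM, hcut⟩ := hT.exists_cutoff h k
  obtain ⟨Mb, hMb, hb⟩ := exists_norm_leftConv_toL2_le (m := m) b
  obtain ⟨Mq, hMq, hq⟩ := exists_norm_leftConv_toL2_le (m := m) q
  set T' : Lp ℂ 2 m →L[ℂ] Lp ℂ 2 m := (leftConv m h).comp (T.comp (leftConv m k))
  change inner ℂ (toL2 m q) (T' (S (toL2 m b))) = inner ℂ (toL2 m q) (S (T' (toL2 m b)))
  rw [← ContinuousLinearMap.adjoint_inner_left S]
  set x := S (toL2 m b)
  set y := ContinuousLinearMap.adjoint S (toL2 m q)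
  have hagree : ∀ c f g : C_c(G, ℂ), (∀ t ∈ tsupport (coeffCc m f g),
      c t = cconv m h (conv m φ k) t) →
      inner ℂ (toL2 m g) (leftConv m c (toL2 m f)) = inner ℂ (toL2 m g) (T' (toL2 m f)) := by
    intro c f g hcfg
    refine (inner_leftConv c _ _).trans (Eq.trans ?_
      (hT.inner_leftConv_apply_leftConv h k f g).symm)
    congr 1 with s
    by_cases hs : coeffCc m f g s = 0
    · change c s * coeffCc m f g s = _ * coeffCc m f g s
      rw [hs, mul_zero, mul_zero]
    · rw [hcfg s (mem_tsupport_of_ne_zero hs)]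
      rfl
  set C := ‖toL2 m q‖ * ‖T'‖ + Mq * M + Mb * M + ‖T'‖ * ‖toL2 m b‖
  have hC : 0 ≤ C := by positivity
  have key : ∀ ε > 0, ‖inner ℂ (toL2 m q) (T' x) - inner ℂ y (T' (toL2 m b))‖ ≤ C * ε := by
    intro ε hε
    obtain ⟨p, hp⟩ := (denseRange_toL2 m).exists_dist_lt x hε
    obtain ⟨r, hr⟩ := (denseRange_toL2 m).exists_dist_lt y hε
    rw [dist_eq_norm] at hp hr
    -- One cutoff exact on the supports of both coefficient functions serves `S b` (approximated by
    -- `p`) and `S* q` (approximated by `r`).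
    obtain ⟨c, hc1, hc2, hcK⟩ := hcut (tsupport (coeffCc m p q) ∪ tsupport (coeffCc m b r))
      ((coeffCc m p q).hasCompactSupport.isCompact.union (coeffCc m b r).hasCompactSupport)
    have e1 := hagree c p q fun t ht => hcK t (.inl ht)
    have e2 := hagree c b r fun t ht => hcK t (.inr ht)
    have e3 : inner ℂ (toL2 m q) (leftConv m c x) = inner ℂ y (leftConv m c (toL2 m b)) := by
      rw [ContinuousLinearMap.adjoint_inner_left, ← map_leftConv hS]
    have e4 : ∀ v, inner ℂ (toL2 m q) (leftConv m c v) =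
        inner ℂ (leftConv m (ccStar m c) (toL2 m q)) v := fun v => by
      rw [inner_leftConv_left, ccStar_ccStar]
    -- Each of the four errors pairs one small difference, `x - p` or `y - r`, with a vector bounded
    -- independently of the cutoff.
    have e5 : inner ℂ (toL2 m q) (T' x) - inner ℂ y (T' (toL2 m b)) =
        inner ℂ (toL2 m q) (T' (x - toL2 m p)) -
          inner ℂ (leftConv m (ccStar m c) (toL2 m q)) (x - toL2 m p) +
          inner ℂ (y - toL2 m r) (leftConv m c (toL2 m b)) -
          inner ℂ (y - toL2 m r) (T' (toL2 m b)) := by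
      rw [← e4]
      simp only [map_sub, inner_sub_left, inner_sub_right, e1, e2, e3]
      ring
    have b1 : ‖inner ℂ (toL2 m q) (T' (x - toL2 m p))‖ ≤ ‖toL2 m q‖ * ‖T'‖ * ε := by
      refine (norm_inner_le_norm _ _).trans ?_
      rw [mul_assoc]
      gcongr
      exact (T'.le_opNorm _).trans (by gcongr)
    have b2 : ‖inner ℂ (leftConv m (ccStar m c) (toL2 m q)) (x - toL2 m p)‖ ≤ Mq * M * ε := by
      refine (norm_inner_le_norm _ _).trans ?_
      gcongr
      exact (hq _).trans (by gcongr)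
    have b3 : ‖inner ℂ (y - toL2 m r) (leftConv m c (toL2 m b))‖ ≤ Mb * M * ε := by
      refine (norm_inner_le_norm _ _).trans ?_
      rw [mul_comm]
      gcongr
      exact (hb _).trans (by gcongr)
    have b4 : ‖inner ℂ (y - toL2 m r) (T' (toL2 m b))‖ ≤ ‖T'‖ * ‖toL2 m b‖ * ε := by
      refine (norm_inner_le_norm _ _).trans ?_
      rw [mul_comm]
      gcongr
      exact T'.le_opNorm _
    rw [e5]
    refine (norm_sub_le _ _).trans ?_
    refine (add_le_add_left ((norm_add_le _ _).trans (add_le_add_left (norm_sub_le _ _) _)) _).trans ?_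
    simp only [C]
    linarith
  rw [← sub_eq_zero, ← norm_le_zero_iff]
  refine le_of_forall_pos_le_add fun ε hε => ?_
  have h1 := key (ε / (C + 1)) (by positivity)
  have h2 : C * (ε / (C + 1)) ≤ ε := by
    rw [mul_div_assoc', div_le_iff₀ (by positivity)]
    nlinarith
  linarith

/-- The operator of convolution by an `L^∞`-convolver is in `VN(G)`. -/
theorem mem_groupVN (hT : IsConvolutionOperator m φ T) : T ∈ (groupVN m).toStarSubalgebra := by
  rw [mem_groupVN_iff]
  intro S hS x
  have h1 : ∀ (h k : C_c(G, ℂ)) (x : Lp ℂ 2 m), leftConv m h (T (leftConv m k (S x))) =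
      S (leftConv m h (T (leftConv m k x))) := fun h k x =>
    (denseRange_toL2 m).induction_on x (isClosed_eq (by fun_prop) (by fun_prop))
      fun b => ext_inner_toL2 fun q => hT.leftConv_comm_of_toL2 h k b q hS
  -- The smoothing by `k` is removed along the approximate identity, and that by `h` in the same way
  -- afterwards.
  have h2 : ∀ (h : C_c(G, ℂ)), leftConv m h (T (S x)) = S (leftConv m h (T x)) := fun h => by
    refine tendsto_nhds_unique
      (((leftConv m h).continuous.comp T.continuous).tendsto _ |>.comp (tendsto_leftConv (S x))) ?_
    refine Tendsto.congr (fun k => (h1 h k x).symm) ?_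
    exact ((S.continuous.comp (leftConv m h).continuous).comp T.continuous).tendsto _
      |>.comp (tendsto_leftConv x)
  refine tendsto_nhds_unique (tendsto_leftConv (T (S x))) ?_
  exact ((S.continuous.tendsto _).comp (tendsto_leftConv (T x))).congr fun h => (h2 h).symm

end IsConvolutionOperator

end

section

variable {G : Type*} [Group G] [TopologicalSpace G] [IsTopologicalGroup G]
  [LocallyCompactSpace G] [MeasurableSpace G] [BorelSpace G] {m : Measure G} [m.IsHaarMeasure]
  [m.InnerRegularCompactLTTop]

/-! ### The pairing of `Λ(φ)` with `S¹A(G)` -/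

/-- A function in `A(G)` is bounded, and a bounded integrable function is square integrable. -/
theorem IsFourierRep.memLp_two {f g : ℕ → Lp ℂ 2 m} {u : G → ℂ} (h : IsFourierRep m f g u)
    (hu : Integrable u m) : MemLp u 2 m := by
  rw [memLp_two_iff_integrable_sq_norm hu.1]
  simp only [sq]
  exact hu.norm.bdd_mul hu.norm.1 (.of_forall fun s => by rw [norm_norm]; exact h.norm_le s)

theorem IsFourierRep.single (x y : Lp ℂ 2 m) :
    IsFourierRep m (fun n => if n = 0 then x else 0) (fun _ => y) (coeffFun m x y) where
  summable := summable_of_ne_finset_zero (s := {0}) fun n hn => by simp_all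
  hasSum s := by
    have := hasSum_ite_eq (0 : ℕ) (coeffFun m x y s)
    refine this.congr_fun fun n => ?_
    split_ifs <;> simp [coeffFun]

theorem tsum_inner_single (x y : Lp ℂ 2 m) (T : Lp ℂ 2 m →L[ℂ] Lp ℂ 2 m) :
    ∑' n : ℕ, inner ℂ y (T (if n = 0 then x else 0)) = inner ℂ y (T x) := by
  rw [tsum_eq_single 0 fun n hn => by simp [hn]]
  simp

/-- The coefficients of `∫ k(x) u(sx) dx`. -/
theorem IsFourierRep.average {f g : ℕ → Lp ℂ 2 m} {u : G → ℂ} (h : IsFourierRep m f g u)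
    (k : C_c(G, ℂ)) :
    IsFourierRep m (fun n => leftConv m k (f n)) g fun s => ∫ x, k x * u (s * x) ∂m where
  summable := by
    refine .of_nonneg_of_le (fun n => by positivity) (fun n => ?_) (h.summable.mul_left ‖leftConv m k‖)
    rw [← mul_assoc]
    gcongr
    exact (leftConv m k).le_opNorm _
  hasSum s := by
    have h1 : ∀ n, coeffFun m (leftConv m k (f n)) (g n) s =
        ∫ x, k x * coeffFun m (f n) (g n) (s * x) ∂m := fun n => by
      rw [coeffFun, inner_leftReg_right, inner_leftConv]
      simp only [coeffFun, leftReg_mul_apply, inner_leftReg_right s]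
    simp only [h1]
    refine hasSum_integral_of_dominated_convergence
      (fun n x => ‖k x‖ * (‖f n‖ * ‖g n‖)) (fun n => ?_) (fun n => .of_forall fun x => ?_)
      (.of_forall fun x => h.summable.mul_left _) ?_ (.of_forall fun x => ?_)
    · have := continuous_coeffFun (f n) (g n)
      exact (k.continuous.mul (this.comp (continuous_const_mul s))
        |>.integrable_of_hasCompactSupport k.hasCompactSupport.mul_right).1
    · rw [norm_mul]
      gcongr
      exact norm_coeffFun_le _ _ _
    · simp only [tsum_mul_left]
      exact (integrable_compactlySupported m k).norm.mul_const _
    · exact (h.hasSum (s * x)).mul_left (k x)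

theorem inner_toLp_conj {u : G → ℂ} (hu : MemLp (fun t => conj (u t)) 2 m) (y : Lp ℂ 2 m) :
    inner ℂ (hu.toLp _) y = ∫ t, u t * y t ∂m := by
  rw [L2.inner_def]
  refine integral_congr_ae ?_
  filter_upwards [hu.coeFn_toLp] with t ht
  rw [ht, RCLike.inner_apply, Complex.conj_conj, mul_comm]

theorem norm_conv_le (φ : Lp ℂ ∞ m) (k : C_c(G, ℂ)) (t : G) :
    ‖conv m φ k t‖ ≤ ‖φ‖ * ∫ x, modD m x * ‖k x‖ ∂m := by
  have h1 := ((isTestFun_compactlySupported (m := m) k).integrable_inv.comp_mul_left t⁻¹)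
  simp only [mul_inv_rev, inv_inv] at h1
  refine (norm_integral_Linfty_mul_le φ h1).trans_eq ?_
  congr 1
  let f : C_c(G, ℂ) := ⟨⟨fun t => (‖k t‖ : ℝ), by fun_prop⟩,
    k.hasCompactSupport.comp_left (g := fun z : ℂ => ((‖z‖ : ℝ) : ℂ)) (by simp)⟩
  have hf : ∀ t, f t = (‖k t‖ : ℝ) := fun _ => rfl
  have h2 := integral_inv (m := m) f
  have h3 := integral_mul_left_eq_self (μ := m) (fun s => ‖k s⁻¹‖) t⁻¹
  simp only [mul_inv_rev, inv_inv] at h3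
  rw [h3]
  simp only [hf, ← Complex.ofReal_mul] at h2
  rw [integral_complex_ofReal, integral_complex_ofReal] at h2
  exact_mod_cast h2

/-- Convolving on the right by a bump costs the integral of `modD` against it, and `modD` is nearly
`modD m 1` close to the identity. Uniformity in `k` allows passing from `C_c(G)` to `L¹(G)`. -/
theorem eventually_norm_conv_le (φ : Lp ℂ ∞ m) :
    ∀ᶠ k : C_c(G, ℂ) in bumpFilter m, ∀ t, ‖conv m φ k t‖ ≤ ‖φ‖ * (modD m 1 + 1) := by
  have hV : {x | modD m x < modD m 1 + 1} ∈ 𝓝 (1 : G) :=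
    continuous_modD.continuousAt.eventually_lt_const (lt_add_one _)
  filter_upwards [eventually_isBump (m := m) hV] with k hk t
  refine (norm_conv_le φ k t).trans ?_
  gcongr
  have h1 : ∫ x, (modD m 1 + 1) * ‖k x‖ ∂m = modD m 1 + 1 := by
    rw [integral_const_mul, hk.integral_norm, mul_one]
  rw [← h1]
  refine integral_mono ?_ ((integrable_compactlySupported m k).norm.const_mul _) fun x => ?_
  · exact (continuous_modD.mul k.continuous.norm).integrable_of_hasCompactSupport
      (k.hasCompactSupport.norm.mul_left)
  · by_cases hx : x ∈ {x | modD m x < modD m 1 + 1}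
    · exact mul_le_mul_of_nonneg_right (le_of_lt hx) (norm_nonneg _)
    · simp [hk.eq_zero x hx]

/-- By Fubini the integral equals `∫ k(x) F(x) dx` with `F(x) = ∫ φ(s) w(sx) ds`, and `F` is
continuous. -/
theorem tendsto_integral_mul_conv_of_compactlySupported (φ : Lp ℂ ∞ m) (w : C_c(G, ℂ)) :
    Tendsto (fun k : C_c(G, ℂ) => ∫ t, w t * conv m φ k t ∂m) (bumpFilter m)
      (𝓝 (∫ s, φ s * w s ∂m)) := by
  have hF : Continuous fun x => ∫ s, φ s * w (s * x) ∂m := by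
    refine continuous_iff_continuousAt.2 fun x₀ => ?_
    obtain ⟨W, hW, hx₀⟩ := exists_compact_mem_nhds x₀
    have hk : IsCompact ((fun p : G × G => p.1 * p.2⁻¹) '' (tsupport w ×ˢ W)) :=
      (w.hasCompactSupport.prod hW).image (by fun_prop)
    have hc := continuousOn_integral_bilinear_of_locally_integrable_of_compact_support
      (ContinuousLinearMap.mul ℂ ℂ) (f := fun x s => w (s * x)) (s := W) (g := φ) (μ := m) hk
      (Continuous.continuousOn (by fun_prop)) (fun x s hx hs => ?_) ?_
    · exact hc.continuousAt hx₀
    · by_contra hne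
      exact hs ⟨(s * x, x), ⟨mem_tsupport_of_ne_zero hne, hx⟩, by simp⟩
    · have : IsFiniteMeasure (m.restrict ((fun p : G × G => p.1 * p.2⁻¹) '' (tsupport w ×ˢ W))) :=
        isFiniteMeasure_restrict.2 hk.measure_lt_top.ne
      exact ((Lp.memLp φ).restrict _).integrable (by simp)
  have h1 := tendsto_integral_bump (m := m) hF
  simp only [mul_one, smul_eq_mul] at h1
  refine h1.congr fun k => ?_
  rw [integral_conv_mul]
  have h2 : ∀ s, ∫ t, w t * k (s⁻¹ * t) ∂m = ∫ x, k x * w (s * x) ∂m := fun s => by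
    have := integral_mul_left_eq_self (μ := m) (fun t => w t * k (s⁻¹ * t)) s
    rw [← this]
    simp only [inv_mul_cancel_left, mul_comm]
  simp only [h2]
  rw [integral_Linfty_mul_swap φ (F := fun s x => k x * w (s * x)) (by fun_prop)]
  · congr 1 with x
    rw [← integral_const_mul]
    congr 1 with s
    ring
  · refine hasCompactSupport_of_forall_mem
      (K := (fun p : G × G => p.1 * p.2⁻¹) '' (tsupport w ×ˢ tsupport k))
      ((w.hasCompactSupport.prod k.hasCompactSupport).image (by fun_prop)) k.hasCompactSupport
      fun s x hne => ?_
    have hk := mem_tsupport_of_ne_zero (left_ne_zero_of_mul hne)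
    have hw := mem_tsupport_of_ne_zero (right_ne_zero_of_mul hne)
    exact ⟨⟨(s * x, x), ⟨hw, hk⟩, by simp⟩, hk⟩

theorem exists_compactlySupported_integral_norm_sub_le {u : G → ℂ} (hu : Integrable u m) {ε : ℝ}
    (hε : 0 < ε) : ∃ w : C_c(G, ℂ), ∫ t, ‖u t - w t‖ ∂m ≤ ε := by
  have hu' := memLp_one_iff_integrable.2 hu
  obtain ⟨w, hw, -⟩ := exists_compactlySupported_eLpNorm_sub_le (p := 1) (q := 1) le_rfl one_le_two
    le_rfl one_le_two hu' hu' hε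
  refine ⟨w, ?_⟩
  have h1 := integral_norm_eq_lintegral_enorm (hu.sub (integrable_compactlySupported m w)).1
  rw [← eLpNorm_one_eq_lintegral_enorm] at h1
  exact h1.trans_le (ENNReal.toReal_le_of_le_ofReal hε.le hw)

theorem tendsto_integral_mul_conv (φ : Lp ℂ ∞ m) {u : G → ℂ} (hu : Integrable u m) :
    Tendsto (fun k : C_c(G, ℂ) => ∫ t, u t * conv m φ k t ∂m) (bumpFilter m)
      (𝓝 (∫ s, φ s * u s ∂m)) := by
  rw [Metric.tendsto_nhds]
  intro ε hε
  set B := ‖φ‖ * (modD m 1 + 1)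
  have hB : 0 ≤ B := mul_nonneg (norm_nonneg _) (by linarith [modD_pos (m := m) (1 : G)])
  obtain ⟨δ, hδ, hδε⟩ : ∃ δ > 0, δ * (B + ‖φ‖) < ε / 2 := by
    refine ⟨ε / (2 * (B + ‖φ‖ + 1)), by positivity, ?_⟩
    rw [div_mul_eq_mul_div, div_lt_div_iff₀ (by positivity) (by positivity)]
    nlinarith
  obtain ⟨w, hw⟩ := exists_compactlySupported_integral_norm_sub_le hu hδ
  have huw : Integrable (fun t => u t - w t) m := hu.sub (integrable_compactlySupported m w)
  filter_upwards [eventually_norm_conv_le φ,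
    (Metric.tendsto_nhds.1 (tendsto_integral_mul_conv_of_compactlySupported φ w)) (ε / 2)
      (half_pos hε)] with k hk hk'
  have hi : ∀ {v : G → ℂ}, Integrable v m → Integrable (fun t => v t * conv m φ k t) m :=
    fun hv => hv.mul_bdd (continuous_conv φ k).aestronglyMeasurable (.of_forall hk)
  have e1 : ∫ t, u t * conv m φ k t ∂m - ∫ s, φ s * u s ∂m =
      ∫ t, (u t - w t) * conv m φ k t ∂m - ∫ s, φ s * (u s - w s) ∂m +
        (∫ t, w t * conv m φ k t ∂m - ∫ s, φ s * w s ∂m) := by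
    simp only [sub_mul, mul_sub]
    rw [integral_sub (hi hu) (hi (integrable_compactlySupported m w)),
      integral_sub (integrable_Linfty_mul φ hu)
        (integrable_Linfty_mul φ (integrable_compactlySupported m w))]
    ring
  have b1 : ‖∫ t, (u t - w t) * conv m φ k t ∂m‖ ≤ δ * B := by
    refine (norm_integral_le_of_norm_le (huw.norm.mul_const B) (.of_forall fun t => ?_)).trans ?_
    · rw [norm_mul]
      gcongr
      exact hk t
    · rw [_root_.MeasureTheory.integral_mul_const]
      gcongr
  have b2 : ‖∫ s, φ s * (u s - w s) ∂m‖ ≤ δ * ‖φ‖ := by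
    refine (norm_integral_Linfty_mul_le φ huw).trans ?_
    rw [mul_comm]
    gcongr
  rw [dist_eq_norm] at hk' ⊢
  rw [e1]
  refine (norm_add_le _ _).trans_lt ?_
  have := norm_sub_le (∫ t, (u t - w t) * conv m φ k t ∂m) (∫ s, φ s * (u s - w s) ∂m)
  linarith

/-- For a convolver `φ`, the pairing of `Λ(φ)` with `u ∈ A(G) ∩ L¹(G)` is `∫ φ u`. -/
theorem IsConvolutionOperator.tsum_inner_eq {φ : Lp ℂ ∞ m} {T : Lp ℂ 2 m →L[ℂ] Lp ℂ 2 m}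
    (hT : IsConvolutionOperator m φ T) {f g : ℕ → Lp ℂ 2 m} {u : G → ℂ}
    (h : IsFourierRep m f g u) (hu : Integrable u m) :
    ∑' n, inner ℂ (g n) (T (f n)) = ∫ s, φ s * u s ∂m := by
  have hu2 : MemLp (fun t => conj (u t)) 2 m := (h.memLp_two hu).star
  have h1 : ∀ k : C_c(G, ℂ), ∑' n, inner ℂ (g n) (T (leftConv m k (f n))) =
      ∫ t, u t * conv m φ k t ∂m := by
    intro k
    -- Here square integrability of `u` enters: the average is one coefficient function.
    have e : (fun s => ∫ x, k x * u (s * x) ∂m) = coeffFun m (toL2 m k) (hu2.toLp _) := by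
      funext s
      rw [coeffFun, inner_toLp_conj, ← integral_mul_left_eq_self (μ := m) _ s⁻¹]
      refine integral_congr_ae ?_
      filter_upwards [coeFn_toL2 m (ltrans s k)] with t ht
      rw [leftReg_toL2, ht]
      simp [mul_comm]
    -- The average has two representations; membership of `T` in `VN(G)` makes their pairings with
    -- `T` equal.
    have := tsum_inner_eq_of_isFourierRep hT.mem_groupVN (h.average k)
      (e ▸ IsFourierRep.single (toL2 m k) (hu2.toLp _))
    rw [this, tsum_inner_single, inner_toLp_conj]
    refine integral_congr_ae ?_
    filter_upwards [hT.apply_toL2 k] with t ht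
    rw [ht]
  refine tendsto_nhds_unique ?_ (tendsto_integral_mul_conv φ hu)
  refine Tendsto.congr h1 ?_
  refine tendsto_tsum_of_dominated_convergence (h.summable.mul_left ‖T‖) (fun n => ?_) ?_
  · exact (((innerSL ℂ (g n)).continuous.comp T.continuous).tendsto _).comp
      (tendsto_leftConv (f n))
  · filter_upwards [eventually_isBump (m := m) (univ_mem : (univ : Set G) ∈ 𝓝 1)] with k hk n
    refine (norm_inner_le_norm _ _).trans ?_
    rw [mul_comm, ← mul_assoc]
    gcongr
    exact (T.le_opNorm _).trans (by gcongr; exact hk.norm_leftConv_apply_le _)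

/-- An operator whose pairing with `A(G) ∩ L¹(G)` is integration against `φ` is convolution
by `φ`. -/
theorem isConvolutionOperator_of_tsum_inner_eq {φ : Lp ℂ ∞ m} {T : Lp ℂ 2 m →L[ℂ] Lp ℂ 2 m}
    (hT : ∀ (f g : ℕ → Lp ℂ 2 m) (u : G → ℂ), IsFourierRep m f g u → Integrable u m →
      ∑' n, inner ℂ (g n) (T (f n)) = ∫ s, φ s * u s ∂m) : IsConvolutionOperator m φ T := by
  refine isConvolutionOperator_of_compactlySupported fun f =>
    apply_toL2_ae_eq_conv f fun d => ?_
  have := hT _ _ _ (IsFourierRep.single (toL2 m f) (toL2 m d))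
    (integrable_compactlySupported m (coeffCc m f d))
  rwa [tsum_inner_single] at this

end

section

/-! ### The dual of `L¹` -/

section General

variable {X : Type*} [MeasurableSpace X] {μ : Measure X}

theorem norm_toLp_one {f : X → ℂ} (hf : MemLp f 1 μ) : ‖hf.toLp f‖ = ∫ x, ‖f x‖ ∂μ := by
  rw [Lp.norm_toLp, integral_norm_eq_lintegral_enorm hf.1, eLpNorm_one_eq_lintegral_enorm]

theorem integral_norm_mul_le_of_two {w : X → ℝ} (hw : MemLp w 2 μ) :
    ∃ M : ℝ, ∀ v : Lp ℂ 2 μ, ∫ x, w x * ‖v x‖ ∂μ ≤ M * ‖v‖ := by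
  refine ⟨‖hw.toLp w‖, fun v => ?_⟩
  have h1 : ∫ x, w x * ‖v x‖ ∂μ = inner ℝ (hw.toLp w) ((Lp.memLp v).norm.toLp _) := by
    rw [L2.inner_def]
    refine integral_congr_ae ?_
    filter_upwards [hw.coeFn_toLp, (Lp.memLp v).norm.coeFn_toLp] with x h1 h2
    rw [h1, h2, RCLike.inner_apply, conj_trivial, mul_comm]
  rw [h1]
  refine (le_abs_self _).trans ((abs_real_inner_le_norm _ _).trans_eq ?_)
  rw [Lp.norm_toLp (μ := μ) (fun x => ‖v x‖), eLpNorm_norm, Lp.norm_def v]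

/-- Testing with the restriction of `h` to the set where `w < ‖h‖` forces that set to be null. -/
theorem ae_norm_le_of_norm_inner_le {h : Lp ℂ 2 μ} {w : X → ℝ} (hwm : Measurable w)
    (hw : MemLp w 2 μ) (hw0 : ∀ x, 0 ≤ w x)
    (H : ∀ v : Lp ℂ 2 μ, ‖inner ℂ h v‖ ≤ ∫ x, w x * ‖v x‖ ∂μ) : ∀ᵐ x ∂μ, ‖h x‖ ≤ w x := by
  set E := {x | w x < ‖h x‖}
  have hE : MeasurableSet E := measurableSet_lt hwm (Lp.stronglyMeasurable h).measurable.norm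
  have hv : MemLp (E.indicator h) 2 μ := (Lp.memLp h).indicator hE
  have h1 := H (hv.toLp _)
  have e1 : inner ℂ h (hv.toLp _) = ((∫ x, E.indicator (fun x => ‖h x‖ ^ 2) x ∂μ : ℝ) : ℂ) := by
    rw [L2.inner_def, ← integral_complex_ofReal]
    refine integral_congr_ae ?_
    filter_upwards [hv.coeFn_toLp] with x hx
    rw [hx]
    by_cases hxE : x ∈ E
    · simp only [indicator_of_mem hxE]
      rw [inner_self_eq_norm_sq_to_K]
      norm_cast
    · simp [indicator_of_notMem hxE]
  have e2 : ∫ x, w x * ‖hv.toLp _ x‖ ∂μ = ∫ x, E.indicator (fun x => w x * ‖h x‖) x ∂μ := by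
    refine integral_congr_ae ?_
    filter_upwards [hv.coeFn_toLp] with x hx
    rw [hx]
    by_cases hxE : x ∈ E <;> simp [hxE]
  have i1 : Integrable (fun x => ‖h x‖ ^ 2) μ :=
    (memLp_two_iff_integrable_sq_norm (Lp.aestronglyMeasurable h)).1 (Lp.memLp h)
  have i2 : Integrable (fun x => w x * ‖h x‖) μ := hw.integrable_mul (Lp.memLp h).norm
  rw [e1, e2, Complex.norm_real] at h1
  have h2 := (le_abs_self _).trans h1
  rw [← sub_nonpos, ← integral_sub (i1.indicator hE) (i2.indicator hE)] at h2
  have hnn : ∀ x, 0 ≤ E.indicator (fun x => ‖h x‖ ^ 2) x - E.indicator (fun x => w x * ‖h x‖) x := by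
    intro x
    by_cases hxE : x ∈ E
    · simp only [indicator_of_mem hxE]
      have : w x < ‖h x‖ := hxE
      nlinarith [norm_nonneg (h x)]
    · simp [hxE]
  have h3 := (integral_eq_zero_iff_of_nonneg hnn ((i1.indicator hE).sub (i2.indicator hE))).1
    (le_antisymm h2 (integral_nonneg hnn))
  filter_upwards [h3] with x hx
  by_contra hxE
  have hlt : w x < ‖h x‖ := not_le.1 hxE
  have hxE : x ∈ E := hlt
  simp only [indicator_of_mem hxE, Pi.zero_apply] at hx
  nlinarith [hw0 x]

/-- Multiplication by a weight `w ∈ L²` maps `L²` to `L¹`, so Riesz represents `v ↦ β (w v)`. Where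
`w > 0`, the quotient of `conj h` by `w` is a density of `β` bounded by `‖β‖`. -/
theorem exists_weighted_representation (β : StrongDual ℂ (Lp ℂ 1 μ)) {w : X → ℝ}
    (hwm : Measurable w) (hw : MemLp w 2 μ) (hw0 : ∀ x, 0 ≤ w x) :
    ∃ h : Lp ℂ 2 μ, (∀ᵐ x ∂μ, ‖h x‖ ≤ ‖β‖ * w x) ∧
      ∀ (v : X → ℂ) (_ : MemLp v 2 μ) (hwv : MemLp (fun x => w x * v x) 1 μ),
        β (hwv.toLp _) = ∫ x, conj (h x) * v x ∂μ := by
  have hmul : ∀ {v : X → ℂ}, MemLp v 2 μ → MemLp (fun x => (w x : ℂ) * v x) 1 μ := fun hv =>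
    memLp_one_iff_integrable.2 (hw.ofReal.integrable_mul hv)
  obtain ⟨M, hM⟩ := integral_norm_mul_le_of_two hw
  have hnorm : ∀ v : Lp ℂ 2 μ, ‖β ((hmul (Lp.memLp v)).toLp _)‖ ≤ ‖β‖ * ∫ x, w x * ‖v x‖ ∂μ := by
    intro v
    refine (β.le_opNorm _).trans_eq ?_
    rw [norm_toLp_one]
    simp only [norm_mul, Complex.norm_real, Real.norm_of_nonneg (hw0 _)]
  let L : StrongDual ℂ (Lp ℂ 2 μ) := LinearMap.mkContinuous
    { toFun := fun v => β ((hmul (Lp.memLp v)).toLp _)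
      map_add' := fun v v' => by
        rw [← map_add, ← MemLp.toLp_add]
        congr 1
        refine MemLp.toLp_congr _ _ ?_
        filter_upwards [Lp.coeFn_add v v'] with x hx
        rw [Pi.add_apply, hx, Pi.add_apply, mul_add]
      map_smul' := fun c v => by
        rw [RingHom.id_apply, ← map_smul, ← MemLp.toLp_const_smul]
        congr 1
        refine MemLp.toLp_congr _ _ ?_
        filter_upwards [Lp.coeFn_smul c v] with x hx
        rw [Pi.smul_apply, hx, Pi.smul_apply, smul_eq_mul, smul_eq_mul, mul_left_comm] } (‖β‖ * M) fun v => (hnorm v).trans (by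
          rw [mul_assoc]
          exact mul_le_mul_of_nonneg_left (hM v) (norm_nonneg _))
  have hL : ∀ v, L v = β ((hmul (Lp.memLp v)).toLp _) := fun _ => rfl
  let h := (InnerProductSpace.toDual ℂ (Lp ℂ 2 μ)).symm L
  have hh : ∀ v, inner ℂ h v = L v := fun v => InnerProductSpace.toDual_symm_apply
  refine ⟨h, ae_norm_le_of_norm_inner_le (hwm.const_mul _) (hw.const_mul _)
    (fun x => mul_nonneg (norm_nonneg _) (hw0 x)) fun v => ?_, fun v hv hwv => ?_⟩
  · rw [hh, hL]
    refine (hnorm v).trans_eq ?_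
    rw [← integral_const_mul]
    simp only [mul_assoc]
  · have h1 := hh (hv.toLp v)
    rw [hL, L2.inner_def] at h1
    have h2 : (hmul (Lp.memLp (hv.toLp v))).toLp _ = hwv.toLp _ := by
      refine MemLp.toLp_congr _ _ ?_
      filter_upwards [hv.coeFn_toLp] with x hx
      rw [hx]
    rw [← h2, ← h1]
    refine integral_congr_ae ?_
    filter_upwards [hv.coeFn_toLp] with x hx
    rw [hx, RCLike.inner_apply, mul_comm]

end General

variable {G : Type*} [Group G] [TopologicalSpace G] [IsTopologicalGroup G]
  [LocallyCompactSpace G] [MeasurableSpace G] [BorelSpace G] {m : Measure G}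

theorem exists_seq_compactlySupported_tendsto_ae [IsFiniteMeasureOnCompacts m]
    [m.InnerRegularCompactLTTop] (h : Lp ℂ 2 m) :
    ∃ g : ℕ → C_c(G, ℂ), ∀ᵐ t ∂m, Tendsto (fun n => g n t) atTop (𝓝 (h t)) := by
  obtain ⟨y, hy, hlim⟩ := mem_closure_iff_seq_limit.1 (denseRange_toL2 m h)
  choose g hg using hy
  obtain ⟨ns, -, hns⟩ := (tendstoInMeasure_of_tendsto_Lp hlim).exists_seq_tendsto_ae
  refine ⟨fun n => g (ns n), ?_⟩
  have h1 : ∀ᵐ t ∂m, ∀ n, y (ns n) t = g (ns n) t := by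
    rw [ae_all_iff]
    intro n
    rw [← hg]
    exact coeFn_toL2 m _
  filter_upwards [hns, h1] with t h2 h3
  simpa only [h3] using h2

/-- A continuous square integrable weight, positive on a given `σ`-compact set. -/
theorem exists_weight (m : Measure G) [IsFiniteMeasureOnCompacts m] {L : ℕ → Set G}
    (hL : ∀ n, IsCompact (L n)) :
    ∃ w : G → ℝ, Continuous w ∧ (∀ t, 0 ≤ w t) ∧ (∀ t ∈ ⋃ n, L n, 0 < w t) ∧ MemLp w 2 m := by
  have : ∀ n, ∃ χ : C(G, ℝ), EqOn χ 1 (L n) ∧ HasCompactSupport χ ∧ ∀ x, χ x ∈ Icc (0 : ℝ) 1 := by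
    intro n
    obtain ⟨χ, h1, -, h2, h3⟩ := exists_continuous_one_zero_of_isCompact (hL n)
      isClosed_empty (disjoint_empty _)
    exact ⟨χ, h1, h2, h3⟩
  choose χ hχ1 hχc hχb using this
  have hχi : ∀ n, Integrable (χ n) m := fun n =>
    (χ n).continuous.integrable_of_hasCompactSupport (hχc n)
  have hI : ∀ n, 0 ≤ ∫ t, χ n t ∂m := fun n => integral_nonneg fun t => (hχb n t).1
  -- The geometric factor makes the series converge uniformly; dividing by `1 + ∫ χ n` makes it
  -- converge in `L¹` as well. A bounded integrable function is then square integrable.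
  set a : ℕ → ℝ := fun n => (1 / 2) ^ n / (1 + ∫ t, χ n t ∂m)
  have ha0 : ∀ n, 0 < a n := fun n => div_pos (by positivity) (by linarith [hI n])
  have ha1 : ∀ n, a n ≤ (1 / 2) ^ n := fun n =>
    div_le_self (by positivity) (by linarith [hI n])
  have hle : ∀ n t, ‖a n * χ n t‖ ≤ (1 / 2) ^ n := fun n t => by
    rw [Real.norm_of_nonneg (mul_nonneg (ha0 n).le (hχb n t).1)]
    exact (mul_le_of_le_one_right (ha0 n).le (hχb n t).2).trans (ha1 n)
  have hs := summable_geometric_two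
  have hst : ∀ t, Summable fun n => a n * χ n t := fun t => .of_norm_bounded hs fun n => hle n t
  have hc : Continuous fun t => ∑' n, a n * χ n t :=
    continuous_tsum (fun n => by fun_prop) hs hle
  have hnn : ∀ t, 0 ≤ ∑' n, a n * χ n t := fun t =>
    tsum_nonneg fun n => mul_nonneg (ha0 n).le (hχb n t).1
  have hn : ∀ n, ∫ t, ‖a n * χ n t‖ ∂m ≤ (1 / 2) ^ n := fun n => by
    have : ∀ t, ‖a n * χ n t‖ = a n * χ n t := fun t =>
      Real.norm_of_nonneg (mul_nonneg (ha0 n).le (hχb n t).1)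
    simp only [this]
    rw [integral_const_mul, div_mul_eq_mul_div, div_le_iff₀ (by linarith [hI n])]
    gcongr
    linarith
  have hint : Integrable (fun t => ∑' n, a n * χ n t) m := by
    refine ⟨hc.aestronglyMeasurable, ?_⟩
    calc ∫⁻ t, ‖∑' n, a n * χ n t‖ₑ ∂m ≤ ∫⁻ t, ∑' n, ‖a n * χ n t‖ₑ ∂m :=
          lintegral_mono fun t => enorm_tsum_le_tsum_enorm
      _ = ∑' n, ∫⁻ t, ‖a n * χ n t‖ₑ ∂m :=
          lintegral_tsum fun n => ((hχi n).const_mul _).1.enorm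
      _ ≤ ∑' n, ENNReal.ofReal ((1 / 2) ^ n) := ENNReal.tsum_le_tsum fun n => by
          rw [← ofReal_integral_norm_eq_lintegral_enorm ((hχi n).const_mul _)]
          exact ENNReal.ofReal_le_ofReal (hn n)
      _ < ∞ := by
          rw [← ENNReal.ofReal_tsum_of_nonneg (fun n => by positivity) hs]
          exact ENNReal.ofReal_lt_top
  refine ⟨fun t => ∑' n, a n * χ n t, hc, hnn, fun t ht => ?_, ?_⟩
  · obtain ⟨n, hn⟩ := mem_iUnion.1 ht
    refine (hst t).tsum_pos (fun n => mul_nonneg (ha0 n).le (hχb n t).1) n ?_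
    rw [hχ1 n hn]
    simpa using ha0 n
  · rw [memLp_two_iff_integrable_sq hint.1]
    simp only [sq]
    refine hint.bdd_mul (c := 2) hint.1 (.of_forall fun t => ?_)
    rw [← tsum_geometric_two]
    exact tsum_of_norm_bounded hs.hasSum (hle · t)

end

/-! ### Densities of functionals on `L¹`, glued over the cosets of an open subgroup -/

section

variable {G : Type*} [Group G] [TopologicalSpace G] [IsTopologicalGroup G]
  [LocallyCompactSpace G] [MeasurableSpace G] [BorelSpace G] {m : Measure G}

/-- The restriction of a continuous function of compact support to a coset of an open subgroup. -/
def cosetPart {H : Subgroup G} (hH : IsOpen (H : Set G)) (q : G ⧸ H) (c : C_c(G, ℂ)) : C_c(G, ℂ) :=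
  ⟨⟨fun t => ({q} : Set (G ⧸ H)).indicator 1 (t : G ⧸ H) * c t, by
    have := QuotientGroup.discreteTopology hH
    have h1 : Continuous fun t : G => ({q} : Set (G ⧸ H)).indicator (1 : G ⧸ H → ℂ) (t : G ⧸ H) :=
      (continuous_of_discreteTopology (f := ({q} : Set (G ⧸ H)).indicator (1 : G ⧸ H → ℂ))).comp
        QuotientGroup.continuous_mk
    exact h1.mul c.continuous⟩, c.hasCompactSupport.mul_left⟩

theorem cosetPart_apply {H : Subgroup G} (hH : IsOpen (H : Set G)) (q : G ⧸ H) (c : C_c(G, ℂ))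
    (t : G) : cosetPart hH q c t = ({q} : Set (G ⧸ H)).indicator 1 (t : G ⧸ H) * c t := rfl

/-- A continuous function of compact support is the sum of its restrictions to finitely many
cosets of an open subgroup. -/
theorem exists_eq_sum_cosetPart {H : Subgroup G} (hH : IsOpen (H : Set G)) (c : C_c(G, ℂ)) :
    ∃ F : Finset (G ⧸ H), c = ∑ q ∈ F, cosetPart hH q c := by
  have := QuotientGroup.discreteTopology hH
  have hfin : ((fun t : G => (t : G ⧸ H)) '' tsupport c).Finite :=
    (c.hasCompactSupport.isCompact.image QuotientGroup.continuous_mk).finite_of_discrete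
  refine ⟨hfin.toFinset, ?_⟩
  ext t
  rw [CompactlySupportedContinuousMap.coe_sum, Finset.sum_apply]
  simp only [cosetPart_apply, ← Finset.sum_mul]
  by_cases ht : c t = 0
  · simp [ht]
  · rw [Finset.sum_eq_single (t : G ⧸ H)]
    · simp
    · intro q _ hq
      simp [hq.symm]
    · intro hq
      exact absurd (hfin.mem_toFinset.2 ⟨t, mem_tsupport_of_ne_zero ht, rfl⟩) hq

variable [m.IsHaarMeasure] [m.InnerRegularCompactLTTop]

/-- A bounded functional on `L¹` is represented on `C_c` by a bounded function. -/
theorem exists_bounded_representation (β : StrongDual ℂ (Lp ℂ 1 m)) :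
    ∃ φ : G → ℂ, StronglyMeasurable φ ∧ (∀ t, ‖φ t‖ ≤ ‖β‖) ∧ ∀ c : C_c(G, ℂ),
      β ((memLp_compactlySupported m c 1).toLp c) = ∫ t, φ t * c t ∂m := by
  obtain ⟨H, L, hHo, -, hL, hHL⟩ := exists_open_sigmaCompact_subgroup (G := G) (fun _ => {1})
    fun _ => isCompact_singleton
  obtain ⟨w, hwc, hw0, hwp, hw2⟩ := exists_weight m hL
  rw [← hHL] at hwp
  -- The weight is positive on `H`; translating it by a representative gives one positive on the
  -- coset.
  let W : G ⧸ H → G → ℝ := fun q t => w (q.out⁻¹ * t)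
  have hWc : ∀ q, Continuous (W q) := fun q => hwc.comp (continuous_const_mul _)
  have hWp : ∀ t : G, 0 < W (t : G ⧸ H) t := fun t =>
    hwp _ (QuotientGroup.eq.1 (QuotientGroup.out_eq' (t : G ⧸ H)))
  have hrepr := fun q => exists_weighted_representation β (hWc q).measurable
    (hw2.comp_measurePreserving (measurePreserving_mul_left m q.out⁻¹)) fun t => hw0 _
  choose h hb hr using hrepr
  choose g hg using fun q => exists_seq_compactlySupported_tendsto_ae (h q)
  -- There may be uncountably many cosets, so gluing measurable densities need not be measurable.
  -- Continuous approximants are glued instead: the cosets are open, hence the result is continuous,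
  -- and its sequential limit is measurable.
  let φn : ℕ → G → ℂ := fun n t => conj (g (t : G ⧸ H) n t) / W (t : G ⧸ H) t
  have hφn : ∀ n, Continuous (φn n) := by
    intro n
    refine continuous_iff_continuousAt.2 fun t₀ => ?_
    have := QuotientGroup.discreteTopology hHo
    have h1 : ∀ᶠ t : G in 𝓝 t₀, (t : G ⧸ H) = (t₀ : G ⧸ H) :=
      (QuotientGroup.continuous_mk.tendsto t₀).eventually
        (IsOpen.mem_nhds (isOpen_discrete {(t₀ : G ⧸ H)}) rfl)
    have h2 : ContinuousAt (fun t => conj (g (t₀ : G ⧸ H) n t) / (W (t₀ : G ⧸ H) t : ℂ)) t₀ := by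
      refine ContinuousAt.div (by fun_prop) ?_ ?_
      · exact (Complex.continuous_ofReal.comp (hWc _)).continuousAt
      · exact_mod_cast (hWp t₀).ne'
    refine h2.congr ?_
    filter_upwards [h1] with t ht
    simp only [φn, ht]
  let φ₀ : G → ℂ := fun t => limUnder atTop fun n => φn n t
  have hφ₀ : StronglyMeasurable φ₀ :=
    StronglyMeasurable.limUnder fun n => (hφn n).stronglyMeasurable
  have hE : MeasurableSet {t | ‖φ₀ t‖ ≤ ‖β‖} := measurableSet_le hφ₀.measurable.norm measurable_const
  refine ⟨{t | ‖φ₀ t‖ ≤ ‖β‖}.indicator φ₀, hφ₀.indicator hE, fun t => ?_, fun c => ?_⟩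
  · by_cases ht : t ∈ {t | ‖φ₀ t‖ ≤ ‖β‖}
    · rw [indicator_of_mem ht]
      exact ht
    · simp [indicator_of_notMem ht]
  set φ := {t | ‖φ₀ t‖ ≤ ‖β‖}.indicator φ₀
  have hφb : ∀ t, ‖φ t‖ ≤ ‖β‖ := fun t => by
    by_cases ht : t ∈ {t | ‖φ₀ t‖ ≤ ‖β‖}
    · simp only [φ, indicator_of_mem ht]
      exact ht
    · simp [φ, indicator_of_notMem ht]
  -- The exceptional null set depends on the coset, and these sets cannot all be collected. This
  -- suffices because a function in `C_c(G)` meets only finitely many cosets.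
  have key : ∀ q, ∀ᵐ t : G ∂m, (t : G ⧸ H) = q → φ t = conj (h q t) / W q t := by
    intro q
    filter_upwards [hg q, hb q] with t h1 h2 ht
    subst ht
    have h3 : φ₀ t = conj (h (t : G ⧸ H) t) / W (t : G ⧸ H) t := by
      refine Tendsto.limUnder_eq ?_
      exact ((Complex.continuous_conj.tendsto _).comp h1).div_const _
    have h4 : t ∈ {t | ‖φ₀ t‖ ≤ ‖β‖} := by
      rw [mem_ofPred_eq, h3, norm_div, RCLike.norm_conj, Complex.norm_real,
        Real.norm_of_nonneg (hWp t).le, div_le_iff₀ (hWp t)]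
      exact h2
    rw [← h3]
    exact indicator_of_mem h4 _
  have hint : ∀ c : C_c(G, ℂ), Integrable (fun t => φ t * c t) m := fun c =>
    (integrable_compactlySupported m c).bdd_mul (hφ₀.indicator hE).aestronglyMeasurable
      (.of_forall hφb)
  let A₁ : C_c(G, ℂ) →ₗ[ℂ] ℂ :=
    { toFun := fun c => β ((memLp_compactlySupported m c 1).toLp c)
      map_add' := fun c d => by rw [← map_add]; rfl
      map_smul' := fun a c => by rw [RingHom.id_apply, ← map_smul]; rfl }
  let A₂ : C_c(G, ℂ) →ₗ[ℂ] ℂ :=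
    { toFun := fun c => ∫ t, φ t * c t ∂m
      map_add' := fun c d => by
        simp only [CompactlySupportedContinuousMap.add_apply, mul_add]
        exact integral_add (hint c) (hint d)
      map_smul' := fun a c => by
        simp only [CompactlySupportedContinuousMap.smul_apply, smul_eq_mul, RingHom.id_apply,
          mul_left_comm _ a, integral_const_mul] }
  change A₁ c = A₂ c
  obtain ⟨F, hF⟩ := exists_eq_sum_cosetPart hHo c
  rw [hF, map_sum, map_sum]
  refine Finset.sum_congr rfl fun q _ => ?_
  -- Dividing by the weight stays in `C_c(G)`, since the weight is positive on the coset and the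
  -- numerator vanishes on all other cosets, which are open.
  let v : C_c(G, ℂ) := ⟨⟨fun t => cosetPart hHo q c t / W q t, by
    refine continuous_iff_continuousAt.2 fun t₀ => ?_
    by_cases ht : (t₀ : G ⧸ H) = q
    · refine ContinuousAt.div (by fun_prop) ?_ ?_
      · exact (Complex.continuous_ofReal.comp (hWc _)).continuousAt
      · rw [← ht]
        exact_mod_cast (hWp t₀).ne'
    · have := QuotientGroup.discreteTopology hHo
      have h1 : ∀ᶠ t : G in 𝓝 t₀, (t : G ⧸ H) = (t₀ : G ⧸ H) :=
        (QuotientGroup.continuous_mk.tendsto t₀).eventually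
          (IsOpen.mem_nhds (isOpen_discrete {(t₀ : G ⧸ H)}) rfl)
      refine (continuousAt_const (y := (0 : ℂ))).congr ?_
      filter_upwards [h1] with t ht'
      simp [cosetPart_apply, ht', ht]⟩, by
    simp only [div_eq_mul_inv]
    exact (cosetPart hHo q c).hasCompactSupport.mul_right⟩
  have hv : ∀ t, v t = cosetPart hHo q c t / W q t := fun _ => rfl
  have hWv : ∀ t, (W q t : ℂ) * v t = cosetPart hHo q c t := fun t => by
    rw [hv]
    by_cases ht : (t : G ⧸ H) = q
    · have : (W q t : ℂ) ≠ 0 := by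
        rw [← ht]
        exact_mod_cast (hWp t).ne'
      field_simp
    · simp [cosetPart_apply, ht]
  have hm : MemLp (fun t => (W q t : ℂ) * v t) 1 m := by
    simp only [hWv]
    exact memLp_compactlySupported m _ 1
  have h1 := hr q v (memLp_compactlySupported m v 2) hm
  have h2 : A₁ (cosetPart hHo q c) = β (hm.toLp _) := by
    change β _ = _
    congr 1
    exact MemLp.toLp_congr _ _ (.of_forall fun t => (hWv t).symm)
  rw [h2, h1]
  refine integral_congr_ae ?_
  filter_upwards [key q] with t ht
  by_cases htq : (t : G ⧸ H) = q
  · rw [ht htq, hv]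
    ring
  · simp [hv, cosetPart_apply, htq]

/-- `L^∞` is the dual of `L¹` for an inner regular Haar measure. -/
theorem exists_Linfty_representation (β : StrongDual ℂ (Lp ℂ 1 m)) :
    ∃ φ : Lp ℂ ∞ m, ‖φ‖ ≤ ‖β‖ ∧ ∀ (v : G → ℂ) (hv : MemLp v 1 m),
      β (hv.toLp v) = ∫ t, φ t * v t ∂m := by
  obtain ⟨φ, hφm, hφb, hφ⟩ := exists_bounded_representation β
  have hmem : MemLp φ ∞ m := memLp_top_of_bound hφm.aestronglyMeasurable ‖β‖ (.of_forall hφb)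
  have hn : ‖hmem.toLp φ‖ ≤ ‖β‖ := by
    rw [Lp.norm_toLp, eLpNorm_exponent_top]
    refine ENNReal.toReal_le_of_le_ofReal (norm_nonneg _) ?_
    refine eLpNormEssSup_le_of_ae_bound (.of_forall hφb)
  refine ⟨hmem.toLp φ, hn, fun v hv => ?_⟩
  have hvi := memLp_one_iff_integrable.1 hv
  rw [← sub_eq_zero, ← norm_le_zero_iff]
  refine le_of_forall_pos_le_add fun ε hε => ?_
  obtain ⟨c, hc⟩ := exists_compactlySupported_integral_norm_sub_le hvi
    (ε := ε / (2 * (‖β‖ + 1))) (by positivity)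
  have hci := integrable_compactlySupported m c
  have hvc : MemLp (fun t => v t - c t) 1 m := memLp_one_iff_integrable.2 (hvi.sub hci)
  have e1 : β (hv.toLp v) - ∫ t, hmem.toLp φ t * v t ∂m =
      β (hvc.toLp _) - ∫ t, hmem.toLp φ t * (v t - c t) ∂m := by
    have e2 : hvc.toLp _ = hv.toLp v - (memLp_compactlySupported m c 1).toLp c := rfl
    have e3 : ∫ t, hmem.toLp φ t * c t ∂m = ∫ t, φ t * c t ∂m := by
      refine integral_congr_ae ?_
      filter_upwards [hmem.coeFn_toLp] with t ht
      rw [ht]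
    simp only [mul_sub]
    rw [e2, map_sub, integral_sub (integrable_Linfty_mul _ hvi) (integrable_Linfty_mul _ hci), e3,
      hφ]
    ring
  rw [e1, zero_add]
  refine (norm_sub_le _ _).trans ?_
  have b1 := β.le_opNorm (hvc.toLp _)
  rw [norm_toLp_one] at b1
  have b2 := norm_integral_Linfty_mul_le (hmem.toLp φ) (hvi.sub hci)
  have b3 : ‖β‖ * ∫ t, ‖v t - c t‖ ∂m ≤ ε / 2 := by
    refine (mul_le_mul_of_nonneg_left hc (norm_nonneg _)).trans ?_
    rw [mul_div_assoc', div_le_div_iff₀ (by positivity) (by positivity)]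
    nlinarith [norm_nonneg β]
  have b4 : ‖hmem.toLp φ‖ * ∫ t, ‖v t - c t‖ ∂m ≤ ‖β‖ * ∫ t, ‖v t - c t‖ ∂m :=
    mul_le_mul_of_nonneg_right hn (integral_nonneg fun t => norm_nonneg _)
  simp only [Pi.sub_apply] at b2
  linarith

end

section

variable {G : Type*} [Group G] [TopologicalSpace G] [IsTopologicalGroup G]
  [MeasurableSpace G] [BorelSpace G]

/-! ### The Fourier algebra as a normed space -/

/-- The Fourier algebra with its norm. -/
def NormedFourierAlgebra (m : Measure G) [m.IsMulLeftInvariant] : Type _ := ↥(fourierAlgebra m)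

section NormedFourierAlgebra

variable (m : Measure G) [m.IsMulLeftInvariant]

instance : AddCommGroup (NormedFourierAlgebra m) :=
  inferInstanceAs (AddCommGroup ↥(fourierAlgebra m))

instance : Module ℂ (NormedFourierAlgebra m) := inferInstanceAs (Module ℂ ↥(fourierAlgebra m))

instance : NormedAddCommGroup (NormedFourierAlgebra m) := AddGroupNorm.toNormedAddCommGroup
  { toFun := fun u => fourierNorm m u.1
    map_zero' := fourierNorm_zero
    add_le' := fun u v => fourierNorm_add_le u.2 v.2
    neg' := fun u => fourierNorm_neg u.2
    eq_zero_of_map_eq_zero' := fun u hu => Subtype.ext (funext fun s => by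
      have h := norm_apply_le_fourierNorm u.2 s
      rw [hu] at h
      exact norm_le_zero_iff.1 h) }

variable {m}

instance : NormedSpace ℂ (NormedFourierAlgebra m) where
  norm_smul_le c u := fourierNorm_smul_le c u.2

end NormedFourierAlgebra

/-! ### Splitting functionals by Hahn–Banach -/

section Embedding

variable {m : Measure G} [m.IsMulLeftInvariant]

/-- The isometric embedding of `S¹A(G)` into `A(G) ⊕₁ L¹(G)`. -/
def segalEmbedding (m : Measure G) [m.IsMulLeftInvariant] :
    S1A m →ₗᵢ[ℂ] WithLp 1 (NormedFourierAlgebra m × Lp ℂ 1 m) where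
  toFun u := WithLp.toLp 1 (⟨u.1, u.2.1⟩, (memLp_one_iff_integrable.2 u.2.2).toLp u.1)
  map_add' _ _ := rfl
  map_smul' _ _ := rfl
  norm_map' u := by
    refine (WithLp.prod_norm_eq_of_L1 _).trans ?_
    rw [S1A.norm_def]
    exact congrArg (fourierNorm m u.1 + ·) (norm_toLp_one (memLp_one_iff_integrable.2 u.2.2))

/-- A bounded functional on `S¹A(G)` is the sum of bounded functionals on `A(G)` and `L¹(G)`. -/
theorem exists_dual_decomposition (Ψ : StrongDual ℂ (S1A m)) :
    ∃ (α : StrongDual ℂ (NormedFourierAlgebra m)) (β : StrongDual ℂ (Lp ℂ 1 m)),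
      ‖α‖ ≤ ‖Ψ‖ ∧ ‖β‖ ≤ ‖Ψ‖ ∧ ∀ u : S1A m,
        Ψ u = α ⟨u.1, u.2.1⟩ + β ((memLp_one_iff_integrable.2 u.2.2).toLp u.1) := by
  let J := segalEmbedding m
  let f : StrongDual ℂ J.range :=
    Ψ.comp (J.equivRange.symm.toLinearIsometry.toContinuousLinearMap)
  have hf : ‖f‖ ≤ ‖Ψ‖ := f.opNorm_le_bound (norm_nonneg _) fun x =>
    (Ψ.le_opNorm _).trans_eq (congrArg (‖Ψ‖ * ·) (J.equivRange.symm.norm_map x))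
  -- The functional is transported to the range of the embedding and extended to the whole `ℓ¹`-sum
  -- with the same norm; the restrictions to the two summands are then bounded by that norm.
  obtain ⟨g, hg, hgn⟩ := exists_extension_norm_eq J.range f
  have hgΨ : ‖g‖ ≤ ‖Ψ‖ := hgn.trans_le hf
  have hgJ : ∀ u, g (J u) = Ψ u := fun u => by
    have h1 := hg (J.equivRange u)
    have h2 : f (J.equivRange u) = Ψ u := congrArg Ψ (J.equivRange.symm_apply_apply u)
    exact h1.trans h2
  have hb1 : ∀ a : NormedFourierAlgebra m, ‖g (WithLp.toLp 1 (a, 0))‖ ≤ ‖g‖ * ‖a‖ := fun a =>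
    (g.le_opNorm _).trans_eq (by rw [WithLp.prod_norm_eq_of_L1]; simp)
  have hb2 : ∀ b : Lp ℂ 1 m, ‖g (WithLp.toLp 1 (0, b))‖ ≤ ‖g‖ * ‖b‖ := fun b =>
    (g.le_opNorm _).trans_eq (by rw [WithLp.prod_norm_eq_of_L1]; simp)
  refine ⟨LinearMap.mkContinuous
      { toFun := fun a => g (WithLp.toLp 1 (a, 0))
        map_add' := fun a a' => by rw [← map_add, ← WithLp.toLp_add]; simp
        map_smul' := fun c a => by
          rw [RingHom.id_apply, ← map_smul, ← WithLp.toLp_smul]; simp } ‖g‖ hb1,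
    LinearMap.mkContinuous
      { toFun := fun b => g (WithLp.toLp 1 (0, b))
        map_add' := fun a a' => by rw [← map_add, ← WithLp.toLp_add]; simp
        map_smul' := fun c a => by
          rw [RingHom.id_apply, ← map_smul, ← WithLp.toLp_smul]; simp } ‖g‖ hb2,
    (LinearMap.mkContinuous_norm_le _ (norm_nonneg _) _).trans hgΨ,
    (LinearMap.mkContinuous_norm_le _ (norm_nonneg _) _).trans hgΨ, fun u => ?_⟩
  have key : ∀ (a : NormedFourierAlgebra m) (b : Lp ℂ 1 m), g (WithLp.toLp 1 (a, b)) =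
      g (WithLp.toLp 1 (a, 0)) + g (WithLp.toLp 1 (0, b)) := fun a b => by
    rw [← map_add, ← WithLp.toLp_add, Prod.mk_add_mk, add_zero, zero_add]
  rw [← hgJ]
  exact key _ _

end Embedding

variable [LocallyCompactSpace G] {m : Measure G} [m.IsHaarMeasure] [m.InnerRegularCompactLTTop]

/-! ### `VN(G)` is the dual of `A(G)` -/

/-- A coefficient function as an element of the Fourier algebra. -/
def coeffElem (f g : Lp ℂ 2 m) : NormedFourierAlgebra m :=
  ⟨coeffFun m f g, _, _, IsFourierRep.single f g⟩

theorem norm_coeffElem_le (f g : Lp ℂ 2 m) : ‖coeffElem f g‖ ≤ ‖f‖ * ‖g‖ := by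
  refine (IsFourierRep.single f g).fourierNorm_le.trans_eq ?_
  rw [tsum_eq_single 0 fun n hn => by simp [hn]]
  simp

/-- The tail of a representation represents the remainder, so its Fourier norm is at most a tail of
a convergent series. -/
theorem tendsto_sum_coeffElem {f g : ℕ → Lp ℂ 2 m} {u : NormedFourierAlgebra m}
    (h : IsFourierRep m f g u.1) : Tendsto (fun N => ∑ n ∈ Finset.range N, coeffElem (f n) (g n))
      atTop (𝓝 u) := by
  rw [tendsto_iff_norm_sub_tendsto_zero]
  refine squeeze_zero (fun N => norm_nonneg _) (fun N => ?_)
    (tendsto_sum_nat_add fun n => ‖f n‖ * ‖g n‖)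
  rw [norm_sub_rev]
  have hs : (u - ∑ n ∈ Finset.range N, coeffElem (f n) (g n)).1 =
      fun s => u.1 s - ∑ n ∈ Finset.range N, coeffFun m (f n) (g n) s := by
    funext s
    let ev : NormedFourierAlgebra m →ₗ[ℂ] ℂ :=
      { toFun := fun a => a.1 s
        map_add' := fun _ _ => rfl
        map_smul' := fun _ _ => rfl }
    exact (map_sub ev u _).trans (congrArg (u.1 s - ·) (map_sum ev _ _))
  have hrep : IsFourierRep m (fun n => f (n + N)) (fun n => g (n + N))
      (u - ∑ n ∈ Finset.range N, coeffElem (f n) (g n)).1 := by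
    refine ⟨(summable_nat_add_iff N).2 h.summable, fun s => ?_⟩
    rw [hs]
    exact (hasSum_nat_add_iff' N).2 (h.hasSum s)
  exact hrep.fourierNorm_le

/-- Evaluating `α` on single coefficients gives a bounded sesquilinear form, hence an operator `T`;
norm convergence of the series extends the formula to all of `A(G)`. -/
theorem exists_VN_of_dual (α : StrongDual ℂ (NormedFourierAlgebra m)) :
    ∃ T : VN m, ‖T‖ ≤ ‖α‖ ∧ ∀ (u : NormedFourierAlgebra m) (f g : ℕ → Lp ℂ 2 m),
      IsFourierRep m f g u.1 →
        α u = ∑' n, inner ℂ (g n) ((T : Lp ℂ 2 m →L[ℂ] Lp ℂ 2 m) (f n)) := by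
  have hbound : ∀ f g : Lp ℂ 2 m, ‖α (coeffElem f g)‖ ≤ ‖α‖ * (‖f‖ * ‖g‖) := fun f g =>
    (α.le_opNorm _).trans (mul_le_mul_of_nonneg_left (norm_coeffElem_le f g) (norm_nonneg _))
  let B : Lp ℂ 2 m →L⋆[ℂ] Lp ℂ 2 m →L[ℂ] ℂ := LinearMap.mkContinuous₂
    (LinearMap.mk₂'ₛₗ (starRingEnd ℂ) (RingHom.id ℂ) (fun g f => α (coeffElem f g))
      (fun g g' f => by
        rw [← map_add]
        congr 1
        exact Subtype.ext (funext fun s => inner_add_left _ _ _))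
      (fun c g f => by
        rw [← map_smul]
        congr 1
        exact Subtype.ext (funext fun s => inner_smul_left _ _ _))
      (fun g f f' => by
        rw [← map_add]
        congr 1
        refine Subtype.ext (funext fun s => ?_)
        change inner ℂ g (leftReg m s (f + f')) = _
        rw [map_add, inner_add_right]
        rfl)
      (fun c g f => by
        rw [← map_smul]
        congr 1
        refine Subtype.ext (funext fun s => ?_)
        change inner ℂ g (leftReg m s (c • f)) = _
        rw [map_smul, inner_smul_right]
        rfl)) ‖α‖ fun g f => (hbound f g).trans_eq (by ring)
  let T : Lp ℂ 2 m →L[ℂ] Lp ℂ 2 m :=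
    ContinuousLinearMap.adjoint (InnerProductSpace.continuousLinearMapOfBilin B)
  have hT : ∀ f g, inner ℂ g (T f) = α (coeffElem f g) := fun f g => by
    rw [ContinuousLinearMap.adjoint_inner_right,
      InnerProductSpace.continuousLinearMapOfBilin_apply]
    rfl
  -- For `S` in the commutant, the coefficient of `S x` and `g` is that of `x` and the adjoint of
  -- `S` applied to `g`; so `T` commutes with `S`.
  have hVN : T ∈ (groupVN m).toStarSubalgebra := by
    rw [mem_groupVN_iff]
    intro S hS x
    refine ext_inner_left ℂ fun g => ?_
    rw [hT, ← ContinuousLinearMap.adjoint_inner_left, hT]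
    congr 1
    refine Subtype.ext (funext fun s => ?_)
    change inner ℂ g (leftReg m s (S x)) = inner ℂ _ (leftReg m s x)
    rw [← hS, ContinuousLinearMap.adjoint_inner_left]
  have hnorm : ‖T‖ ≤ ‖α‖ := T.opNorm_le_bound (norm_nonneg _) fun f => by
    have h1 := hbound f (T f)
    rw [← hT, inner_self_eq_norm_sq_to_K, norm_pow] at h1
    simp only [Complex.coe_algebraMap, Complex.norm_real, norm_norm] at h1
    rcases (norm_nonneg (T f)).eq_or_lt with h2 | h2
    · rw [← h2]
      positivity
    · nlinarith
  refine ⟨⟨T, hVN⟩, hnorm, fun u f g h => ?_⟩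
  refine tendsto_nhds_unique ((α.continuous.tendsto u).comp (tendsto_sum_coeffElem h)) ?_
  have h1 := (summable_inner_apply h.summable T).hasSum.tendsto_sum_nat
  refine h1.congr fun N => ?_
  rw [Function.comp_apply, map_sum]
  exact Finset.sum_congr rfl fun n _ => hT _ _

/-! ### The operators `Λ(φ)` -/

theorem IsConvolutionOperator.add {φ φ' : Lp ℂ ∞ m} {T T' : Lp ℂ 2 m →L[ℂ] Lp ℂ 2 m}
    (hT : IsConvolutionOperator m φ T) (hT' : IsConvolutionOperator m φ' T') :
    IsConvolutionOperator m (φ + φ') (T + T') := fun f hf => by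
  rw [conv_add hf]
  exact (Lp.coeFn_add _ _).trans ((hT f hf).add (hT' f hf))

theorem IsConvolutionOperator.smul {φ : Lp ℂ ∞ m} {T : Lp ℂ 2 m →L[ℂ] Lp ℂ 2 m}
    (hT : IsConvolutionOperator m φ T) (c : ℂ) :
    IsConvolutionOperator m (c • φ) (c • T) := fun f hf => by
  rw [conv_smul]
  exact (Lp.coeFn_smul _ _).trans ((hT f hf).const_smul c)

/-- The operator `Λ(φ)` of convolution by a convolver `φ`. -/
def convOperator (m : Measure G) [m.IsHaarMeasure] [m.InnerRegularCompactLTTop] :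
    convInfty m →ₗ[ℂ] VN m where
  toFun φ := ⟨(IsConvolver.exists_operator φ.2).choose,
    (IsConvolver.exists_operator φ.2).choose_spec.mem_groupVN⟩
  map_add' φ ψ := Subtype.ext <| (IsConvolver.exists_operator (φ + ψ).2).choose_spec.unique
    ((IsConvolver.exists_operator φ.2).choose_spec.add
      (IsConvolver.exists_operator ψ.2).choose_spec)
  map_smul' c φ := Subtype.ext <| (IsConvolver.exists_operator (c • φ).2).choose_spec.unique
    ((IsConvolver.exists_operator φ.2).choose_spec.smul c)

theorem isConvolutionOperator_convOperator (φ : convInfty m) :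
    IsConvolutionOperator m φ (convOperator m φ : Lp ℂ 2 m →L[ℂ] Lp ℂ 2 m) :=
  (IsConvolver.exists_operator φ.2).choose_spec

end

section

variable {G : Type*} [Group G] [TopologicalSpace G] [IsTopologicalGroup G]
  [MeasurableSpace G] [BorelSpace G]
  [LocallyCompactSpace G] {m : Measure G} [m.IsHaarMeasure] [m.InnerRegularCompactLTTop]

/-! ### The functionals on `S¹A(G)` -/

theorem IsFourierRep.exists_add_pairing {f g f' g' : ℕ → Lp ℂ 2 m} {u v : G → ℂ}
    (h : IsFourierRep m f g u) (h' : IsFourierRep m f' g' v) :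
    ∃ F K : ℕ → Lp ℂ 2 m, IsFourierRep m F K (u + v) ∧ ∀ T : Lp ℂ 2 m →L[ℂ] Lp ℂ 2 m,
      ∑' n, inner ℂ (K n) (T (F n)) =
        ∑' n, inner ℂ (g n) (T (f n)) + ∑' n, inner ℂ (g' n) (T (f' n)) := by
  let e := Equiv.natSumNatEquivNat.symm
  let F : ℕ ⊕ ℕ → Lp ℂ 2 m := Sum.elim f f'
  let K : ℕ ⊕ ℕ → Lp ℂ 2 m := Sum.elim g g'
  refine ⟨F ∘ e, K ∘ e, ⟨?_, fun s => ?_⟩, fun T => ?_⟩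
  · exact ((e.hasSum_iff (f := fun i => ‖F i‖ * ‖K i‖)).2
      (HasSum.sum h.summable.hasSum h'.summable.hasSum)).summable
  · exact (e.hasSum_iff (f := fun i => coeffFun m (F i) (K i) s)).2
      (HasSum.sum (h.hasSum s) (h'.hasSum s))
  · exact ((e.hasSum_iff (f := fun i => inner ℂ (K i) (T (F i)))).2
      (HasSum.sum (summable_inner_apply h.summable T).hasSum
        (summable_inner_apply h'.summable T).hasSum)).tsum_eq

open Classical in
/-- The pairing of `VN(G)` with `A(G)`. -/
def vnPairing (T : VN m) (u : G → ℂ) : ℂ :=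
  if h : ∃ f g : ℕ → Lp ℂ 2 m, IsFourierRep m f g u then
    ∑' n, inner ℂ (h.choose_spec.choose n) ((T : Lp ℂ 2 m →L[ℂ] Lp ℂ 2 m) (h.choose n))
  else 0

theorem vnPairing_eq (T : VN m) {u : G → ℂ} {f g : ℕ → Lp ℂ 2 m} (h : IsFourierRep m f g u) :
    vnPairing T u = ∑' n, inner ℂ (g n) ((T : Lp ℂ 2 m →L[ℂ] Lp ℂ 2 m) (f n)) := by
  have h' : ∃ f g : ℕ → Lp ℂ 2 m, IsFourierRep m f g u := ⟨f, g, h⟩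
  rw [vnPairing, dif_pos h']
  exact tsum_inner_eq_of_isFourierRep T.2 h'.choose_spec.choose_spec h

theorem norm_vnPairing_le (T : VN m) {u : G → ℂ} (hu : u ∈ fourierAlgebra m) :
    ‖vnPairing T u‖ ≤ ‖(T : Lp ℂ 2 m →L[ℂ] Lp ℂ 2 m)‖ * fourierNorm m u := by
  rcases (norm_nonneg (T : Lp ℂ 2 m →L[ℂ] Lp ℂ 2 m)).eq_or_lt with hT | hT
  · obtain ⟨f, g, h⟩ := hu
    rw [vnPairing_eq T h, norm_eq_zero.1 hT.symm]
    simp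
  rw [← div_le_iff₀' hT]
  refine le_fourierNorm hu fun f g h => ?_
  rw [div_le_iff₀' hT, vnPairing_eq T h]
  exact norm_tsum_inner_apply_le h.summable _

theorem vnPairing_add_right (T : VN m) {u v : G → ℂ} (hu : u ∈ fourierAlgebra m)
    (hv : v ∈ fourierAlgebra m) : vnPairing T (u + v) = vnPairing T u + vnPairing T v := by
  obtain ⟨f, g, h⟩ := hu
  obtain ⟨f', g', h'⟩ := hv
  obtain ⟨F, K, H, hFK⟩ := h.exists_add_pairing h'
  rw [vnPairing_eq T h, vnPairing_eq T h', vnPairing_eq T H, hFK]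

theorem vnPairing_smul_right (T : VN m) (c : ℂ) {u : G → ℂ} (hu : u ∈ fourierAlgebra m) :
    vnPairing T (c • u) = c * vnPairing T u := by
  obtain ⟨f, g, h⟩ := hu
  rw [vnPairing_eq T h, vnPairing_eq T (h.smul c), ← tsum_mul_left]
  exact tsum_congr fun n => by rw [map_smul, inner_smul_right]

theorem vnPairing_add_left (T T' : VN m) {u : G → ℂ} (hu : u ∈ fourierAlgebra m) :
    vnPairing (T + T') u = vnPairing T u + vnPairing T' u := by
  obtain ⟨f, g, h⟩ := hu
  rw [vnPairing_eq T h, vnPairing_eq T' h, vnPairing_eq (T + T') h,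
    ← (summable_inner_apply h.summable _).tsum_add (summable_inner_apply h.summable _)]
  exact tsum_congr fun n => inner_add_right _ _ _

theorem vnPairing_smul_left (c : ℂ) (T : VN m) {u : G → ℂ} (hu : u ∈ fourierAlgebra m) :
    vnPairing (c • T) u = c * vnPairing T u := by
  obtain ⟨f, g, h⟩ := hu
  rw [vnPairing_eq T h, vnPairing_eq (c • T) h, ← tsum_mul_left]
  exact tsum_congr fun n => inner_smul_right _ _ _

theorem integral_Linfty_add_mul (φ ψ : Lp ℂ ∞ m) {u : G → ℂ} (hu : Integrable u m) :
    ∫ s, (φ + ψ : Lp ℂ ∞ m) s * u s ∂m = ∫ s, φ s * u s ∂m + ∫ s, ψ s * u s ∂m := by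
  rw [← integral_add (integrable_Linfty_mul φ hu) (integrable_Linfty_mul ψ hu)]
  refine integral_congr_ae ?_
  filter_upwards [Lp.coeFn_add φ ψ] with s hs
  rw [hs, Pi.add_apply, add_mul]

theorem integral_Linfty_smul_mul (c : ℂ) (φ : Lp ℂ ∞ m) (u : G → ℂ) :
    ∫ s, (c • φ : Lp ℂ ∞ m) s * u s ∂m = c * ∫ s, φ s * u s ∂m := by
  rw [← integral_const_mul]
  refine integral_congr_ae ?_
  filter_upwards [Lp.coeFn_smul c φ] with s hs
  rw [hs, Pi.smul_apply, smul_eq_mul, mul_assoc]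

theorem integral_Linfty_neg_mul (φ : Lp ℂ ∞ m) (u : G → ℂ) :
    ∫ s, (-φ : Lp ℂ ∞ m) s * u s ∂m = -∫ s, φ s * u s ∂m := by
  rw [← neg_one_smul ℂ φ, integral_Linfty_smul_mul, neg_one_mul]

theorem integral_Linfty_mul_add (φ : Lp ℂ ∞ m) {u v : G → ℂ} (hu : Integrable u m)
    (hv : Integrable v m) :
    ∫ s, φ s * (u + v) s ∂m = ∫ s, φ s * u s ∂m + ∫ s, φ s * v s ∂m := by
  rw [← integral_add (integrable_Linfty_mul φ hu) (integrable_Linfty_mul φ hv)]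
  simp only [Pi.add_apply, mul_add]

theorem integral_Linfty_mul_smul (c : ℂ) (φ : Lp ℂ ∞ m) (u : G → ℂ) :
    ∫ s, φ s * (c • u) s ∂m = c * ∫ s, φ s * u s ∂m := by
  rw [← integral_const_mul]
  simp only [Pi.smul_apply, smul_eq_mul, mul_left_comm]

theorem norm_pairing_le (T : VN m) (φ : Lp ℂ ∞ m) {u : G → ℂ} (hu : u ∈ fourierAlgebra m)
    (hu' : Integrable u m) : ‖vnPairing T u + ∫ s, φ s * u s ∂m‖ ≤
      max ‖(T : Lp ℂ 2 m →L[ℂ] Lp ℂ 2 m)‖ ‖φ‖ * (fourierNorm m u + ∫ s, ‖u s‖ ∂m) := by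
  refine (norm_add_le _ _).trans ?_
  rw [mul_add]
  refine add_le_add ((norm_vnPairing_le T hu).trans ?_)
    ((norm_integral_Linfty_mul_le φ hu').trans ?_)
  · exact mul_le_mul_of_nonneg_right (le_max_left _ _) (fourierNorm_nonneg _)
  · exact mul_le_mul_of_nonneg_right (le_max_right _ _) (integral_nonneg fun _ => norm_nonneg _)

/-- The functional `u ↦ ⟨T, u⟩ + ∫ φ u` on `S¹A(G)`. -/
def segalFunctional (T : VN m) (φ : Lp ℂ ∞ m) : StrongDual ℂ (S1A m) :=
  LinearMap.mkContinuous
    { toFun := fun u => vnPairing T u.1 + ∫ s, φ s * u.1 s ∂m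
      map_add' := fun u v => (congrArg₂ (· + ·) (vnPairing_add_right T u.2.1 v.2.1)
        (integral_Linfty_mul_add φ u.2.2 v.2.2)).trans (add_add_add_comm _ _ _ _)
      map_smul' := fun c u => (congrArg₂ (· + ·) (vnPairing_smul_right T c u.2.1)
        (integral_Linfty_mul_smul c φ u.1)).trans (mul_add _ _ _).symm }
    (max ‖(T : Lp ℂ 2 m →L[ℂ] Lp ℂ 2 m)‖ ‖φ‖) fun u => norm_pairing_le T φ u.2.1 u.2.2

theorem norm_segalFunctional_le (T : VN m) (φ : Lp ℂ ∞ m) :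
    ‖segalFunctional T φ‖ ≤ max ‖(T : Lp ℂ 2 m →L[ℂ] Lp ℂ 2 m)‖ ‖φ‖ :=
  LinearMap.mkContinuous_norm_le _ (le_max_of_le_left (norm_nonneg _)) _

/-- The map `(T, φ) ↦ (u ↦ ⟨T, u⟩ + ∫ φ u)`. -/
def segalPairing (m : Measure G) [m.IsHaarMeasure] [m.InnerRegularCompactLTTop] :
    (VN m × Lp ℂ ∞ m) →ₗ[ℂ] StrongDual ℂ (S1A m) where
  toFun x := segalFunctional x.1 x.2
  map_add' x y := ContinuousLinearMap.ext fun u => (congrArg₂ (· + ·)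
    (vnPairing_add_left x.1 y.1 u.2.1) (integral_Linfty_add_mul x.2 y.2 u.2.2)).trans
      (add_add_add_comm _ _ _ _)
  map_smul' c x := ContinuousLinearMap.ext fun u => (congrArg₂ (· + ·)
    (vnPairing_smul_left c x.1 u.2.1) (integral_Linfty_smul_mul c x.2 u.1)).trans
      (mul_add _ _ _).symm

theorem norm_segalPairing_le (x : VN m × Lp ℂ ∞ m) : ‖segalPairing m x‖ ≤ ‖x‖ :=
  norm_segalFunctional_le x.1 x.2

/-- Every functional on `S¹A(G)` comes from a pair of no larger norm. -/
theorem exists_segalPairing_eq (Ψ : StrongDual ℂ (S1A m)) :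
    ∃ x : VN m × Lp ℂ ∞ m, ‖x‖ ≤ ‖Ψ‖ ∧ segalPairing m x = Ψ := by
  obtain ⟨α, β, hα, hβ, hΨ⟩ := exists_dual_decomposition Ψ
  obtain ⟨T, hT, hTα⟩ := exists_VN_of_dual α
  obtain ⟨φ, hφ, hφβ⟩ := exists_Linfty_representation β
  refine ⟨(T, φ), max_le (hT.trans hα) (hφ.trans hβ), ContinuousLinearMap.ext fun u => ?_⟩
  obtain ⟨f, g, h⟩ := u.2.1
  refine Eq.trans ?_ (hΨ u).symm
  exact congrArg₂ (· + ·) ((vnPairing_eq T h).trans (hTα ⟨u.1, u.2.1⟩ f g h).symm)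
    (hφβ u.1 (memLp_one_iff_integrable.2 u.2.2)).symm

/-- Forward, `C_c` coefficient functions detect the convolution; backward is the formula `⟨Λ(φ), u⟩
= ∫ φ u`, valid on all of `A(G) ∩ L¹(G)`. -/
theorem segalPairing_eq_zero_iff {T : VN m} {φ : Lp ℂ ∞ m} : segalPairing m (T, φ) = 0 ↔
    IsConvolutionOperator m (-φ) (T : Lp ℂ 2 m →L[ℂ] Lp ℂ 2 m) := by
  constructor
  · intro h0
    refine isConvolutionOperator_of_tsum_inner_eq fun f g u h hu => ?_
    have h1 : vnPairing T u + ∫ s, φ s * u s ∂m = 0 :=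
      congrArg (fun F : StrongDual ℂ (S1A m) => F ⟨u, ⟨f, g, h⟩, hu⟩) h0
    rw [integral_Linfty_neg_mul, ← vnPairing_eq T h]
    exact eq_neg_of_add_eq_zero_left h1
  · refine fun hT => ContinuousLinearMap.ext fun u => ?_
    obtain ⟨f, g, h⟩ := u.2.1
    have h1 := hT.tsum_inner_eq h u.2.2
    rw [← vnPairing_eq T h, integral_Linfty_neg_mul] at h1
    exact eq_neg_iff_add_eq_zero.1 h1

theorem ker_segalPairing :
    LinearMap.ker (segalPairing m) = convolverGraph m (convOperator m) := by
  refine Submodule.ext fun x => ?_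
  obtain ⟨T, φ⟩ := x
  refine (LinearMap.mem_ker.trans segalPairing_eq_zero_iff).trans ⟨fun hT => ?_, ?_⟩
  · exact ⟨⟨-φ, hT.isConvolver⟩, Prod.ext
      (Subtype.ext ((isConvolutionOperator_convOperator _).unique hT)) (neg_neg φ)⟩
  · rintro ⟨ψ, hψ⟩
    obtain ⟨h1, h2⟩ := Prod.ext_iff.1 hψ
    have h1 : convOperator m ψ = T := h1
    have h2 : -(ψ : Lp ℂ ∞ m) = φ := h2
    rw [← h1, ← h2, neg_neg]
    exact isConvolutionOperator_convOperator ψ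

/-- The linear isomorphism of the quotient with the dual of `S¹A(G)`. -/
def segalDualLinearEquiv (m : Measure G) [m.IsHaarMeasure] [m.InnerRegularCompactLTTop] :
    ((VN m × Lp ℂ ∞ m) ⧸ convolverGraph m (convOperator m)) ≃ₗ[ℂ] StrongDual ℂ (S1A m) :=
  (Submodule.quotEquivOfEq _ _ (ker_segalPairing (m := m)).symm).trans
    ((segalPairing m).quotKerEquivOfSurjective
      fun Ψ => (exists_segalPairing_eq Ψ).imp fun _ h => h.2)

theorem segalDualLinearEquiv_mk (x : VN m × Lp ℂ ∞ m) :
    segalDualLinearEquiv m (Submodule.Quotient.mk x) = segalPairing m x := rfl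

theorem mk_eq_mk_iff_segalPairing {x y : VN m × Lp ℂ ∞ m} :
    (Submodule.Quotient.mk x : (VN m × Lp ℂ ∞ m) ⧸ convolverGraph m (convOperator m)) =
      Submodule.Quotient.mk y ↔ segalPairing m x = segalPairing m y := by
  rw [← segalDualLinearEquiv_mk, ← segalDualLinearEquiv_mk]
  exact (segalDualLinearEquiv m).injective.eq_iff.symm

/-- The upper bound holds because the pairing is a contraction on every representative of the class,
the lower one because some representative has norm at most that of the functional. -/
theorem norm_segalDualLinearEquiv (q : (VN m × Lp ℂ ∞ m) ⧸ convolverGraph m (convOperator m)) :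
    ‖segalDualLinearEquiv m q‖ = ‖q‖ := by
  obtain ⟨x, rfl⟩ := Submodule.Quotient.mk_surjective _ q
  rw [segalDualLinearEquiv_mk]
  refine le_antisymm ?_ ?_
  · refine le_of_forall_pos_le_add fun ε hε => ?_
    obtain ⟨y, hy, hy'⟩ := Submodule.Quotient.norm_mk_lt
      (Submodule.Quotient.mk x : (VN m × Lp ℂ ∞ m) ⧸ convolverGraph m (convOperator m)) hε
    rw [← mk_eq_mk_iff_segalPairing.1 hy]
    exact (norm_segalPairing_le y).trans hy'.le
  · obtain ⟨y, hy, hyx⟩ := exists_segalPairing_eq (segalPairing m x)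
    rw [← mk_eq_mk_iff_segalPairing.2 hyx]
    exact (Submodule.Quotient.norm_mk_le _ y).trans hy

/-- The isometric isomorphism of the quotient with the dual of `S¹A(G)`. -/
def segalDualEquiv (m : Measure G) [m.IsHaarMeasure] [m.InnerRegularCompactLTTop] :
    ((VN m × Lp ℂ ∞ m) ⧸ convolverGraph m (convOperator m)) ≃ₗᵢ[ℂ] StrongDual ℂ (S1A m) :=
  ⟨segalDualLinearEquiv m, norm_segalDualLinearEquiv⟩

theorem isClosed_convolverGraph :
    IsClosed (convolverGraph m (convOperator m) : Set (VN m × Lp ℂ ∞ m)) := by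
  have hc : Continuous (segalPairing m) :=
    AddMonoidHomClass.continuous_of_bound (segalPairing m) 1 fun x =>
      (norm_segalPairing_le x).trans_eq (one_mul _).symm
  rw [← ker_segalPairing]
  exact isClosed_singleton.preimage hc

end

end SegalFourier

end

/-! ### The duality theorem -/

theorem theorem2p3 {G : Type*} [Group G] [TopologicalSpace G] [IsTopologicalGroup G]
    [LocallyCompactSpace G] [T2Space G] [MeasurableSpace G] [BorelSpace G]
    (m : MeasureTheory.Measure G) [m.IsHaarMeasure] [m.InnerRegularCompactLTTop] :
    ∃ Λ : SegalFourier.convInfty m →ₗ[ℂ] SegalFourier.VN m,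
      -- `Λ(φ)` is the unique bounded extension of `f ↦ φ ∗ f`
      (∀ (φ : SegalFourier.convInfty m) (T : Lp ℂ 2 m →L[ℂ] Lp ℂ 2 m),
        SegalFourier.IsConvolutionOperator m φ T ↔ T = Λ φ) ∧
      -- the isometric isomorphism, induced by `⟨(T, φ), u⟩ = ⟨T, u⟩ + ∫ φ u dm`
      (∃ Φ : ((SegalFourier.VN m × Lp ℂ ∞ m) ⧸ SegalFourier.convolverGraph m Λ) ≃ₗᵢ[ℂ]
          StrongDual ℂ (SegalFourier.S1A m),
        ∀ (T : SegalFourier.VN m) (φ : Lp ℂ ∞ m) (u : SegalFourier.S1A m)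
          (f g : ℕ → Lp ℂ 2 m), SegalFourier.IsFourierRep m f g u →
          Φ (Submodule.Quotient.mk (T, φ)) u =
            (∑' n, inner ℂ (g n) ((T : Lp ℂ 2 m →L[ℂ] Lp ℂ 2 m) (f n))) +
              ∫ s, φ s * u s ∂m) ∧
      IsClosed (SegalFourier.convolverGraph m Λ : Set (SegalFourier.VN m × Lp ℂ ∞ m)) ∧
      ∃ e : SegalFourier.convInfty m ≃ₗ[ℂ] SegalFourier.convolverGraph m Λ,
        ∀ φ, (e φ : SegalFourier.VN m × Lp ℂ ∞ m) = (Λ φ, -(φ : Lp ℂ ∞ m)) := by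
  refine ⟨SegalFourier.convOperator m, fun φ T => ⟨fun hT => ?_, ?_⟩,
    ⟨SegalFourier.segalDualEquiv m, fun T φ u f g h => ?_⟩,
    SegalFourier.isClosed_convolverGraph, ?_⟩
  · exact hT.unique (SegalFourier.isConvolutionOperator_convOperator φ)
  · rintro rfl
    exact SegalFourier.isConvolutionOperator_convOperator φ
  · exact congrArg (· + ∫ s, φ s * u.1 s ∂m) (SegalFourier.vnPairing_eq T h)
  -- The second coordinate already determines `φ`.
  · exact ⟨LinearEquiv.ofInjective _ fun φ ψ h => Subtype.ext (neg_injective (congrArg Prod.snd h)),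
      fun φ => rfl⟩
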